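/- Let $d\ge 3$ and let $B\subset\mathbb{R}^d$ be a ball. There is a constant $\varepsilon=\varepsilon(d,B)>0$ such that the following holds. Let $\gamma_1,\gamma_2\in W^{1,\infty}(\mathbb{R}^d)$ be real-valued with $\gamma_i>c>0$ and $\gamma_i=1$ outside $B$. Put $g_i=\gamma_i^{1/2}$ and let $q_i=g_i^{-1}\Delta g_i$ be the corresponding potential; multiplication by $q_i$ is defined by $$\langle m_{q_i}(u),v\rangle=-\int_{\mathbb{R}^d}\nabla g_i\cdot\nabla(g_i^{-1}uv)\,dx ,$$ and $q_i$ is the tempered distribution $v\mapsto\langle m_{q_i}(1),v\rangle$. For $\zeta\in\mathbb{C}^d$ let $p_\zeta(\xi)=-|\xi|^2+2i\zeta\cdot\xi$ (where $\cdot$ is bilinear), and for $b\in\mathbb{R}$ let $$\|u\|_{\dot X^b_\zeta}=\big\|\,|p_\zeta(\xi)|^b\,\hat u(\xi)\big\|_{L^2_\xi}$$ for tempered distributions $u$ ($=\infty$ if $\hat u$ is not a function), where $\hat u(\xi)=(2\pi)^{-d/2}\int e^{-ix\cdot\xi}u(x)\,dx$. Then for every fixed $k\in\mathbb{R}^d$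 there are sequences $s^{(n)},r^{(n)}\in\mathbb{R}$ with $s^{(n)}\to\infty$ and unit vectors $\eta_1^{(n)},\eta_2^{(n)}\in\mathbb{R}^d$ with $k,\eta_1^{(n)},\eta_2^{(n)}$ pairwise orthogonal and $|k|^2/4+(r^{(n)})^2=(s^{(n)})^2$, such that for the pairs $$\zeta_1^{(n)}=s^{(n)}\eta_1^{(n)}+i\Big(\frac k2+r^{(n)}\eta_2^{(n)}\Big),\qquad \zeta_2^{(n)}=-s^{(n)}\eta_1^{(n)}+i\Big(\frac k2-r^{(n)}\eta_2^{(n)}\Big)$$ the following holds. (a) $\|q_i\|_{\dot X^{-1/2}_{\zeta_j^{(n)}}}\to 0$ as $n\to\infty$, for all $i,j\in\{1,2\}$. (b) For each $i\in\{1,2\}$ such that $\|\nabla\log\gamma_i\|_{L^\infty(\mathbb{R}^d)}\le\varepsilon$ or $\gamma_i\in C^1(\mathbb{R}^d)$, there are functions $\psi_i^{(n)}$ (defining tempered distributions) such that for every $n$ the function $u_i^{(n)}=e^{x\cdot\zeta_i^{(n)}}\big(1+\psi_i^{(n)}\big)$ belongs to $H^1_{\mathrm{loc}}(\mathbb{R}^d)$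 and solves $(-\Delta+q_i)u_i^{(n)}=0$ weakly, that is, $\int\nabla u_i^{(n)}\cdot\nabla\varphi\,dx+\langle m_{q_i}(u_i^{(n)}),\varphi\rangle=0$ for all $\varphi\in C_c^\infty(\mathbb{R}^d)$, and $$\|\psi_i^{(n)}\|_{\dot X^{1/2}_{\zeta_i^{(n)}}}\to 0\quad\text{as } n\to\infty .$$ -/

import Mathlib

open MeasureTheory Filter Topology
open scoped ENNReal ContDiff

namespace CGO

/-- `G` is the weak (distributional) gradient of the locally integrable function `f` on `ℝ^d`:
`∫ f ∂_j φ = -∫ G_j φ` for every `j` and every `φ ∈ C_c^∞`. -/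
def HasWeakGrad {d : ℕ} (f : EuclideanSpace ℝ (Fin d) → ℂ)
    (G : EuclideanSpace ℝ (Fin d) → EuclideanSpace ℂ (Fin d)) : Prop :=
  LocallyIntegrable f volume ∧ LocallyIntegrable G volume ∧
    ∀ (j : Fin d) (φ : EuclideanSpace ℝ (Fin d) → ℂ), ContDiff ℝ ∞ φ → HasCompactSupport φ →
      ∫ x, f x * fderiv ℝ φ x (EuclideanSpace.single j 1) = -∫ x, G x j * φ x

open Classical in
/-- The weak gradient `∇f` of a function that has one (it is unique almost everywhere); the value
is `0` for functions without a weak gradient. -/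
noncomputable def weakGrad {d : ℕ} (f : EuclideanSpace ℝ (Fin d) → ℂ) :
    EuclideanSpace ℝ (Fin d) → EuclideanSpace ℂ (Fin d) :=
  if h : ∃ G, HasWeakGrad f G then h.choose else 0

/-- `γ ∈ W^{1,∞}(ℝ^d)`: `γ` and its weak gradient are in `L^∞`. -/
def MemW1Inf {d : ℕ} (γ : EuclideanSpace ℝ (Fin d) → ℝ) : Prop :=
  MemLp γ ∞ volume ∧ ∃ G, HasWeakGrad (fun x => (γ x : ℂ)) G ∧ MemLp G ∞ volume

/-- `γ ∈ C^1(ℝ^d)`, for a function defined up to null sets. -/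
def IsC1 {d : ℕ} (γ : EuclideanSpace ℝ (Fin d) → ℝ) : Prop :=
  ∃ h : EuclideanSpace ℝ (Fin d) → ℝ, ContDiff ℝ 1 h ∧ γ =ᵐ[volume] h

/-- `‖∇ log γ‖_{L^∞(ℝ^d)}`. -/
noncomputable def gradLogNorm {d : ℕ} (γ : EuclideanSpace ℝ (Fin d) → ℝ) : ℝ≥0∞ :=
  eLpNorm (weakGrad (fun x => (Real.log (γ x) : ℂ))) ∞ volume

/-- `u ∈ H^1_loc(ℝ^d)`. -/
def MemH1Loc {d : ℕ} (u : EuclideanSpace ℝ (Fin d) → ℂ) : Prop :=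
  (∀ K : Set (EuclideanSpace ℝ (Fin d)), IsCompact K → MemLp u 2 (volume.restrict K)) ∧
    ∃ G, HasWeakGrad u G ∧
      ∀ K : Set (EuclideanSpace ℝ (Fin d)), IsCompact K → MemLp G 2 (volume.restrict K)

/-- The pairing `⟨m_q(u), v⟩ = -∫ ∇g · ∇(g⁻¹ u v) dx` with `g = γ^{1/2}`, which defines
multiplication by the potential `q = g⁻¹ Δ g`. -/
noncomputable def mq {d : ℕ} (γ : EuclideanSpace ℝ (Fin d) → ℝ)
    (u v : EuclideanSpace ℝ (Fin d) → ℂ) : ℂ :=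
  -∫ x, ∑ j : Fin d, weakGrad (fun y => (Real.sqrt (γ y) : ℂ)) x j *
      weakGrad (fun y => (Real.sqrt (γ y) : ℂ)⁻¹ * u y * v y) x j

/-- The tempered distribution `Q` is the potential `q = γ^{-1/2} Δ γ^{1/2}`:
`⟨Q, v⟩ = ⟨m_q(1), v⟩` for all Schwartz functions `v`. -/
def IsPotential {d : ℕ} (γ : EuclideanSpace ℝ (Fin d) → ℝ)
    (Q : TemperedDistribution (EuclideanSpace ℝ (Fin d)) ℂ) : Prop :=
  ∀ v : SchwartzMap (EuclideanSpace ℝ (Fin d)) ℂ, Q v = mq γ (fun _ => 1) v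

/-- `u ∈ H^1_loc` is a weak solution of `(-Δ + q) u = 0`, where `q = γ^{-1/2} Δ γ^{1/2}`:
`∫ ∇u · ∇φ + ⟨m_q(u), φ⟩ = 0` for every `φ ∈ C_c^∞`. -/
def IsSchrodingerSolution {d : ℕ} (γ : EuclideanSpace ℝ (Fin d) → ℝ)
    (u : EuclideanSpace ℝ (Fin d) → ℂ) : Prop :=
  MemH1Loc u ∧
    ∀ φ : EuclideanSpace ℝ (Fin d) → ℂ, ContDiff ℝ ∞ φ → HasCompactSupport φ →
      (∫ x, ∑ j : Fin d, weakGrad u x j * fderiv ℝ φ x (EuclideanSpace.single j 1))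
        + mq γ u φ = 0

/-- The tempered distribution `T` is the function `f`. -/
def IsFunction {d : ℕ} (T : TemperedDistribution (EuclideanSpace ℝ (Fin d)) ℂ)
    (f : EuclideanSpace ℝ (Fin d) → ℂ) : Prop :=
  ∀ φ : SchwartzMap (EuclideanSpace ℝ (Fin d)) ℂ,
    Integrable (fun x => f x * φ x) volume ∧ T φ = ∫ x, f x * φ x

/-- `x · ζ = ∑_j x_j ζ_j` for `x ∈ ℝ^d`, `ζ ∈ ℂ^d`. -/
noncomputable def cdot {d : ℕ} (x : EuclideanSpace ℝ (Fin d)) (ζ : Fin d → ℂ) : ℂ :=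
  ∑ j, (x j : ℂ) * ζ j

/-- `p_ζ(ξ) = -|ξ|² + 2 i ζ · ξ`, the symbol of `Δ_ζ = Δ + 2 ζ · ∇`. -/
noncomputable def symbol {d : ℕ} (ζ : Fin d → ℂ) (ξ : EuclideanSpace ℝ (Fin d)) : ℂ :=
  -((‖ξ‖ ^ 2 : ℝ) : ℂ) + 2 * Complex.I * cdot ξ ζ

/-- The norm `‖T‖_{Ẋ^b_ζ} = ‖ |p_ζ|^b T̂ ‖_{L²}` of a tempered distribution, with value `∞` if `T̂`
is not a function. (The function `F` below is unique almost everywhere, so that the infimum is over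
at most one value.) The Fourier transform in Mathlib is `∫ e^{-2πi x·ξ} u(x) dx`, so that `∂_j`
becomes multiplication by `2πi ξ_j` and the symbol is taken at `2πξ`; after the change of variables
`ξ ↦ ξ / 2π` this is the norm for the unitary transform `(2π)^{-d/2} ∫ e^{-i x·ξ} u(x) dx`. -/
noncomputable def XNorm {d : ℕ} (b : ℝ) (ζ : Fin d → ℂ)
    (T : TemperedDistribution (EuclideanSpace ℝ (Fin d)) ℂ) : ℝ≥0∞ :=
  ⨅ (F : EuclideanSpace ℝ (Fin d) → ℂ) (_ : IsFunction (FourierTransform.fourier T) F),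
    eLpNorm (fun ξ => ((‖symbol ζ ((2 * Real.pi) • ξ)‖ ^ b : ℝ) : ℂ) * F ξ) 2 volume

/-- The admissible parameters: `η₁, η₂` are unit vectors, `k, η₁, η₂` are pairwise orthogonal and
`|k|²/4 + r² = s²`. -/
def Admissible {d : ℕ} (k : EuclideanSpace ℝ (Fin d)) (s r : ℝ)
    (η₁ η₂ : EuclideanSpace ℝ (Fin d)) : Prop :=
  ‖η₁‖ = 1 ∧ ‖η₂‖ = 1 ∧ inner ℝ k η₁ = 0 ∧ inner ℝ k η₂ = 0 ∧ inner ℝ η₁ η₂ = 0 ∧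
    ‖k‖ ^ 2 / 4 + r ^ 2 = s ^ 2

/-- The pair `ζ₁ = s η₁ + i (k/2 + r η₂)`, `ζ₂ = -s η₁ + i (k/2 - r η₂)`. -/
noncomputable def zeta {d : ℕ} (k : EuclideanSpace ℝ (Fin d)) (s r : ℝ)
    (η₁ η₂ : EuclideanSpace ℝ (Fin d)) : Fin 2 → Fin d → ℂ :=
  ![fun j => (s : ℂ) * (η₁ j : ℂ) + Complex.I * ((k j : ℂ) / 2 + (r : ℂ) * (η₂ j : ℂ)),
    fun j => -(s : ℂ) * (η₁ j : ℂ) + Complex.I * ((k j : ℂ) / 2 - (r : ℂ) * (η₂ j : ℂ))]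

end CGO

/-! Since ζ·ζ = 0, e^{x·ζ}(1+ψ) is a solution exactly when (Δ + 2ζ·∇)ψ = q(1+ψ), and the operator on
the left has symbol p = p_ζ. Let ψ be the inverse Fourier transform of |p|^{-1/2} h with h in L².
The equation becomes h = U(A h + q₀), where U multiplies by conj(p)/|p|, A is multiplication by q
conjugated with |p|^{-1/2}, and q₀ = |p|^{-1/2} q̂ has L² norm ‖q‖ in the space of exponent -1/2. If
‖A‖ ≤ 1/2, a Neumann series gives ‖h‖ ≤ 2‖q₀‖, so (b) follows from (a); see `exists_solution` and
`exists_cgo_solution`.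

Bound for A. With f = ∇ log γ^{1/2}, bounded and compactly supported, q = |f|² + div f. Localized by
a fixed weight, the map h ↦ ψ has norm O(s^{-1/2}) and h ↦ ∇ψ has norm O(s^{1/2})
(`exists_weightOps`). Zero-order terms are therefore O(1/s), while first-order terms are bounded by
a constant times sup |f|. The latter suffices if f is small. If f is continuous, it is split into a
small part and a smooth part whose derivative is moved by parts into a zero-order term
(`IsSplitting.exists_perturbation`). The localized bounds reduce, by Cauchy-Schwarz for the
convolution kernel of the weight, to the uniform estimate that the integral of (1+|ξ-η|)^{-d-1} /
|p(η)| is O(1/s). This holds because |p| is at least s times the distance to a sphere of codimension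
two, and the inverse distance to such a set is locally integrable, uniformly in the radius
(`exists_lintegral_singular_le`).

Part (a). Since f and |f|² are in L², |q̂|²/(1+|ξ|²) is integrable. The parameters r and η₂ are
encoded by a complex number z in an annulus through r η₂ = l z, and |p| dominates the modulus of an
affine function of z with constant term |x|² + k·x. As 1/|z| is locally integrable in the plane, the
average over z of 1/|p| is O(1/|x|²) at high frequencies, so some z makes the high-frequency part of
∫ |q̂|²/|p| as small as a tail of a convergent integral. At low frequencies q̂ is bounded and the
O(1/s) estimate applies (`exists_admissible_lintegral_le`). Averaging the sum over both potentials
and both signs of ζ gives one sequence for all four norms. -/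

namespace CGO

/-! ### Weak gradients: uniqueness and the product rule with smooth functions. -/

section WeakGradient

variable {d : ℕ}

theorem locallyIntegrable_apply {G : EuclideanSpace ℝ (Fin d) → EuclideanSpace ℂ (Fin d)}
    (hG : LocallyIntegrable G volume) (j : Fin d) : LocallyIntegrable (fun x => G x j) volume := by
  intro x
  obtain ⟨s, hs, h⟩ := hG x
  refine ⟨s, hs, ?_⟩
  exact (EuclideanSpace.proj (𝕜 := ℂ) j).integrable_comp h

theorem locallyIntegrable_euclidean {G : EuclideanSpace ℝ (Fin d) → EuclideanSpace ℂ (Fin d)}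
    (hG : ∀ j, LocallyIntegrable (fun x => G x j) volume) : LocallyIntegrable G volume := by
  have h : G = fun x => ∑ j, (G x j) • EuclideanSpace.single j (1 : ℂ) := by
    funext x
    ext i
    simp [Finset.sum_apply, Pi.single_apply]
  rw [h]
  have : LocallyIntegrable
      (∑ j, fun x => (G x j) • (EuclideanSpace.single j (1 : ℂ) : EuclideanSpace ℂ (Fin d)))
      volume := by
    refine locallyIntegrable_finsetSum' _ fun j _ => ?_
    intro x
    obtain ⟨s, hs, h⟩ := hG j x
    exact ⟨s, hs, h.smul_const _⟩
  convert this using 1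
  funext x
  simp

/-- The weak gradient is unique almost everywhere. -/
theorem HasWeakGrad.ae_eq {f : EuclideanSpace ℝ (Fin d) → ℂ}
    {G H : EuclideanSpace ℝ (Fin d) → EuclideanSpace ℂ (Fin d)}
    (hG : HasWeakGrad f G) (hH : HasWeakGrad f H) : G =ᵐ[volume] H := by
  have h : ∀ j, ∀ᵐ x ∂(volume : Measure (EuclideanSpace ℝ (Fin d))), G x j = H x j := by
    intro j
    refine ae_eq_of_integral_contDiff_smul_eq (locallyIntegrable_apply hG.2.1 j) (locallyIntegrable_apply hH.2.1 j) ?_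
    intro g hg hc
    have h1 := hG.2.2 j (fun x => (g x : ℂ)) (Complex.ofRealCLM.contDiff.comp hg) (hc.comp_left (g := Complex.ofReal) rfl)
    have h2 := hH.2.2 j (fun x => (g x : ℂ)) (Complex.ofRealCLM.contDiff.comp hg) (hc.comp_left (g := Complex.ofReal) rfl)
    rw [h1] at h2
    have := neg_inj.1 h2
    simpa [Complex.real_smul, mul_comm] using this
  filter_upwards [ae_all_iff.2 h] with x hx
  ext j
  exact hx j

theorem HasWeakGrad.weakGrad_ae_eq {f : EuclideanSpace ℝ (Fin d) → ℂ}
    {G : EuclideanSpace ℝ (Fin d) → EuclideanSpace ℂ (Fin d)}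
    (hG : HasWeakGrad f G) : weakGrad f =ᵐ[volume] G := by
  have h : ∃ G, HasWeakGrad f G := ⟨G, hG⟩
  rw [weakGrad, dif_pos h]
  exact h.choose_spec.ae_eq hG

theorem HasWeakGrad.congr {f g : EuclideanSpace ℝ (Fin d) → ℂ}
    {G H : EuclideanSpace ℝ (Fin d) → EuclideanSpace ℂ (Fin d)}
    (hG : HasWeakGrad f G) (hfg : f =ᵐ[volume] g) (hGH : G =ᵐ[volume] H) : HasWeakGrad g H := by
  refine ⟨hG.1.congr hfg, hG.2.1.congr hGH, fun j φ hφ hc => ?_⟩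
  have h1 : ∫ x, g x * fderiv ℝ φ x (EuclideanSpace.single j 1) =
      ∫ x, f x * fderiv ℝ φ x (EuclideanSpace.single j 1) := by
    apply integral_congr_ae
    filter_upwards [hfg] with x hx
    rw [hx]
  have h2 : ∫ x, H x j * φ x = ∫ x, G x j * φ x := by
    apply integral_congr_ae
    filter_upwards [hGH] with x hx
    rw [hx]
  rw [h1, h2, hG.2.2 j φ hφ hc]

/-- The gradient of a complex-valued function. -/
noncomputable def grad (w : EuclideanSpace ℝ (Fin d) → ℂ) (x : EuclideanSpace ℝ (Fin d)) :
    EuclideanSpace ℂ (Fin d) :=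
  WithLp.toLp 2 fun j => fderiv ℝ w x (EuclideanSpace.single j 1)

@[simp]
theorem grad_apply (w : EuclideanSpace ℝ (Fin d) → ℂ) (x : EuclideanSpace ℝ (Fin d)) (j : Fin d) :
    grad w x j = fderiv ℝ w x (EuclideanSpace.single j 1) := rfl

theorem locallyIntegrable_mul_continuous {u w : EuclideanSpace ℝ (Fin d) → ℂ}
    (hu : LocallyIntegrable u volume) (hw : Continuous w) :
    LocallyIntegrable (fun x => u x * w x) volume := by
  have := (locallyIntegrableOn_univ.2 hu).mul_continuousOn hw.continuousOn isOpen_univ.isLocallyClosed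
  exact locallyIntegrableOn_univ.1 this

theorem integrable_mul_of_hasCompactSupport {u w : EuclideanSpace ℝ (Fin d) → ℂ}
    (hu : LocallyIntegrable u volume) (hw : Continuous w) (hc : HasCompactSupport w) :
    Integrable (fun x => u x * w x) volume := by
  have := hu.integrable_smul_left_of_hasCompactSupport hw hc
  simpa [mul_comm] using this

/-- The product rule for a weakly differentiable and a smooth function. -/
theorem HasWeakGrad.mul_contDiff {u w : EuclideanSpace ℝ (Fin d) → ℂ}
    {G : EuclideanSpace ℝ (Fin d) → EuclideanSpace ℂ (Fin d)}
    (hu : HasWeakGrad u G) (hw : ContDiff ℝ ∞ w) :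
    HasWeakGrad (fun x => u x * w x) (fun x => w x • G x + u x • grad w x) := by
  have hdw : ∀ j : Fin d, Continuous fun x => fderiv ℝ w x (EuclideanSpace.single j 1) := fun j =>
    (hw.continuous_fderiv (by simp)).clm_apply continuous_const
  refine ⟨locallyIntegrable_mul_continuous hu.1 hw.continuous, ?_, ?_⟩
  · refine locallyIntegrable_euclidean fun j => ?_
    have h1 := locallyIntegrable_mul_continuous (locallyIntegrable_apply hu.2.1 j) hw.continuous
    have h2 := locallyIntegrable_mul_continuous hu.1 (hdw j)
    have h3 : (fun x => (w x • G x + u x • grad w x) j) = (fun x => G x j * w x) +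
        fun x => u x * fderiv ℝ w x (EuclideanSpace.single j 1) := by
      funext x
      simp [mul_comm]
    rw [h3]
    exact h1.add h2
  · intro j φ hφ hc
    have hdφ : Continuous fun x => fderiv ℝ φ x (EuclideanSpace.single j 1) :=
      (hφ.continuous_fderiv (by simp)).clm_apply continuous_const
    have hcφ : HasCompactSupport fun x => fderiv ℝ φ x (EuclideanSpace.single j 1) :=
      hc.fderiv_apply ℝ _
    have key := hu.2.2 j (fun x => w x * φ x) (hw.mul hφ) hc.mul_left
    have hd : ∀ x, fderiv ℝ (fun x => w x * φ x) x (EuclideanSpace.single j 1) =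
        w x * fderiv ℝ φ x (EuclideanSpace.single j 1) +
          fderiv ℝ w x (EuclideanSpace.single j 1) * φ x := by
      intro x
      rw [fderiv_fun_mul (hw.differentiable (by simp) x) (hφ.differentiable (by simp) x)]
      simp [mul_comm]
    simp only [hd] at key
    have i1 : Integrable (fun x => u x * (w x * fderiv ℝ φ x (EuclideanSpace.single j 1))) volume :=
      integrable_mul_of_hasCompactSupport hu.1 (hw.continuous.mul hdφ) hcφ.mul_left
    have i2 : Integrable (fun x => u x * (fderiv ℝ w x (EuclideanSpace.single j 1) * φ x)) volume :=
      integrable_mul_of_hasCompactSupport hu.1 ((hdw j).mul hφ.continuous) hc.mul_left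
    have i3 : Integrable (fun x => G x j * (w x * φ x)) volume :=
      integrable_mul_of_hasCompactSupport (locallyIntegrable_apply hu.2.1 j) (hw.continuous.mul hφ.continuous)
        hc.mul_left
    have e1 : ∫ x, u x * (w x * fderiv ℝ φ x (EuclideanSpace.single j 1) +
          fderiv ℝ w x (EuclideanSpace.single j 1) * φ x) =
        (∫ x, u x * (w x * fderiv ℝ φ x (EuclideanSpace.single j 1))) +
          ∫ x, u x * (fderiv ℝ w x (EuclideanSpace.single j 1) * φ x) := by
      rw [← integral_add i1 i2]
      simp only [mul_add]
    rw [e1] at key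
    have e2 : ∫ x, (w x • G x + u x • grad w x) j * φ x =
        (∫ x, G x j * (w x * φ x)) +
          ∫ x, u x * (fderiv ℝ w x (EuclideanSpace.single j 1) * φ x) := by
      rw [← integral_add i3 i2]
      congr 1
      funext x
      simp
      ring
    rw [e2]
    have e3 : ∫ x, u x * w x * fderiv ℝ φ x (EuclideanSpace.single j 1) =
        ∫ x, u x * (w x * fderiv ℝ φ x (EuclideanSpace.single j 1)) := by
      simp only [mul_assoc]
    rw [e3, eq_sub_of_add_eq key]
    ring

/-- The constant function enters both through `q = m_q(1)` and through the 1 in 1 + ψ. -/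
theorem hasWeakGrad_one : HasWeakGrad (fun _ : EuclideanSpace ℝ (Fin d) => (1 : ℂ)) 0 := by
  refine ⟨locallyIntegrable_const _, locallyIntegrable_zero, fun j φ hφ hc => ?_⟩
  simp only [one_mul, Pi.zero_apply, PiLp.zero_apply, zero_mul, integral_zero, neg_zero]
  have hd : Continuous fun x => fderiv ℝ φ x (EuclideanSpace.single j 1) :=
    (hφ.continuous_fderiv (by simp)).clm_apply continuous_const
  have h := integral_mul_fderiv_eq_neg_fderiv_mul_of_integrable (μ := volume)
    (f := fun _ : EuclideanSpace ℝ (Fin d) => (1 : ℂ)) (g := φ)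
    (v := EuclideanSpace.single j 1) (by simp)
    (by simpa using hd.integrable_of_hasCompactSupport (hc.fderiv_apply ℝ _))
    (by simpa using hφ.continuous.integrable_of_hasCompactSupport hc)
    (by simp) (fun x _ => hφ.differentiable (by simp) x)
  simpa using h

end WeakGradient

/-! ### Mollification and the product rule with Lipschitz functions. -/

section Mollification

variable {d : ℕ}

/-- A sequence of smooth bumps at the origin with supports shrinking to a point. -/
noncomputable def bump (d n : ℕ) : ContDiffBump (0 : EuclideanSpace ℝ (Fin d)) where
  rIn := 1 / (n + 1)
  rOut := 2 / (n + 1)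
  rIn_pos := by positivity
  rIn_lt_rOut := by gcongr; norm_num

/-- The mollifier, an approximate identity. -/
noncomputable def mollifier (d n : ℕ) : EuclideanSpace ℝ (Fin d) → ℝ := (bump d n).normed volume

theorem contDiff_mollifier (d n : ℕ) : ContDiff ℝ ∞ (mollifier d n) :=
  ContDiffBump.contDiff_normed _

theorem hasCompactSupport_mollifier (d n : ℕ) : HasCompactSupport (mollifier d n) :=
  ContDiffBump.hasCompactSupport_normed _

theorem mollifier_nonneg (d n : ℕ) (x : EuclideanSpace ℝ (Fin d)) : 0 ≤ mollifier d n x :=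
  ContDiffBump.nonneg_normed _ x

theorem integral_mollifier (d n : ℕ) : ∫ x, mollifier d n x = 1 :=
  ContDiffBump.integral_normed _

/-- Convolution with the mollifier. -/
noncomputable def mollify (n : ℕ) (w : EuclideanSpace ℝ (Fin d) → ℝ)
    (x : EuclideanSpace ℝ (Fin d)) : ℝ := ∫ y, w y * mollifier d n (x - y)

theorem mollify_eq_convolution (n : ℕ) (w : EuclideanSpace ℝ (Fin d) → ℝ) :
    mollify n w = convolution w (mollifier d n) (ContinuousLinearMap.mul ℝ ℝ) volume := rfl

theorem mollify_eq_convolution_left (n : ℕ) (w : EuclideanSpace ℝ (Fin d) → ℝ) :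
    mollify n w =
      convolution ((bump d n).normed volume) w (ContinuousLinearMap.lsmul ℝ ℝ) volume := by
  rw [mollify_eq_convolution, ← convolution_flip]
  funext x
  simp [convolution, mollifier, mul_comm]

theorem contDiff_mollify (n : ℕ) {w : EuclideanSpace ℝ (Fin d) → ℝ}
    (hw : LocallyIntegrable w volume) : ContDiff ℝ ∞ (mollify n w) :=
  (hasCompactSupport_mollifier d n).contDiff_convolution_right (ContinuousLinearMap.mul ℝ ℝ) hw
    (contDiff_mollifier d n)

theorem tendsto_rOut_bump (d : ℕ) : Tendsto (fun n => (bump d n).rOut) atTop (𝓝 0) := by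
  have := (tendsto_one_div_add_atTop_nhds_zero_nat (𝕜 := ℝ)).const_mul 2
  simpa [bump, div_eq_mul_inv] using this

theorem ae_tendsto_mollify {w : EuclideanSpace ℝ (Fin d) → ℝ} (hw : LocallyIntegrable w volume) :
    ∀ᵐ x, Tendsto (fun n => mollify n w x) atTop (𝓝 (w x)) := by
  simp only [mollify_eq_convolution_left]
  refine ContDiffBump.ae_convolution_tendsto_right_of_locallyIntegrable (K := 2)
    (tendsto_rOut_bump d) (Eventually.of_forall fun n => ?_) hw
  simp [bump, div_eq_mul_inv]

theorem integrable_mollifier_sub (n : ℕ) (x : EuclideanSpace ℝ (Fin d)) :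
    Integrable (fun y => mollifier d n (x - y)) volume :=
  ((bump d n).integrable_normed (μ := volume)).comp_sub_left x

theorem abs_mollify_le (n : ℕ) {w : EuclideanSpace ℝ (Fin d) → ℝ} {M : ℝ}
    (hM : ∀ᵐ x, |w x| ≤ M) (x : EuclideanSpace ℝ (Fin d)) : |mollify n w x| ≤ M := by
  have h : ‖∫ y, w y * mollifier d n (x - y)‖ ≤ ∫ y, M * mollifier d n (x - y) := by
    refine norm_integral_le_of_norm_le ((integrable_mollifier_sub n x).const_mul M) ?_
    filter_upwards [hM] with y hy
    rw [norm_mul, Real.norm_eq_abs, Real.norm_eq_abs, abs_of_nonneg (mollifier_nonneg d n _)]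
    exact mul_le_mul_of_nonneg_right hy (mollifier_nonneg d n _)
  rw [integral_const_mul, integral_sub_left_eq_self (mollifier d n), integral_mollifier,
    mul_one] at h
  exact h

/-- Mollification turns a weak derivative into a classical one. -/
theorem fderiv_mollify (n : ℕ) {w g : EuclideanSpace ℝ (Fin d) → ℝ} {e : EuclideanSpace ℝ (Fin d)}
    (hw : LocallyIntegrable w volume)
    (h : ∀ φ : EuclideanSpace ℝ (Fin d) → ℝ, ContDiff ℝ ∞ φ → HasCompactSupport φ →
      ∫ x, w x * fderiv ℝ φ x e = -∫ x, g x * φ x) (x : EuclideanSpace ℝ (Fin d)) :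
    fderiv ℝ (mollify n w) x e = mollify n g x := by
  have hc := hasCompactSupport_mollifier d n
  have hs := contDiff_mollifier d n
  have h1 := (hc.hasFDerivAt_convolution_right (ContinuousLinearMap.mul ℝ ℝ) hw
    (hs.of_le (by simp)) x).fderiv
  rw [mollify_eq_convolution, h1, convolution_precompR_apply _ hw (hc.fderiv ℝ)
    (hs.continuous_fderiv (by simp))]
  have hφs : ContDiff ℝ ∞ fun y => mollifier d n (x - y) := hs.comp (contDiff_const.sub contDiff_id)
  have hφc : HasCompactSupport fun y => mollifier d n (x - y) :=
    hc.comp_homeomorph (Homeomorph.subLeft x)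
  have key := h _ hφs hφc
  have hd : ∀ y, fderiv ℝ (fun y => mollifier d n (x - y)) y e =
      -fderiv ℝ (mollifier d n) (x - y) e := by
    intro y
    have h1 : HasFDerivAt (fun y => mollifier d n (x - y)) _ y :=
      ((hs.differentiable (by simp) (x - y)).hasFDerivAt).comp y ((hasFDerivAt_id y).const_sub x)
    rw [h1.fderiv]
    simp
  simp only [hd, mul_neg, integral_neg, neg_inj] at key
  simpa [convolution, mollify] using key

theorem lineDeriv_weak {C : NNReal} {w : EuclideanSpace ℝ (Fin d) → ℝ} (hw : LipschitzWith C w)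
    (e : EuclideanSpace ℝ (Fin d)) (φ : EuclideanSpace ℝ (Fin d) → ℝ) (hφ : ContDiff ℝ ∞ φ)
    (hc : HasCompactSupport φ) :
    ∫ x, w x * fderiv ℝ φ x e = -∫ x, lineDeriv ℝ w x e * φ x := by
  obtain ⟨D, hD⟩ := ContDiff.lipschitzWith_of_hasCompactSupport hc (hφ.of_le (by simp)) one_ne_zero
  have := hw.integral_lineDeriv_mul_eq (μ := volume) hD hc e
  rw [this, ← integral_neg]
  congr 1
  funext x
  rw [((hφ.differentiable (by simp)) x).lineDeriv_eq_fderiv]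
  simp [mul_comm]

/-- The product rule for a weakly differentiable and a bounded Lipschitz function. -/
theorem HasWeakGrad.mul_lipschitz {u : EuclideanSpace ℝ (Fin d) → ℂ}
    {G : EuclideanSpace ℝ (Fin d) → EuclideanSpace ℂ (Fin d)} (hu : HasWeakGrad u G)
    {w : EuclideanSpace ℝ (Fin d) → ℝ} {C : NNReal} (hw : LipschitzWith C w) {M : ℝ}
    (hM : ∀ x, |w x| ≤ M) :
    HasWeakGrad (fun x => u x * (w x : ℂ)) (fun x => (w x : ℂ) • G x + u x • WithLp.toLp 2 fun j =>
      ((lineDeriv ℝ w x (EuclideanSpace.single j 1) : ℝ) : ℂ)) := by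
  have hwc : Continuous fun x => (w x : ℂ) := Complex.continuous_ofReal.comp hw.continuous
  have hwl : LocallyIntegrable w volume := hw.continuous.locallyIntegrable
  set e : Fin d → EuclideanSpace ℝ (Fin d) := fun j => EuclideanSpace.single j 1
  have hbd : ∀ j x, |lineDeriv ℝ w x (e j)| ≤ C := by
    intro j x
    have := norm_lineDeriv_le_of_lipschitz ℝ hw (x₀ := x) (v := e j)
    simpa [e] using this
  have hml : ∀ j, AEStronglyMeasurable (fun x => ((lineDeriv ℝ w x (e j) : ℝ) : ℂ)) volume := fun j =>
    Complex.continuous_ofReal.comp_aestronglyMeasurable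
      (aestronglyMeasurable_lineDeriv hw.continuous _)
  -- Dominated convergence for uniformly bounded factors `b n` converging almost everywhere. It is
  -- used to pass to the limit in the smooth product rule for the mollifications of `w`, in each of
  -- its three integrals.
  have hdom : ∀ (f : EuclideanSpace ℝ (Fin d) → ℂ), LocallyIntegrable f volume →
      ∀ φ : EuclideanSpace ℝ (Fin d) → ℂ, Continuous φ → HasCompactSupport φ →
      ∀ (b : ℕ → EuclideanSpace ℝ (Fin d) → ℝ) (b' : EuclideanSpace ℝ (Fin d) → ℝ) (B : ℝ),
      (∀ n, Continuous (b n)) → (∀ n x, |b n x| ≤ B) →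
      (∀ᵐ x, Tendsto (fun n => b n x) atTop (𝓝 (b' x))) →
      Tendsto (fun n => ∫ x, f x * (b n x : ℂ) * φ x) atTop (𝓝 (∫ x, f x * (b' x : ℂ) * φ x)) := by
    intro f hf φ hφ hc b b' B hb hB ht
    have hi := integrable_mul_of_hasCompactSupport hf hφ hc
    refine tendsto_integral_of_dominated_convergence (fun x => B * ‖f x * φ x‖) (fun n => ?_)
      (hi.norm.const_mul B) (fun n => ?_) ?_
    · have : (fun x => f x * (b n x : ℂ) * φ x) = fun x => (f x * φ x) * (b n x : ℂ) := by
        funext x; ring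
      rw [this]
      exact hi.aestronglyMeasurable.mul
        (Complex.continuous_ofReal.comp (hb n)).aestronglyMeasurable
    · refine Eventually.of_forall fun x => ?_
      have : f x * (b n x : ℂ) * φ x = (b n x : ℂ) * (f x * φ x) := by ring
      rw [this, norm_mul, Complex.norm_real]
      exact mul_le_mul_of_nonneg_right (hB n x) (norm_nonneg _)
    · filter_upwards [ht] with x hx
      exact ((Complex.continuous_ofReal.tendsto _).comp hx).const_mul _ |>.mul_const _
  refine ⟨locallyIntegrable_mul_continuous hu.1 hwc, ?_, ?_⟩
  · refine locallyIntegrable_euclidean fun j => ?_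
    have h1 := locallyIntegrable_mul_continuous (locallyIntegrable_apply hu.2.1 j) hwc
    have h2 : LocallyIntegrable (fun x => u x * ((lineDeriv ℝ w x (e j) : ℝ) : ℂ)) volume := by
      intro x
      obtain ⟨s, hs, h⟩ := hu.1 x
      refine ⟨s, hs, ?_⟩
      refine Integrable.mul_bdd (c := C) h (hml j).restrict (Eventually.of_forall fun y => ?_)
      rw [Complex.norm_real]
      exact hbd j y
    have h3 : (fun x => ((w x : ℂ) • G x + u x • WithLp.toLp 2 fun j =>
        ((lineDeriv ℝ w x (EuclideanSpace.single j 1) : ℝ) : ℂ)) j) = (fun x => G x j * (w x : ℂ)) +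
        fun x => u x * ((lineDeriv ℝ w x (e j) : ℝ) : ℂ) := by
      funext x
      simp [mul_comm, e]
    rw [h3]
    exact h1.add h2
  · intro j φ hφ hc
    have hdφ : Continuous fun x => fderiv ℝ φ x (e j) :=
      (hφ.continuous_fderiv (by simp)).clm_apply continuous_const
    have hcφ : HasCompactSupport fun x => fderiv ℝ φ x (e j) := hc.fderiv_apply ℝ _
    have hsm : ∀ n, ContDiff ℝ ∞ fun x => (mollify n w x : ℂ) := fun n =>
      Complex.ofRealCLM.contDiff.comp (contDiff_mollify n hwl)
    have hderiv : ∀ n x, fderiv ℝ (fun x => (mollify n w x : ℂ)) x (e j) =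
        (mollify n (fun x => lineDeriv ℝ w x (e j)) x : ℂ) := by
      intro n x
      have h1 : HasFDerivAt (fun x => (mollify n w x : ℂ))
          (Complex.ofRealCLM.comp (fderiv ℝ (mollify n w) x)) x :=
        Complex.ofRealCLM.hasFDerivAt.comp x
          ((contDiff_mollify n hwl).differentiable (by simp) x).hasFDerivAt
      rw [h1.fderiv]
      simp only [ContinuousLinearMap.comp_apply, Complex.ofRealCLM_apply]
      rw [fderiv_mollify n hwl (lineDeriv_weak hw (e j)) x]
    have hll : LocallyIntegrable (fun x => lineDeriv ℝ w x (e j)) volume :=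
      hw.locallyIntegrable_lineDeriv _
    have hn : ∀ n, ∫ x, u x * (mollify n w x : ℂ) * fderiv ℝ φ x (e j) =
        -((∫ x, G x j * (mollify n w x : ℂ) * φ x) +
          ∫ x, u x * (mollify n (fun x => lineDeriv ℝ w x (e j)) x : ℂ) * φ x) := by
      intro n
      rw [(hu.mul_contDiff (hsm n)).2.2 j φ hφ hc, ← integral_add]
      · congr 2
        funext x
        simp only [PiLp.add_apply, PiLp.smul_apply, grad_apply, smul_eq_mul]
        rw [hderiv n x]
        ring
      · simpa only [mul_assoc, Pi.mul_apply, Function.comp_apply] using integrable_mul_of_hasCompactSupport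
          (locallyIntegrable_apply hu.2.1 j) ((hsm n).continuous.mul hφ.continuous) hc.mul_left
      · simpa only [mul_assoc, Pi.mul_apply, Function.comp_apply] using integrable_mul_of_hasCompactSupport
          hu.1 ((Complex.continuous_ofReal.comp (contDiff_mollify n hll).continuous).mul
            hφ.continuous) hc.mul_left
    have t1 := hdom u hu.1 _ hdφ hcφ (fun n => mollify n w) w M
      (fun n => (contDiff_mollify n hwl).continuous)
      (fun n => abs_mollify_le n (Eventually.of_forall hM)) (ae_tendsto_mollify hwl)
    have t2 := hdom _ (locallyIntegrable_apply hu.2.1 j) φ hφ.continuous hc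
      (fun n => mollify n w) w M
      (fun n => (contDiff_mollify n hwl).continuous)
      (fun n => abs_mollify_le n (Eventually.of_forall hM)) (ae_tendsto_mollify hwl)
    have t3 := hdom u hu.1 φ hφ.continuous hc
      (fun n => mollify n (fun x => lineDeriv ℝ w x (e j))) (fun x => lineDeriv ℝ w x (e j)) C
      (fun n => (contDiff_mollify n hll).continuous)
      (fun n => abs_mollify_le n (Eventually.of_forall (hbd j))) (ae_tendsto_mollify hll)
    simp only [hn] at t1
    rw [tendsto_nhds_unique t1 (t2.add t3).neg, ← integral_add]
    · congr 2
      funext x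
      simp [e]
      ring
    · simpa only [mul_assoc, Pi.mul_apply, Function.comp_apply] using integrable_mul_of_hasCompactSupport
        (locallyIntegrable_apply hu.2.1 j) (hwc.mul hφ.continuous) hc.mul_left
    · have hi := integrable_mul_of_hasCompactSupport hu.1 hφ.continuous hc
      have := Integrable.mul_bdd (c := C) hi (hml j) (Eventually.of_forall fun y => by
        rw [Complex.norm_real]; exact hbd j y)
      refine this.congr (Eventually.of_forall fun x => ?_)
      simp only
      ring

theorem hasWeakGrad_of_lipschitz {w : EuclideanSpace ℝ (Fin d) → ℝ} {C : NNReal}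
    (hw : LipschitzWith C w) {M : ℝ} (hM : ∀ x, |w x| ≤ M) :
    HasWeakGrad (fun x => (w x : ℂ)) (fun x => WithLp.toLp 2 fun j =>
      ((lineDeriv ℝ w x (EuclideanSpace.single j 1) : ℝ) : ℂ)) := by
  have := hasWeakGrad_one.mul_lipschitz hw hM
  simpa using this

end Mollification

/-! ### Lipschitz representatives of functions in W^{1,∞}. -/

section LipschitzRepresentative

variable {d : ℕ}

theorem HasWeakGrad.re_apply {γ : EuclideanSpace ℝ (Fin d) → ℝ}
    {G : EuclideanSpace ℝ (Fin d) → EuclideanSpace ℂ (Fin d)}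
    (hG : HasWeakGrad (fun x => (γ x : ℂ)) G) (j : Fin d) (φ : EuclideanSpace ℝ (Fin d) → ℝ)
    (hφ : ContDiff ℝ ∞ φ) (hc : HasCompactSupport φ) :
    ∫ x, γ x * fderiv ℝ φ x (EuclideanSpace.single j 1) = -∫ x, (G x j).re * φ x := by
  have hφ' : ContDiff ℝ ∞ fun x => (φ x : ℂ) := Complex.ofRealCLM.contDiff.comp hφ
  have hc' : HasCompactSupport fun x => (φ x : ℂ) := hc.comp_left (g := Complex.ofReal) rfl
  have h := hG.2.2 j _ hφ' hc'
  have hd : ∀ x, fderiv ℝ (fun x => (φ x : ℂ)) x (EuclideanSpace.single j 1) =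
      (fderiv ℝ φ x (EuclideanSpace.single j 1) : ℝ) := by
    intro x
    have h1 : HasFDerivAt (fun x => (φ x : ℂ)) (Complex.ofRealCLM.comp (fderiv ℝ φ x)) x :=
      Complex.ofRealCLM.hasFDerivAt.comp x (hφ.differentiable (by simp) x).hasFDerivAt
    rw [h1.fderiv]
    rfl
  simp only [hd, ← Complex.ofReal_mul] at h
  rw [integral_complex_ofReal] at h
  have hi := integrable_mul_of_hasCompactSupport (locallyIntegrable_apply hG.2.1 j)
    hφ'.continuous hc'
  have h2 := congrArg Complex.re h
  have h3 := Complex.reCLM.integral_comp_comm hi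
  simp only [Complex.reCLM_apply, Complex.re_mul_ofReal] at h3
  rw [Complex.ofReal_re, Complex.neg_re, ← h3] at h2
  exact h2

/-- A function in `W^{1,∞}` has a Lipschitz representative. -/
theorem MemW1Inf.exists_lipschitz {γ : EuclideanSpace ℝ (Fin d) → ℝ} (h : MemW1Inf γ) :
    ∃ (C : NNReal) (g : EuclideanSpace ℝ (Fin d) → ℝ), LipschitzWith C g ∧ γ =ᵐ[volume] g := by
  obtain ⟨hγ, G, hG, hGb⟩ := h
  have hγl : LocallyIntegrable γ volume := hγ.locallyIntegrable (by simp)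
  obtain ⟨B, hB⟩ : ∃ B : NNReal, ∀ᵐ x, ‖G x‖ ≤ B := by
    refine ⟨(eLpNorm G ∞ volume).toNNReal, ?_⟩
    filter_upwards [ae_le_eLpNormEssSup (f := G) (μ := volume)] with x hx
    rw [← eLpNorm_exponent_top] at hx
    have := ENNReal.toReal_mono hGb.2.ne hx
    rw [toReal_enorm, eLpNorm_exponent_top] at this
    simpa [ENNReal.toReal] using this
  -- The mollifications are Lipschitz uniformly in `n`, because their partial derivatives are
  -- mollified weak derivatives. The factor `d` comes from summing over coordinates.
  have hL : ∀ n, LipschitzWith (d * B) (mollify n γ) := by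
    intro n
    refine lipschitzWith_of_nnnorm_fderiv_le
      ((contDiff_mollify n hγl).differentiable (by simp)) fun x => ?_
    rw [← NNReal.coe_le_coe, coe_nnnorm]
    refine ContinuousLinearMap.opNorm_le_bound _ (by positivity) fun v => ?_
    have hv : v = ∑ j, v j • (EuclideanSpace.single j (1 : ℝ) : EuclideanSpace ℝ (Fin d)) := by
      ext i
      simp [Finset.sum_apply, Pi.single_apply]
    have hj : ∀ j : Fin d, |fderiv ℝ (mollify n γ) x (EuclideanSpace.single j 1)| ≤ B := by
      intro j
      rw [fderiv_mollify n hγl (hG.re_apply j)]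
      refine abs_mollify_le n ?_ x
      filter_upwards [hB] with y hy
      exact (Complex.abs_re_le_norm _).trans ((PiLp.norm_apply_le (G y) j).trans hy)
    conv_lhs => rw [hv]
    rw [map_sum]
    calc ‖∑ j, fderiv ℝ (mollify n γ) x (v j • EuclideanSpace.single j 1)‖
        ≤ ∑ j : Fin d, ‖v‖ * B := by
          refine (norm_sum_le _ _).trans (Finset.sum_le_sum fun j _ => ?_)
          rw [map_smul, norm_smul]
          exact mul_le_mul (PiLp.norm_apply_le v j) (hj j) (norm_nonneg _) (norm_nonneg _)
      _ = ((d * B : NNReal) : ℝ) * ‖v‖ := by simp; ring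
  have hS := ae_tendsto_mollify hγl
  -- The uniform Lipschitz bound survives on the full-measure set where the mollifications converge,
  -- and a Lipschitz function on a set extends to the whole space.
  have hlip : LipschitzOnWith (d * B) γ {x | Tendsto (fun n => mollify n γ x) atTop (𝓝 (γ x))} := by
    refine LipschitzOnWith.of_dist_le_mul fun x hx y hy => ?_
    exact le_of_tendsto (hx.dist hy) (Eventually.of_forall fun n => (hL n).dist_le_mul x y)
  obtain ⟨g, hg, hgγ⟩ := hlip.extend_real
  exact ⟨_, g, hg, by filter_upwards [hS] with x hx using hgγ hx⟩

end LipschitzRepresentative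

/-! ### The logarithmic gradient and the bilinear form of the potential. -/

section LogGradient

variable {d : ℕ}

/-- The chain rule at the points where `g` is differentiable, which are almost all points by
Rademacher's theorem. It is applied to the logarithm, the square root and its inverse, all smooth on
[c, ∞). -/
theorem lipschitz_comp_of_deriv_le {g : EuclideanSpace ℝ (Fin d) → ℝ} {C : NNReal}
    (hg : LipschitzWith C g) {c M : ℝ} (hgc : ∀ x, c ≤ g x) (hgM : ∀ x, g x ≤ M)
    {Φ Φ' : ℝ → ℝ} {K : NNReal} (hΦ : ∀ t, c ≤ t → HasDerivAt Φ (Φ' t) t)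
    (hK : ∀ t, c ≤ t → |Φ' t| ≤ K) :
    LipschitzWith (K * C) (fun x => Φ (g x)) ∧ (∃ B, ∀ x, |Φ (g x)| ≤ B) ∧
      ∀ᵐ x, ∀ e, lineDeriv ℝ (fun x => Φ (g x)) x e = Φ' (g x) * lineDeriv ℝ g x e := by
  refine ⟨?_, ?_, ?_⟩
  · have h : LipschitzOnWith K Φ (Set.Ici c) := by
      refine (convex_Ici c).lipschitzOnWith_of_nnnorm_hasDerivWithin_le (f' := Φ')
        (fun t ht => (hΦ t ht).hasDerivWithinAt) fun t ht => ?_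
      rw [← NNReal.coe_le_coe, coe_nnnorm]
      exact hK t ht
    have h2 := h.comp (hg.lipschitzOnWith (s := Set.univ)) (fun x _ => hgc x)
    exact lipschitzOnWith_univ.1 h2
  · have hcont : ContinuousOn Φ (Set.Icc c M) := fun t ht =>
      (hΦ t ht.1).continuousAt.continuousWithinAt
    obtain ⟨B, hB⟩ := isCompact_Icc.exists_bound_of_continuousOn hcont
    exact ⟨B, fun x => hB _ ⟨hgc x, hgM x⟩⟩
  · filter_upwards [hg.ae_differentiableAt] with x hx e
    have h1 : HasFDerivAt (fun x => Φ (g x)) (Φ' (g x) • fderiv ℝ g x) x :=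
      (hΦ _ (hgc x)).comp_hasFDerivAt x hx.hasFDerivAt
    rw [h1.differentiableAt.lineDeriv_eq_fderiv, hx.lineDeriv_eq_fderiv, h1.fderiv]
    rfl

/-- `f` is the gradient of `log γ^{1/2}`, supported in the ball of radius `ρ` around the origin, in
the form needed to compute with the potential of `γ`. -/
structure IsLogGradient (γ : EuclideanSpace ℝ (Fin d) → ℝ) (ρ : ℝ)
    (f : Fin d → EuclideanSpace ℝ (Fin d) → ℝ) : Prop where
  measurable : ∀ j, Measurable (f j)
  bounded : ∃ B, ∀ j x, |f j x| ≤ B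
  eq_zero : ∀ j x, ρ < ‖x‖ → f j x = 0
  mq_eq : ∀ (u v : EuclideanSpace ℝ (Fin d) → ℂ)
    (G : EuclideanSpace ℝ (Fin d) → EuclideanSpace ℂ (Fin d)), HasWeakGrad u G → ContDiff ℝ ∞ v →
    mq γ u v = ∫ x, ∑ j, ((f j x : ℂ) ^ 2 * (u x * v x) -
      (f j x : ℂ) * (G x j * v x + u x * fderiv ℝ v x (EuclideanSpace.single j 1)))
  log_eq : ∀ᵐ x, ∀ j, weakGrad (fun x => (Real.log (γ x) : ℂ)) x j = 2 * (f j x : ℂ)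
  continuous : IsC1 γ → ∀ j, Continuous (f j)

/-- For the Lipschitz representative `g` take f = ∇g/(2g) = ∇ log g^{1/2}. Expanding ∇g^{1/2} ·
∇(g^{-1/2} u v) cancels the powers of g and leaves f·∇(uv) - |f|² uv. -/
theorem exists_isLogGradient {γ : EuclideanSpace ℝ (Fin d) → ℝ} (hγ : MemW1Inf γ) {c : ℝ}
    (hc : 0 < c) (hγc : ∀ᵐ x, c < γ x) {ρ : ℝ} (hρ : ∀ᵐ x, ρ < ‖x‖ → γ x = 1) :
    ∃ f, IsLogGradient γ ρ f := by
  obtain ⟨C, g, hg, hγg⟩ := hγ.exists_lipschitz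
  -- A set of full measure is dense, so the almost everywhere lower bound extends everywhere by
  -- continuity.
  have hgc : ∀ x, c ≤ g x := by
    have hcl : IsClosed {x | c ≤ g x} := isClosed_le continuous_const hg.continuous
    have hd : Dense {x | c ≤ g x} := by
      refine Measure.dense_of_ae (μ := volume) ?_
      filter_upwards [hγc, hγg] with x h1 h2
      rw [← h2]; exact h1.le
    intro x
    have : x ∈ closure {x | c ≤ g x} := hd x
    rwa [hcl.closure_eq] at this
  have hg1 : ∀ x, ρ < ‖x‖ → g x = 1 := by
    intro x hx
    by_contra hne
    have ho : IsOpen {y : EuclideanSpace ℝ (Fin d) | ρ < ‖y‖ ∧ g y ≠ 1} :=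
      (isOpen_lt continuous_const continuous_norm).inter
        (isOpen_ne.preimage hg.continuous)
    have h0 : volume {y : EuclideanSpace ℝ (Fin d) | ρ < ‖y‖ ∧ g y ≠ 1} = 0 := by
      refine measure_mono_null (t := {y | ¬ ((ρ < ‖y‖ → γ y = 1) ∧ γ y = g y)}) ?_ ?_
      · intro y hy hy2
        exact hy.2 (hy2.2 ▸ hy2.1 hy.1)
      · exact ae_iff.1 (hρ.and hγg)
    exact (ho.measure_pos volume ⟨x, hx, hne⟩).ne' h0
  obtain ⟨M, hM⟩ : ∃ M, ∀ x, g x ≤ M := by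
    obtain ⟨B, hB⟩ := (isCompact_closedBall (0 : EuclideanSpace ℝ (Fin d)) ρ).exists_bound_of_continuousOn
      hg.continuous.continuousOn
    refine ⟨max B 1, fun x => ?_⟩
    by_cases hx : ρ < ‖x‖
    · rw [hg1 x hx]; exact le_max_right _ _
    · exact (le_abs_self _).trans ((hB x (by simpa using hx)).trans (le_max_left _ _))
  have hpos : ∀ x, 0 < g x := fun x => hc.trans_le (hgc x)
  have hsq : ∀ x, 0 < Real.sqrt (g x) := fun x => Real.sqrt_pos.2 (hpos x)
  set e : Fin d → EuclideanSpace ℝ (Fin d) := fun j => EuclideanSpace.single j 1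
  -- the three compositions
  obtain ⟨l1, ⟨B1, b1⟩, d1⟩ := lipschitz_comp_of_deriv_le hg hgc hM
    (Φ := Real.log) (Φ' := fun t => t⁻¹) (K := ⟨c⁻¹, by positivity⟩)
    (fun t ht => Real.hasDerivAt_log (hc.trans_le ht).ne') (fun t ht => by
      have : 0 < t := hc.trans_le ht
      rw [abs_of_pos (by positivity)]
      exact inv_anti₀ hc ht)
  obtain ⟨l2, ⟨B2, b2⟩, d2⟩ := lipschitz_comp_of_deriv_le hg hgc hM
    (Φ := Real.sqrt) (Φ' := fun t => 1 / (2 * Real.sqrt t))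
    (K := ⟨1 / (2 * Real.sqrt c), by positivity⟩)
    (fun t ht => Real.hasDerivAt_sqrt (hc.trans_le ht).ne') (fun t ht => by
      have h0 : 0 < Real.sqrt c := Real.sqrt_pos.2 hc
      have := Real.sqrt_le_sqrt ht
      rw [abs_of_nonneg (by positivity)]
      exact one_div_le_one_div_of_le (by positivity) (by linarith))
  obtain ⟨l3, ⟨B3, b3⟩, d3⟩ := lipschitz_comp_of_deriv_le hg hgc hM
    (Φ := fun t => (Real.sqrt t)⁻¹) (Φ' := fun t => -(1 / (2 * Real.sqrt t)) / Real.sqrt t ^ 2)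
    (K := ⟨1 / (2 * Real.sqrt c) / Real.sqrt c ^ 2, by positivity⟩)
    (fun t ht => (Real.hasDerivAt_sqrt (hc.trans_le ht).ne').inv
      (Real.sqrt_pos.2 (hc.trans_le ht)).ne') (fun t ht => by
      have h0 : 0 < Real.sqrt c := Real.sqrt_pos.2 hc
      have := Real.sqrt_le_sqrt ht
      rw [neg_div, abs_neg, abs_of_nonneg (by positivity)]
      show _ ≤ 1 / (2 * Real.sqrt c) / Real.sqrt c ^ 2
      gcongr)
  have w1 := (hasWeakGrad_of_lipschitz l1 b1).weakGrad_ae_eq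
  have w2 := (hasWeakGrad_of_lipschitz l2 b2).weakGrad_ae_eq
  have hlog : weakGrad (fun x => (Real.log (γ x) : ℂ)) =ᵐ[volume]
      weakGrad (fun x => (Real.log (g x) : ℂ)) := by
    refine (((hasWeakGrad_of_lipschitz l1 b1).congr ?_ EventuallyEq.rfl).weakGrad_ae_eq).trans w1.symm
    filter_upwards [hγg] with x hx
    rw [hx]
  have hsqrt : weakGrad (fun x => (Real.sqrt (γ x) : ℂ)) =ᵐ[volume]
      weakGrad (fun x => (Real.sqrt (g x) : ℂ)) := by
    refine (((hasWeakGrad_of_lipschitz l2 b2).congr ?_ EventuallyEq.rfl).weakGrad_ae_eq).trans w2.symm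
    filter_upwards [hγg] with x hx
    rw [hx]
  refine ⟨fun j x => lineDeriv ℝ g x (e j) / (2 * g x), ?_, ?_, ?_, ?_, ?_, ?_⟩
  · intro j
    exact (measurable_lineDeriv hg.continuous).div (hg.continuous.measurable.const_mul 2)
  · refine ⟨C / (2 * c), fun j x => ?_⟩
    have h1 := norm_lineDeriv_le_of_lipschitz ℝ hg (x₀ := x) (v := e j)
    have h2 : |lineDeriv ℝ g x (e j)| ≤ C := by simpa [e] using h1
    rw [abs_div, abs_of_pos (by linarith [hpos x] : 0 < 2 * g x)]
    exact div_le_div₀ (by positivity) h2 (by positivity) (by linarith [hgc x])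
  · intro j x hx
    have : g =ᶠ[𝓝 x] fun _ => 1 := by
      filter_upwards [(isOpen_lt continuous_const continuous_norm).mem_nhds hx] with y hy
      exact hg1 y hy
    have hz : lineDeriv ℝ g x (e j) = 0 := by
      rw [Filter.EventuallyEq.lineDeriv_eq this]
      simp [lineDeriv]
    rw [hz, zero_div]
  · intro u v G hu hv
    have hw : HasWeakGrad (fun y => (Real.sqrt (γ y) : ℂ)⁻¹ * u y * v y) _ :=
      ((hu.mul_lipschitz l3 b3).mul_contDiff hv).congr (by
        filter_upwards [hγg] with x hx
        rw [hx]; push_cast; ring) EventuallyEq.rfl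
    rw [mq, ← integral_neg]
    refine integral_congr_ae ?_
    filter_upwards [hsqrt, w2, hw.weakGrad_ae_eq, d2, d3] with x h1 h2 h3 h4 h5
    rw [← Finset.sum_neg_distrib]
    refine Finset.sum_congr rfl fun j _ => ?_
    rw [h1, h2, h3]
    simp only [PiLp.add_apply, PiLp.smul_apply, grad_apply, smul_eq_mul]
    rw [h4, h5]
    have hs : ((Real.sqrt (g x) : ℝ) : ℂ) ≠ 0 := by exact_mod_cast (hsq x).ne'
    have hgs : (g x : ℂ) = (Real.sqrt (g x) : ℂ) ^ 2 := by
      exact_mod_cast (Real.sq_sqrt (hpos x).le).symm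
    push_cast
    rw [hgs]
    simp only [e]
    field_simp
    ring
  · filter_upwards [hlog, w1, d1] with x h1 h2 h3 j
    rw [h1, h2]
    simp only
    rw [h3]
    have hs : (g x : ℂ) ≠ 0 := by exact_mod_cast (hpos x).ne'
    push_cast
    simp only [e]
    field_simp
  · rintro ⟨h, hh, hγh⟩ j
    -- Continuous functions that agree almost everywhere are equal, so the Lipschitz representative
    -- is itself the C^1 one.
    have hgh : g = h :=
      (Continuous.ae_eq_iff_eq volume hg.continuous hh.continuous).1 (hγg.symm.trans hγh)
    have : (fun x => lineDeriv ℝ g x (e j)) = fun x => fderiv ℝ h x (e j) := by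
      funext x
      rw [hgh, (hh.differentiable (by simp) x).lineDeriv_eq_fderiv]
    have h2 : Continuous fun x => lineDeriv ℝ g x (e j) := by
      rw [this]
      exact (hh.continuous_fderiv (by simp)).clm_apply continuous_const
    exact h2.div (continuous_const.mul hg.continuous) fun x => by
      have := hpos x; positivity

end LogGradient

/-! ### Integrals of negative powers of the norm, uniform under translation. -/

section SingularIntegrals

/-- The power is at most 1 where ‖x + a‖ ≥ 1, and the remaining region is a translate of the unit
ball. The constant is thus the integral over that ball plus the measure of `S`. -/
theorem exists_setLIntegral_enorm_rpow_le {E : Type*} [NormedAddCommGroup E] [NormedSpace ℝ E]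
    [FiniteDimensional ℝ E] [MeasurableSpace E] [BorelSpace E] (μ : Measure E) [μ.IsAddHaarMeasure]
    {α : ℝ} (hα : 0 < α) (hd : 1 ≤ Module.finrank ℝ E) (hαd : α < Module.finrank ℝ E) {S : Set E}
    (hS : MeasurableSet S) (hS' : μ S ≠ ⊤) :
    ∃ C : NNReal, ∀ a : E, ∫⁻ x in S, (‖x + a‖ₑ ^ α)⁻¹ ∂μ ≤ C := by
  have hpos : 0 < Module.finrank ℝ E := hd
  have : Nontrivial E := Module.nontrivial_of_finrank_pos (R := ℝ) hpos
  have hI : ∫⁻ x in Metric.ball (0 : E) 1, (‖x‖ₑ ^ α)⁻¹ ∂μ < ⊤ := by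
    have h1 : IntegrableOn (fun x : E => ‖x‖ ^ (-α)) (Metric.ball 0 1) μ :=
      integrableOn_ball_of_norm_le_rpow (C := 1) hd hαd
        (Eventually.of_forall fun x => by
          rw [one_mul, Real.norm_of_nonneg (by positivity)])
        (measurable_norm.pow_const _).aestronglyMeasurable
    refine lt_of_le_of_lt (lintegral_mono_ae ?_) h1.2
    have h0 : ∀ᵐ x ∂μ, x ≠ 0 := by simp [ae_iff]
    filter_upwards [ae_restrict_of_ae h0] with x hx
    rw [← ENNReal.rpow_neg, ← ofReal_norm, ← ofReal_norm,
      ENNReal.ofReal_rpow_of_pos (norm_pos_iff.2 hx), Real.norm_of_nonneg (by positivity)]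
  have hm : Measurable fun x : E => (‖x‖ₑ ^ α)⁻¹ := by fun_prop
  set C := ∫⁻ x in Metric.ball (0 : E) 1, (‖x‖ₑ ^ α)⁻¹ ∂μ + μ S with hC
  have hCt : C ≠ ⊤ := ENNReal.add_ne_top.2 ⟨hI.ne, hS'⟩
  refine ⟨C.toNNReal, fun a => ?_⟩
  rw [ENNReal.coe_toNNReal hCt, hC]
  have hb : ∀ x : E, S.indicator (fun x => (‖x + a‖ₑ ^ α)⁻¹) x ≤
      (Metric.ball (0 : E) 1).indicator (fun x => (‖x‖ₑ ^ α)⁻¹) (x + a) + S.indicator 1 x := by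
    intro x
    by_cases hx : x ∈ S
    · by_cases hxa : x + a ∈ Metric.ball (0 : E) 1
      · simp only [Set.indicator_of_mem hx, Set.indicator_of_mem hxa]
        exact le_self_add
      · simp only [Set.indicator_of_mem hx, Set.indicator_of_notMem hxa, zero_add, Pi.one_apply]
        rw [ENNReal.inv_le_one]
        have : (1 : ℝ≥0∞) ≤ ‖x + a‖ₑ := by
          rw [← ofReal_norm, ENNReal.one_le_ofReal]
          simpa using hxa
        exact ENNReal.one_le_rpow this hα
    · simp [Set.indicator_of_notMem hx]
  calc ∫⁻ x in S, (‖x + a‖ₑ ^ α)⁻¹ ∂μ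
      = ∫⁻ x, S.indicator (fun x => (‖x + a‖ₑ ^ α)⁻¹) x ∂μ := (lintegral_indicator hS _).symm
    _ ≤ ∫⁻ x, ((Metric.ball (0 : E) 1).indicator (fun x => (‖x‖ₑ ^ α)⁻¹) (x + a) +
          S.indicator 1 x) ∂μ := lintegral_mono hb
    _ = _ := by
        rw [lintegral_add_right _ (measurable_one.indicator hS),
          lintegral_add_right_eq_self (fun x => (Metric.ball (0 : E) 1).indicator
            (fun x => (‖x‖ₑ ^ α)⁻¹) x), lintegral_indicator measurableSet_ball,
          lintegral_indicator_one hS]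

/-- The inverse square root of `|t|`, with value `∞` at the origin. -/
noncomputable def invSqrt (t : ℝ) : ℝ≥0∞ := (‖t‖ₑ ^ (1 / 2 : ℝ))⁻¹

@[fun_prop]
theorem measurable_invSqrt : Measurable invSqrt := by unfold invSqrt; fun_prop

theorem exists_lintegral_invSqrt_le : ∃ C : NNReal, ∀ a : ℝ,
    ∫⁻ t in Set.Icc (0 : ℝ) 1, invSqrt (a + t) ≤ C := by
  obtain ⟨C, hC⟩ := exists_setLIntegral_enorm_rpow_le (volume : Measure ℝ) (α := 1 / 2)
    (by norm_num) (by simp) (by simp; norm_num) (S := Set.Icc 0 1) measurableSet_Icc (by simp)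
  exact ⟨C, fun a => by simpa [invSqrt, add_comm] using hC a⟩

/-- Factor out `m`: its inverse square root is at most 2 because m ≥ 1/4, and the rest is the
translation-invariant bound. -/
theorem exists_lintegral_invSqrt_mul_le : ∃ C : NNReal, ∀ a m : ℝ, 1 / 4 ≤ m →
    ∫⁻ t in Set.Icc (0 : ℝ) 1, invSqrt (a - t * m) ≤ C := by
  obtain ⟨C, hC⟩ := exists_lintegral_invSqrt_le
  refine ⟨2 * C, fun a m hm => ?_⟩
  have hm0 : 0 < m := by linarith
  have h : ∀ t, invSqrt (a - t * m) ≤ 2 * invSqrt (-a / m + t) := by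
    intro t
    have h1 : a - t * m = -m * (-a / m + t) := by field_simp; ring
    rw [h1, invSqrt, invSqrt, enorm_mul, ENNReal.mul_rpow_of_nonneg _ _ (by norm_num),
      ENNReal.mul_inv (Or.inr (by simp)) (Or.inl (by simp))]
    gcongr
    rw [ENNReal.inv_le_iff_inv_le]
    have h2 : (2 : ℝ≥0∞)⁻¹ = (ENNReal.ofReal (1 / 4)) ^ (1 / 2 : ℝ) := by
      rw [ENNReal.ofReal_rpow_of_pos (by norm_num)]
      have : ((1 : ℝ) / 4) ^ (1 / 2 : ℝ) = 2⁻¹ := by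
        rw [← Real.sqrt_eq_rpow, show (1 : ℝ) / 4 = (2⁻¹) ^ 2 by norm_num,
          Real.sqrt_sq (by norm_num)]
      rw [this, ENNReal.ofReal_inv_of_pos (by norm_num)]
      simp
    rw [h2]
    gcongr
    rw [enorm_neg, ← ofReal_norm, Real.norm_of_nonneg hm0.le]
    exact ENNReal.ofReal_le_ofReal hm
  calc ∫⁻ t in Set.Icc (0 : ℝ) 1, invSqrt (a - t * m)
      ≤ ∫⁻ t in Set.Icc (0 : ℝ) 1, 2 * invSqrt (-a / m + t) := lintegral_mono h
    _ = 2 * ∫⁻ t in Set.Icc (0 : ℝ) 1, invSqrt (-a / m + t) :=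
        lintegral_const_mul _ (by fun_prop)
    _ ≤ _ := by push_cast; gcongr; exact hC _

end SingularIntegrals

/-! ### The decaying weight and the distance to a sphere of codimension two. -/

section Kernel

variable {d : ℕ}

/-- The weight `(1 + |x|)^{-d-1}`. -/
noncomputable def decay (x : EuclideanSpace ℝ (Fin d)) : ℝ := (1 + ‖x‖) ^ (-((d : ℝ) + 1))

theorem decay_pos (x : EuclideanSpace ℝ (Fin d)) : 0 < decay x := by unfold decay; positivity

theorem continuous_decay : Continuous (decay (d := d)) := by
  unfold decay
  exact Continuous.rpow_const (by fun_prop) fun x => Or.inl (by positivity)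

@[fun_prop]
theorem measurable_decay : Measurable (decay (d := d)) := continuous_decay.measurable

theorem integrable_decay : Integrable (decay (d := d)) volume :=
  integrable_one_add_norm (by simp)

/-- The constant 5 comes from 1 + ‖v‖ ≤ 5 + ‖u‖ ≤ 5(1 + ‖u‖). The displacement 4 is what the
dilations and translations in `exists_lintegral_singular_le` can produce. -/
theorem decay_le_mul_decay {u v : EuclideanSpace ℝ (Fin d)} (h : ‖u - v‖ ≤ 4) :
    decay u ≤ 5 ^ ((d : ℝ) + 1) * decay v := by
  have h1 : 1 + ‖v‖ ≤ 5 * (1 + ‖u‖) := by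
    have h2 : ‖v‖ ≤ ‖u‖ + ‖u - v‖ := by
      have := norm_sub_le u (u - v)
      simpa using this
    linarith [norm_nonneg u]
  have h0 : (0 : ℝ) < 1 + ‖u‖ := by positivity
  have hv0 : (0 : ℝ) < 1 + ‖v‖ := by positivity
  unfold decay
  rw [Real.rpow_neg h0.le, Real.rpow_neg hv0.le, inv_le_iff_one_le_mul₀ (by positivity),
    mul_right_comm, ← Real.mul_rpow (by norm_num) h0.le, ← div_eq_mul_inv,
    one_le_div (by positivity)]
  gcongr

theorem lintegral_decay_lt_top :
    ∫⁻ x : EuclideanSpace ℝ (Fin d), ENNReal.ofReal (decay x) < ⊤ := by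
  have := (integrable_decay (d := d)).2
  rw [hasFiniteIntegral_iff_ofReal (Eventually.of_forall fun x => (decay_pos x).le)] at this
  exact this

theorem lintegral_smul_add {a : ℝ} (ha : 1 ≤ a) (v : EuclideanSpace ℝ (Fin d))
    {F : EuclideanSpace ℝ (Fin d) → ℝ≥0∞} (hF : Measurable F) :
    ∫⁻ x, F x = ENNReal.ofReal (a ^ d) * ∫⁻ z, F (a • z + v) := by
  have ha0 : a ≠ 0 := by linarith
  have h1 : ∫⁻ z, F (a • z + v) = ENNReal.ofReal ((a ^ d)⁻¹) * ∫⁻ x, F x := by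
    have h2 : ∫⁻ z, F (a • z + v) =
        ∫⁻ x, F (x + v) ∂(Measure.map (fun z : EuclideanSpace ℝ (Fin d) => a • z) volume) := by
      rw [lintegral_map (by fun_prop) (by fun_prop)]
    rw [h2, Measure.map_addHaar_smul volume ha0, lintegral_smul_measure,
      lintegral_add_right_eq_self F v]
    simp [abs_of_nonneg (by positivity : (0 : ℝ) ≤ (a ^ d)⁻¹)]
  rw [h1, ← mul_assoc, ← ENNReal.ofReal_mul (by positivity), mul_inv_cancel₀ (by positivity)]
  simp

/-- The component of `η` orthogonal to the unit vector `e`. -/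
noncomputable def perp (e η : EuclideanSpace ℝ (Fin d)) : EuclideanSpace ℝ (Fin d) :=
  η - inner ℝ e η • e

theorem norm_sq_eq_perp {e : EuclideanSpace ℝ (Fin d)} (he : ‖e‖ = 1)
    (η : EuclideanSpace ℝ (Fin d)) : ‖η‖ ^ 2 = (inner ℝ e η) ^ 2 + ‖perp e η‖ ^ 2 := by
  rw [perp, norm_sub_sq_real, inner_smul_right, norm_smul, he, real_inner_comm]
  simp
  ring

/-- The distance from `η` to the sphere of radius `s` in the hyperplane orthogonal to `e`. -/
noncomputable def sphereDist (e : EuclideanSpace ℝ (Fin d)) (s : ℝ)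
    (η : EuclideanSpace ℝ (Fin d)) : ℝ :=
  Real.sqrt ((s - ‖perp e η‖) ^ 2 + (inner ℝ e η) ^ 2)

@[fun_prop]
theorem continuous_perp (e : EuclideanSpace ℝ (Fin d)) : Continuous (perp e) := by
  unfold perp; fun_prop

@[fun_prop]
theorem continuous_sphereDist (e : EuclideanSpace ℝ (Fin d)) (s : ℝ) :
    Continuous (sphereDist e s) := by
  unfold sphereDist; fun_prop

/-- By a² + b² ≥ |ab| the distance is at least √|a| √|b|, with a and b the two coordinates
transverse to the sphere. This separates the singularity into two one-dimensional integrable ones;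
at distance at least 1 the inverse is at most 1. -/
theorem inv_sphereDist_le (e : EuclideanSpace ℝ (Fin d)) (s : ℝ) (η : EuclideanSpace ℝ (Fin d)) :
    (ENNReal.ofReal (sphereDist e s η))⁻¹ ≤ 1 +
      {η | |inner ℝ e η| < 1 ∧ |s - ‖perp e η‖| < 1}.indicator
        (fun η => invSqrt (inner ℝ e η) * invSqrt (s - ‖perp e η‖)) η := by
  by_cases h : 1 ≤ sphereDist e s η
  · refine le_add_right ?_
    rw [ENNReal.inv_le_one, ENNReal.one_le_ofReal]
    exact h
  · push Not at h
    have hmem : η ∈ {η | |inner ℝ e η| < 1 ∧ |s - ‖perp e η‖| < 1} := by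
      rw [sphereDist, Real.sqrt_lt' one_pos] at h
      constructor
      · rw [← sq_lt_one_iff_abs_lt_one]; nlinarith [sq_nonneg (s - ‖perp e η‖)]
      · rw [← sq_lt_one_iff_abs_lt_one]; nlinarith [sq_nonneg (inner ℝ e η)]
    rw [Set.indicator_of_mem hmem]
    refine le_add_left ?_
    rw [invSqrt, invSqrt, ← ENNReal.mul_inv (Or.inr (by simp)) (Or.inl (by simp)),
      ← ENNReal.mul_rpow_of_nonneg _ _ (by norm_num), ← enorm_mul, ENNReal.inv_le_inv,
      ← ofReal_norm, ENNReal.ofReal_rpow_of_nonneg (norm_nonneg _) (by norm_num)]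
    refine ENNReal.ofReal_le_ofReal ?_
    rw [← Real.sqrt_eq_rpow, sphereDist]
    refine Real.sqrt_le_sqrt ?_
    rw [Real.norm_eq_abs, abs_le]
    constructor <;>
      nlinarith [sq_nonneg (inner ℝ e η + (s - ‖perp e η‖)), sq_nonneg (inner ℝ e η - (s - ‖perp e η‖)),
        sq_nonneg (inner ℝ e η), sq_nonneg (s - ‖perp e η‖)]

end Kernel

/-! ### Uniform integrability of the inverse distance to the sphere. -/

section KernelBound

variable {d : ℕ}

theorem inner_smul_add_smul {e : EuclideanSpace ℝ (Fin d)} (he : ‖e‖ = 1) (a σ : ℝ)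
    (z : EuclideanSpace ℝ (Fin d)) : inner ℝ e (a • z + σ • e) = a * inner ℝ e z + σ := by
  rw [inner_add_right, inner_smul_right, inner_smul_right, real_inner_self_eq_norm_sq, he]
  ring

theorem perp_smul_add_smul {e : EuclideanSpace ℝ (Fin d)} (he : ‖e‖ = 1) (a σ : ℝ)
    (z : EuclideanSpace ℝ (Fin d)) : perp e (a • z + σ • e) = a • perp e z := by
  rw [perp, inner_smul_add_smul he, perp, smul_sub, smul_smul, add_smul]
  abel

/-- The integrals of the singular weight near a sphere of codimension two are bounded uniformly in
the radius of the sphere. -/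
theorem exists_lintegral_singular_le (d : ℕ) : ∃ C : NNReal, ∀ (s : ℝ), 2 ≤ s →
    ∀ (e : EuclideanSpace ℝ (Fin d)), ‖e‖ = 1 → ∀ ξ : EuclideanSpace ℝ (Fin d),
      ∫⁻ η, ENNReal.ofReal (decay (ξ - η)) *
        {η | |inner ℝ e η| < 1 ∧ |s - ‖perp e η‖| < 1}.indicator
          (fun η => invSqrt (inner ℝ e η) * invSqrt (s - ‖perp e η‖)) η ≤ C := by
  obtain ⟨C₁, hC₁⟩ := exists_lintegral_invSqrt_le
  obtain ⟨C₂, hC₂⟩ := exists_lintegral_invSqrt_mul_le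
  set K := ∫⁻ x : EuclideanSpace ℝ (Fin d), ENNReal.ofReal (decay x) with hK
  have hKt : K ≠ ⊤ := lintegral_decay_lt_top.ne
  set A : ℝ≥0∞ := ENNReal.ofReal (2 ^ d) * ENNReal.ofReal (5 ^ ((d : ℝ) + 1)) * (C₁ * C₂) * K with hA
  have hAt : A ≠ ⊤ := by
    rw [hA]
    exact ENNReal.mul_ne_top (by finiteness) hKt
  refine ⟨A.toNNReal, fun s hs e he ξ => ?_⟩
  rw [ENNReal.coe_toNNReal hAt]
  set S : Set (EuclideanSpace ℝ (Fin d)) := {η | |inner ℝ e η| < 1 ∧ |s - ‖perp e η‖| < 1} with hS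
  have hSm : MeasurableSet S := by
    have h1 : Continuous fun η : EuclideanSpace ℝ (Fin d) => |inner ℝ e η| := by fun_prop
    have h2 : Continuous fun η : EuclideanSpace ℝ (Fin d) => |s - ‖perp e η‖| := by fun_prop
    exact ((isOpen_lt h1 continuous_const).inter (isOpen_lt h2 continuous_const)).measurableSet
  set F : EuclideanSpace ℝ (Fin d) → ℝ≥0∞ :=
    S.indicator (fun η => invSqrt (inner ℝ e η) * invSqrt (s - ‖perp e η‖)) with hF
  have hFm : Measurable F := by
    refine Measurable.indicator ?_ hSm
    fun_prop
  set ν : Measure ℝ := volume.restrict (Set.Icc 0 1) with hν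
  have hν1 : IsProbabilityMeasure ν := ⟨by simp [hν]⟩
  -- The two parameters move a point across the sphere: the dilation changes `‖perp e z‖`, which is
  -- comparable with `s`, at a rate comparable with 1, and the translation changes the component
  -- along `e` at unit speed. Averaging the integral over the unit square of parameters turns the
  -- singular directions into one-dimensional integrals, without polar coordinates.
  set T : ℝ × ℝ → EuclideanSpace ℝ (Fin d) → EuclideanSpace ℝ (Fin d) :=
    fun p z => (1 + p.1 / s) • z + p.2 • e with hT
  have hTm : Measurable fun q : (ℝ × ℝ) × EuclideanSpace ℝ (Fin d) => T q.1 q.2 := by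
    rw [hT]; fun_prop
  have hs0 : 0 < s := by linarith
  have hae : ∀ᵐ p ∂(ν.prod ν), p ∈ Set.Icc (0 : ℝ) 1 ×ˢ Set.Icc (0 : ℝ) 1 := by
    rw [hν, Measure.prod_restrict]
    exact ae_restrict_mem (measurableSet_Icc.prod measurableSet_Icc)
  -- change variables for fixed parameters
  have h1 : ∀ p ∈ Set.Icc (0 : ℝ) 1 ×ˢ Set.Icc (0 : ℝ) 1,
      ∫⁻ η, ENNReal.ofReal (decay (ξ - η)) * F η ≤
        ENNReal.ofReal (2 ^ d) * ENNReal.ofReal (5 ^ ((d : ℝ) + 1)) *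
          ∫⁻ z, ENNReal.ofReal (decay (ξ - z)) * F (T p z) := by
    rintro ⟨τ, σ⟩ ⟨hτ, hσ⟩
    simp only at hτ hσ
    have ha : 1 ≤ 1 + τ / s := by have := div_nonneg hτ.1 hs0.le; linarith
    have ha2 : 1 + τ / s ≤ 2 := by
      have : τ / s ≤ 1 := by rw [div_le_one hs0]; linarith [hτ.2]
      linarith
    rw [lintegral_smul_add ha (σ • e) (F := fun η => ENNReal.ofReal (decay (ξ - η)) * F η)
      (by fun_prop), mul_assoc]
    gcongr
    rw [← lintegral_const_mul' _ _ (by finiteness)]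
    refine lintegral_mono fun z => ?_
    change _ * F (T (τ, σ) z) ≤ _
    by_cases hz : T (τ, σ) z ∈ S
    · rw [← mul_assoc, ← ENNReal.ofReal_mul (by positivity)]
      gcongr
      refine decay_le_mul_decay ?_
      have hx := hz.1
      have hy := hz.2
      have h3 : ‖T (τ, σ) z‖ ≤ s + 2 := by
        have h4 : T (τ, σ) z = perp e (T (τ, σ) z) + inner ℝ e (T (τ, σ) z) • e := by
          rw [perp]; abel
        rw [h4]
        refine (norm_add_le _ _).trans ?_
        rw [norm_smul, he, Real.norm_eq_abs]
        have := (abs_lt.1 hy).1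
        linarith
      have h5 : (1 + τ / s) * ‖z‖ ≤ s + 3 := by
        have h6 : (1 + τ / s) • z = T (τ, σ) z - σ • e := by simp [hT]
        have h7 : ‖(1 + τ / s) • z‖ = (1 + τ / s) * ‖z‖ := by
          rw [norm_smul, Real.norm_of_nonneg (by linarith)]
        rw [← h7, h6]
        refine (norm_sub_le _ _).trans ?_
        rw [norm_smul, he, Real.norm_of_nonneg hσ.1]
        linarith [hσ.2]
      have hz3 : ‖z‖ ≤ s + 3 := by nlinarith [norm_nonneg z]
      have h8 : ξ - ((1 + τ / s) • z + σ • e) - (ξ - z) = -((τ / s) • z + σ • e) := by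
        rw [add_smul, one_smul]; abel
      rw [h8, norm_neg]
      refine (norm_add_le _ _).trans ?_
      rw [norm_smul, norm_smul, he, Real.norm_of_nonneg (div_nonneg hτ.1 hs0.le),
        Real.norm_of_nonneg hσ.1]
      -- From ‖z‖ ≤ s + 3 and s ≥ 2; adding the translation of length at most 1 gives the
      -- displacement 4.
      have h9 : τ / s * ‖z‖ ≤ 3 := by
        rw [div_mul_eq_mul_div, div_le_iff₀ hs0]
        nlinarith [hτ.1, hτ.2, norm_nonneg z]
      linarith [hσ.2]
    · have : F (T (τ, σ) z) = 0 := by rw [hF, Set.indicator_of_notMem hz]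
      rw [this]; simp
  -- integrate over the parameters
  have h2 : ∀ z, ∫⁻ p, F (T p z) ∂(ν.prod ν) ≤ C₁ * C₂ := by
    intro z
    have hb : ∀ p ∈ Set.Icc (0 : ℝ) 1 ×ˢ Set.Icc (0 : ℝ) 1, F (T p z) ≤
        (if 1 / 4 ≤ ‖perp e z‖ / s then invSqrt ((s - ‖perp e z‖) - p.1 * (‖perp e z‖ / s)) else 0) *
          invSqrt ((1 + p.1 / s) * inner ℝ e z + p.2) := by
      rintro ⟨τ, σ⟩ ⟨hτ, hσ⟩
      simp only at hτ hσ
      by_cases hz : T (τ, σ) z ∈ S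
      · have ha : 0 ≤ 1 + τ / s := by have := div_nonneg hτ.1 hs0.le; linarith
        have hn : ‖perp e (T (τ, σ) z)‖ = (1 + τ / s) * ‖perp e z‖ := by
          simp only [hT]
          rw [perp_smul_add_smul he, norm_smul, Real.norm_of_nonneg ha]
        have hi : inner ℝ e (T (τ, σ) z) = (1 + τ / s) * inner ℝ e z + σ := by
          simp only [hT]
          rw [inner_smul_add_smul he]
        -- On `S` the dilated radius exceeds s - 1 ≥ s/2, while the dilation factor is at most 3/2.
        -- Thus the quotient is at least 1/3, so the radial coordinate really moves with τ.
        have hq : 1 / 4 ≤ ‖perp e z‖ / s := by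
          rw [le_div_iff₀ hs0]
          have hy := (abs_lt.1 hz.2).2
          rw [hn] at hy
          have : τ / s ≤ 1 / 2 := by rw [div_le_iff₀ hs0]; linarith [hτ.2]
          nlinarith [norm_nonneg (perp e z)]
        rw [hF, Set.indicator_of_mem hz, if_pos hq, hi, hn, mul_comm]
        have : s - (1 + τ / s) * ‖perp e z‖ = s - ‖perp e z‖ - τ * (‖perp e z‖ / s) := by ring
        rw [this]
      · rw [hF, Set.indicator_of_notMem hz]; exact zero_le
    calc ∫⁻ p, F (T p z) ∂(ν.prod ν)
        ≤ ∫⁻ p, (if 1 / 4 ≤ ‖perp e z‖ / s then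
            invSqrt ((s - ‖perp e z‖) - p.1 * (‖perp e z‖ / s)) else 0) *
              invSqrt ((1 + p.1 / s) * inner ℝ e z + p.2) ∂(ν.prod ν) :=
          lintegral_mono_ae (by filter_upwards [hae] with p hp using hb p hp)
      _ ≤ C₁ * C₂ := by
          split_ifs with hq
          · rw [lintegral_prod _ (by fun_prop)]
            simp only
            -- The translation parameter is integrated first: its bound `C₁` does not see the shift
            -- that depends on the dilation parameter.
            calc ∫⁻ x, ∫⁻ y, invSqrt (s - ‖perp e z‖ - x * (‖perp e z‖ / s)) *
                  invSqrt ((1 + x / s) * inner ℝ e z + y) ∂ν ∂ν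
                ≤ ∫⁻ x, invSqrt (s - ‖perp e z‖ - x * (‖perp e z‖ / s)) * C₁ ∂ν := by
                  refine lintegral_mono fun x => ?_
                  rw [lintegral_const_mul _ (by fun_prop)]
                  gcongr
                  exact hC₁ _
              _ ≤ C₁ * C₂ := by
                  rw [lintegral_mul_const _ (by fun_prop), mul_comm]
                  gcongr
                  exact hC₂ _ _ hq
          · simp
  calc ∫⁻ η, ENNReal.ofReal (decay (ξ - η)) * F η
      = ∫⁻ _p, (∫⁻ η, ENNReal.ofReal (decay (ξ - η)) * F η) ∂(ν.prod ν) := by simp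
    _ ≤ ∫⁻ p, (ENNReal.ofReal (2 ^ d) * ENNReal.ofReal (5 ^ ((d : ℝ) + 1)) *
          ∫⁻ z, ENNReal.ofReal (decay (ξ - z)) * F (T p z)) ∂(ν.prod ν) :=
        lintegral_mono_ae (by filter_upwards [hae] with p hp using h1 p hp)
    _ = ENNReal.ofReal (2 ^ d) * ENNReal.ofReal (5 ^ ((d : ℝ) + 1)) *
          ∫⁻ z, ENNReal.ofReal (decay (ξ - z)) * ∫⁻ p, F (T p z) ∂(ν.prod ν) := by
        rw [lintegral_const_mul' _ _ (by finiteness), lintegral_lintegral_swap]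
        · congr 1
          refine lintegral_congr fun z => ?_
          rw [lintegral_const_mul' _ _ (by finiteness)]
        · exact (Measurable.mul (by fun_prop) (hFm.comp hTm)).aemeasurable
    _ ≤ ENNReal.ofReal (2 ^ d) * ENNReal.ofReal (5 ^ ((d : ℝ) + 1)) *
          ∫⁻ z, ENNReal.ofReal (decay (ξ - z)) * (C₁ * C₂) := by
        gcongr with z
        exact h2 z
    _ = A := by
        rw [lintegral_mul_const _ (by fun_prop),
          lintegral_sub_left_eq_self (fun z => ENNReal.ofReal (decay z)) ξ, hA]
        ring

theorem exists_lintegral_inv_sphereDist_le (d : ℕ) : ∃ C : NNReal, ∀ (s : ℝ), 2 ≤ s →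
    ∀ (e : EuclideanSpace ℝ (Fin d)), ‖e‖ = 1 → ∀ ξ : EuclideanSpace ℝ (Fin d),
      ∫⁻ η, ENNReal.ofReal (decay (ξ - η)) * (ENNReal.ofReal (sphereDist e s η))⁻¹ ≤ C := by
  obtain ⟨C, hC⟩ := exists_lintegral_singular_le d
  set K := ∫⁻ x : EuclideanSpace ℝ (Fin d), ENNReal.ofReal (decay x) with hK
  have hKt : K ≠ ⊤ := lintegral_decay_lt_top.ne
  refine ⟨K.toNNReal + C, fun s hs e he ξ => ?_⟩
  push_cast
  rw [ENNReal.coe_toNNReal hKt]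
  calc ∫⁻ η, ENNReal.ofReal (decay (ξ - η)) * (ENNReal.ofReal (sphereDist e s η))⁻¹
      ≤ ∫⁻ η, (ENNReal.ofReal (decay (ξ - η)) + ENNReal.ofReal (decay (ξ - η)) *
        {η | |inner ℝ e η| < 1 ∧ |s - ‖perp e η‖| < 1}.indicator
          (fun η => invSqrt (inner ℝ e η) * invSqrt (s - ‖perp e η‖)) η) := by
        refine lintegral_mono fun η => ?_
        have := mul_le_mul_right (inv_sphereDist_le e s η) (ENNReal.ofReal (decay (ξ - η)))
        rwa [mul_add, mul_one] at this
    _ ≤ K + C := by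
        rw [lintegral_add_left (by fun_prop),
          lintegral_sub_left_eq_self (fun z => ENNReal.ofReal (decay z)) ξ]
        gcongr
        exact hC s hs e he ξ

end KernelBound

/-! ### Lower bounds for the symbol and integrability of its inverse. -/

section Symbol

variable {d : ℕ}

/-- `ζ = s e + i b` with `e` a unit vector, `b` orthogonal to `e` and `|b| = s`, so that
`ζ · ζ = 0`. -/
structure IsNull (ζ : Fin d → ℂ) (s : ℝ) (e b : EuclideanSpace ℝ (Fin d)) : Prop where
  norm_e : ‖e‖ = 1
  inner_eq : inner ℝ e b = 0
  norm_b : ‖b‖ = s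
  eq : ∀ j, ζ j = (s : ℂ) * (e j : ℂ) + Complex.I * (b j : ℂ)

theorem cdot_ofReal (x b : EuclideanSpace ℝ (Fin d)) :
    cdot x (fun j => (b j : ℂ)) = (inner ℝ x b : ℝ) := by
  simp [cdot, PiLp.inner_apply, mul_comm]

theorem IsNull.cdot_eq {ζ : Fin d → ℂ} {s : ℝ} {e b : EuclideanSpace ℝ (Fin d)}
    (h : IsNull ζ s e b) (x : EuclideanSpace ℝ (Fin d)) :
    cdot x ζ = (s : ℂ) * (inner ℝ e x : ℝ) + Complex.I * (inner ℝ b x : ℝ) := by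
  rw [real_inner_comm, ← cdot_ofReal x e, real_inner_comm, ← cdot_ofReal x b]
  simp only [cdot, h.eq, Finset.mul_sum, ← Finset.sum_add_distrib]
  refine Finset.sum_congr rfl fun j _ => ?_
  ring

theorem IsNull.sum_sq {ζ : Fin d → ℂ} {s : ℝ} {e b : EuclideanSpace ℝ (Fin d)}
    (h : IsNull ζ s e b) : ∑ j, ζ j * ζ j = 0 := by
  have h1 : ∑ j, ζ j * ζ j = (s : ℂ) * cdot e ζ + Complex.I * cdot b ζ := by
    simp only [cdot, Finset.mul_sum, ← Finset.sum_add_distrib]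
    refine Finset.sum_congr rfl fun j _ => ?_
    rw [h.eq]
    ring
  rw [h1, h.cdot_eq, h.cdot_eq, real_inner_self_eq_norm_sq, real_inner_self_eq_norm_sq, h.norm_e,
    h.norm_b, real_inner_comm, h.inner_eq]
  push_cast
  ring_nf
  simp

theorem IsNull.symbol_eq {ζ : Fin d → ℂ} {s : ℝ} {e b : EuclideanSpace ℝ (Fin d)}
    (h : IsNull ζ s e b) (x : EuclideanSpace ℝ (Fin d)) :
    symbol ζ x = ((-‖x‖ ^ 2 - 2 * inner ℝ b x : ℝ) : ℂ) +
      ((2 * s * inner ℝ e x : ℝ) : ℂ) * Complex.I := by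
  rw [symbol, h.cdot_eq]
  push_cast
  ring_nf
  simp
  ring

theorem IsNull.norm_symbol_sq {ζ : Fin d → ℂ} {s : ℝ} {e b : EuclideanSpace ℝ (Fin d)}
    (h : IsNull ζ s e b) (x : EuclideanSpace ℝ (Fin d)) :
    ‖symbol ζ x‖ ^ 2 = (‖x‖ ^ 2 + 2 * inner ℝ b x) ^ 2 + (2 * s * inner ℝ e x) ^ 2 := by
  rw [h.symbol_eq, Complex.sq_norm, Complex.normSq_add_mul_I]
  ring

/-- With t = e·x and p = ‖perp e (x + b)‖, the squared symbol factors as ((s-p)² + t²)((s+p)² + t²).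
The first factor is the squared distance and the second is at least s². -/
theorem IsNull.le_norm_symbol {ζ : Fin d → ℂ} {s : ℝ} {e b : EuclideanSpace ℝ (Fin d)}
    (h : IsNull ζ s e b) (x : EuclideanSpace ℝ (Fin d)) :
    s * sphereDist e s (x + b) ≤ ‖symbol ζ x‖ := by
  have hs : 0 ≤ s := h.norm_b ▸ norm_nonneg b
  refine (le_abs_self _).trans (abs_le_of_sq_le_sq ?_ (norm_nonneg _))
  rw [h.norm_symbol_sq, mul_pow, sphereDist, Real.sq_sqrt (by positivity)]
  have h1 : inner ℝ e (x + b) = inner ℝ e x := by rw [inner_add_right, h.inner_eq, add_zero]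
  have h2 := norm_sq_eq_perp h.norm_e (x + b)
  rw [norm_add_sq_real, h.norm_b, h1, real_inner_comm] at h2
  rw [h1]
  set p := ‖perp e (x + b)‖
  set t : ℝ := inner ℝ e x
  have hp : 0 ≤ p := norm_nonneg _
  have h3 : ‖x‖ ^ 2 + 2 * inner ℝ b x = t ^ 2 + p ^ 2 - s ^ 2 := by linarith
  rw [h3]
  have h4 : (t ^ 2 + p ^ 2 - s ^ 2) ^ 2 + (2 * s * t) ^ 2 =
      ((s - p) ^ 2 + t ^ 2) * ((s + p) ^ 2 + t ^ 2) := by ring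
  rw [h4, mul_comm (s ^ 2)]
  gcongr
  nlinarith [mul_nonneg hs hp, sq_nonneg t, sq_nonneg p]

theorem sphereDist_smul (e : EuclideanSpace ℝ (Fin d)) {a : ℝ} (ha : 0 < a) (s : ℝ)
    (x : EuclideanSpace ℝ (Fin d)) : sphereDist e (a * s) (a • x) = a * sphereDist e s x := by
  have h1 : perp e (a • x) = a • perp e x := by
    rw [perp, inner_smul_right, perp, smul_sub, smul_smul]
  rw [sphereDist, sphereDist, h1, norm_smul, inner_smul_right, Real.norm_of_nonneg ha.le,
    ← Real.sqrt_sq ha.le, ← Real.sqrt_mul (by positivity), Real.sqrt_sq ha.le]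
  congr 1
  ring

@[fun_prop]
theorem continuous_symbol (ζ : Fin d → ℂ) : Continuous (symbol ζ) := by
  unfold symbol cdot
  fun_prop

/-- The modulus of the symbol, in the frequency variable of the Fourier transform. -/
noncomputable def absSymbol (ζ : Fin d → ℂ) (ξ : EuclideanSpace ℝ (Fin d)) : ℝ :=
  ‖symbol ζ ((2 * Real.pi) • ξ)‖

@[fun_prop]
theorem continuous_absSymbol (ζ : Fin d → ℂ) : Continuous (absSymbol ζ) := by
  unfold absSymbol
  fun_prop

theorem absSymbol_nonneg (ζ : Fin d → ℂ) (ξ : EuclideanSpace ℝ (Fin d)) : 0 ≤ absSymbol ζ ξ :=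
  norm_nonneg _

/-- Uniform integrability of the inverse symbol against rapidly decaying weights. -/
theorem exists_lintegral_inv_absSymbol_le (d : ℕ) : ∃ C : NNReal, ∀ (ζ : Fin d → ℂ) (s : ℝ)
    (e b : EuclideanSpace ℝ (Fin d)), IsNull ζ s e b → 13 ≤ s → ∀ ξ : EuclideanSpace ℝ (Fin d),
      ∫⁻ η, ENNReal.ofReal (decay (ξ - η)) * (ENNReal.ofReal (absSymbol ζ η))⁻¹ ≤
        C * ENNReal.ofReal s⁻¹ := by
  obtain ⟨C, hC⟩ := exists_lintegral_inv_sphereDist_le d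
  refine ⟨C, fun ζ s e b h hs ξ => ?_⟩
  have hs0 : 0 < s := by linarith
  have hpi : 0 < 2 * Real.pi := by positivity
  set b' := (2 * Real.pi)⁻¹ • b with hb'
  set s' := (2 * Real.pi)⁻¹ * s with hs'
  -- The threshold 13 exceeds 4π, so the rescaled radius s/(2π) is at least 2.
  have hs2 : 2 ≤ s' := by
    rw [hs', inv_mul_eq_div, le_div_iff₀ hpi]
    nlinarith [Real.pi_lt_d2]
  have hle : ∀ η, s * sphereDist e s' (η + b') ≤ absSymbol ζ η := by
    intro η
    have h1 := h.le_norm_symbol ((2 * Real.pi) • η)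
    have h2 : (2 * Real.pi) • η + b = (2 * Real.pi) • (η + b') := by
      rw [hb', smul_add, smul_smul, mul_inv_cancel₀ hpi.ne', one_smul]
    have h3 : s = 2 * Real.pi * s' := by rw [hs', mul_inv_cancel_left₀ hpi.ne']
    rw [h2] at h1
    nth_rw 2 [h3] at h1
    rw [sphereDist_smul e hpi] at h1
    refine le_trans ?_ h1
    gcongr
    have h5 : 0 ≤ sphereDist e s' (η + b') := Real.sqrt_nonneg _
    nlinarith [Real.pi_gt_three]
  calc ∫⁻ η, ENNReal.ofReal (decay (ξ - η)) * (ENNReal.ofReal (absSymbol ζ η))⁻¹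
      ≤ ∫⁻ η, ENNReal.ofReal s⁻¹ * (ENNReal.ofReal (decay (ξ + b' - (η + b'))) *
          (ENNReal.ofReal (sphereDist e s' (η + b')))⁻¹) := by
        refine lintegral_mono fun η => ?_
        rw [add_sub_add_right_eq_sub, mul_left_comm]
        gcongr
        rw [ENNReal.ofReal_inv_of_pos hs0,
          ← ENNReal.mul_inv (Or.inr (by simp)) (Or.inl (by simp)), ← ENNReal.ofReal_mul hs0.le,
          ENNReal.inv_le_inv]
        exact ENNReal.ofReal_le_ofReal (hle η)
    _ = ENNReal.ofReal s⁻¹ * ∫⁻ η, ENNReal.ofReal (decay (ξ + b' - η)) *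
          (ENNReal.ofReal (sphereDist e s' η))⁻¹ := by
        rw [lintegral_const_mul' _ _ (by finiteness)]
        congr 1
        exact lintegral_add_right_eq_self (fun η => ENNReal.ofReal (decay (ξ + b' - η)) *
          (ENNReal.ofReal (sphereDist e s' η))⁻¹) b'
    _ ≤ _ := by
        rw [mul_comm]
        gcongr
        exact hC s' hs2 e h.norm_e _

/-- If ‖x‖ > 4s, the real part alone gives |p| ≥ ‖x‖² - 2s‖x‖ ≥ ‖x‖²/2; otherwise the second
alternative is immediate. -/
theorem IsNull.norm_sq_div_le {ζ : Fin d → ℂ} {s : ℝ} {e b : EuclideanSpace ℝ (Fin d)}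
    (h : IsNull ζ s e b) (x : EuclideanSpace ℝ (Fin d)) :
    ‖x‖ ^ 2 ≤ 2 * ‖symbol ζ x‖ ∨ ‖x‖ ^ 2 ≤ 16 * s ^ 2 := by
  have hs : 0 ≤ s := h.norm_b ▸ norm_nonneg b
  by_cases hx : ‖x‖ ≤ 4 * s
  · right
    nlinarith [norm_nonneg x]
  · left
    push Not at hx
    have h1 : |‖x‖ ^ 2 + 2 * inner ℝ b x| ≤ ‖symbol ζ x‖ := by
      refine abs_le_of_sq_le_sq ?_ (norm_nonneg _)
      rw [h.norm_symbol_sq]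
      nlinarith [sq_nonneg (2 * s * inner ℝ e x)]
    have h2 := (abs_le.1 (abs_real_inner_le_norm b x)).1
    rw [h.norm_b] at h2
    have h3 := (le_abs_self _).trans h1
    nlinarith [norm_nonneg x]

/-- This is the bound for ∇ψ. The factor ‖x‖² costs s² only near the characteristic set, so 1/s
becomes s, and the geometric mean of the two bounds is independent of s. -/
theorem exists_lintegral_norm_sq_inv_absSymbol_le (d : ℕ) : ∃ C : NNReal, ∀ (ζ : Fin d → ℂ) (s : ℝ)
    (e b : EuclideanSpace ℝ (Fin d)), IsNull ζ s e b → 13 ≤ s → ∀ ξ : EuclideanSpace ℝ (Fin d),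
      ∫⁻ η, ENNReal.ofReal (decay (ξ - η)) * (ENNReal.ofReal (‖(2 * Real.pi) • η‖ ^ 2) *
        (ENNReal.ofReal (absSymbol ζ η))⁻¹) ≤ C * ENNReal.ofReal s := by
  obtain ⟨C, hC⟩ := exists_lintegral_inv_absSymbol_le d
  set K := ∫⁻ x : EuclideanSpace ℝ (Fin d), ENNReal.ofReal (decay x) with hK
  have hKt : K ≠ ⊤ := lintegral_decay_lt_top.ne
  refine ⟨2 * K.toNNReal + 16 * C, fun ζ s e b h hs ξ => ?_⟩
  have hs0 : 0 < s := by linarith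
  have hpt : ∀ η, ENNReal.ofReal (‖(2 * Real.pi) • η‖ ^ 2) * (ENNReal.ofReal (absSymbol ζ η))⁻¹ ≤
      2 + ENNReal.ofReal (16 * s ^ 2) * (ENNReal.ofReal (absSymbol ζ η))⁻¹ := by
    intro η
    rcases h.norm_sq_div_le ((2 * Real.pi) • η) with h1 | h1
    · refine le_add_right ?_
      calc ENNReal.ofReal (‖(2 * Real.pi) • η‖ ^ 2) * (ENNReal.ofReal (absSymbol ζ η))⁻¹
          ≤ ENNReal.ofReal (2 * absSymbol ζ η) * (ENNReal.ofReal (absSymbol ζ η))⁻¹ := by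
            gcongr; exact h1
        _ = 2 * (ENNReal.ofReal (absSymbol ζ η) * (ENNReal.ofReal (absSymbol ζ η))⁻¹) := by
            rw [ENNReal.ofReal_mul (by norm_num), mul_assoc]; simp
        _ ≤ 2 * 1 := by gcongr; exact ENNReal.mul_inv_le_one _
        _ = 2 := mul_one _
    · refine le_add_left ?_
      gcongr
  calc ∫⁻ η, ENNReal.ofReal (decay (ξ - η)) * (ENNReal.ofReal (‖(2 * Real.pi) • η‖ ^ 2) *
        (ENNReal.ofReal (absSymbol ζ η))⁻¹)
      ≤ ∫⁻ η, (ENNReal.ofReal (decay (ξ - η)) * 2 + ENNReal.ofReal (16 * s ^ 2) *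
          (ENNReal.ofReal (decay (ξ - η)) * (ENNReal.ofReal (absSymbol ζ η))⁻¹)) := by
        refine lintegral_mono fun η => ?_
        rw [mul_left_comm (ENNReal.ofReal (16 * s ^ 2)), ← mul_add]
        gcongr
        exact hpt η
    _ ≤ K * 2 + ENNReal.ofReal (16 * s ^ 2) * (C * ENNReal.ofReal s⁻¹) := by
        rw [lintegral_add_left (by fun_prop), lintegral_mul_const _ (by fun_prop),
          lintegral_const_mul' _ _ (by finiteness),
          lintegral_sub_left_eq_self (fun z => ENNReal.ofReal (decay z)) ξ]
        gcongr
        exact hC ζ s e b h hs ξ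
    _ ≤ _ := by
        push_cast
        rw [ENNReal.coe_toNNReal hKt, add_mul, mul_comm K, mul_left_comm,
          ← ENNReal.ofReal_mul (by positivity)]
        have h3 : 16 * s ^ 2 * s⁻¹ = 16 * s := by field_simp
        rw [h3, ENNReal.ofReal_mul (by norm_num)]
        refine add_le_add ?_ ?_
        · refine le_mul_of_one_le_right zero_le ?_
          rw [ENNReal.one_le_ofReal]; linarith
        · rw [ENNReal.ofReal_ofNat]
          refine le_of_eq ?_
          ring

/-- The inverse symbol is infinite on the zero set, which must be null because the weighted integral
is finite. -/
theorem IsNull.ae_absSymbol_pos {ζ : Fin d → ℂ} {s : ℝ} {e b : EuclideanSpace ℝ (Fin d)}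
    (h : IsNull ζ s e b) (hs : 13 ≤ s) : ∀ᵐ ξ, 0 < absSymbol ζ ξ := by
  obtain ⟨C, hC⟩ := exists_lintegral_inv_absSymbol_le d
  have h1 := hC ζ s e b h hs 0
  have hm : AEMeasurable (fun η => ENNReal.ofReal (decay (0 - η)) *
      (ENNReal.ofReal (absSymbol ζ η))⁻¹) volume := by fun_prop
  have h2 := ae_lt_top' hm (ne_top_of_le_ne_top (by finiteness) h1)
  filter_upwards [h2] with ξ hξ
  by_contra hne
  have h0 : ENNReal.ofReal (absSymbol ζ ξ) = 0 := ENNReal.ofReal_eq_zero.2 (not_lt.1 hne)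
  rw [h0, ENNReal.inv_zero, ENNReal.mul_top] at hξ
  · exact lt_irrefl _ hξ
  · exact (ENNReal.ofReal_pos.2 (decay_pos _)).ne'

theorem Admissible.isNull_zero {k : EuclideanSpace ℝ (Fin d)} {s r : ℝ}
    {η₁ η₂ : EuclideanSpace ℝ (Fin d)} (h : Admissible k s r η₁ η₂) (hs : 0 ≤ s) :
    IsNull (zeta k s r η₁ η₂ 0) s η₁ ((2 : ℝ)⁻¹ • k + r • η₂) := by
  obtain ⟨h1, h2, h3, h4, h5, h6⟩ := h
  refine ⟨h1, ?_, ?_, fun j => ?_⟩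
  · rw [inner_add_right, inner_smul_right, inner_smul_right, real_inner_comm, h3, h5]; simp
  · rw [← sq_eq_sq₀ (norm_nonneg _) hs, norm_add_sq_real, inner_smul_left, inner_smul_right, h4,
      norm_smul, norm_smul, h2, ← h6]
    simp; ring
  · simp [zeta]; ring

theorem Admissible.isNull_one {k : EuclideanSpace ℝ (Fin d)} {s r : ℝ}
    {η₁ η₂ : EuclideanSpace ℝ (Fin d)} (h : Admissible k s r η₁ η₂) (hs : 0 ≤ s) :
    IsNull (zeta k s r η₁ η₂ 1) s (-η₁) ((2 : ℝ)⁻¹ • k - r • η₂) := by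
  obtain ⟨h1, h2, h3, h4, h5, h6⟩ := h
  refine ⟨by rw [norm_neg, h1], ?_, ?_, fun j => ?_⟩
  · rw [inner_neg_left, inner_sub_right, inner_smul_right, inner_smul_right, real_inner_comm, h3,
      h5]
    simp
  · rw [← sq_eq_sq₀ (norm_nonneg _) hs, norm_sub_sq_real, inner_smul_left, inner_smul_right, h4,
      norm_smul, norm_smul, h2, ← h6]
    simp; ring
  · simp [zeta]; ring

end Symbol

/-! ### Averaging the inverse symbol over the directions and sizes of ζ. -/

section Averaging

variable {d : ℕ}

/-- The annulus over which the frequencies are averaged. -/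
def annulus : Set ℂ := {z | 1 ≤ ‖z‖ ∧ ‖z‖ ≤ 2}

theorem measurableSet_annulus : MeasurableSet annulus :=
  ((isClosed_le continuous_const continuous_norm).inter
    (isClosed_le continuous_norm continuous_const)).measurableSet

theorem volume_annulus_ne_top : volume annulus ≠ ⊤ := by
  refine ne_top_of_le_ne_top (measure_closedBall_lt_top (x := (0 : ℂ)) (r := 2)).ne
    (measure_mono fun z hz => ?_)
  simpa using hz.2

theorem volume_annulus_ne_zero : volume annulus ≠ 0 := by
  have h : IsOpen {z : ℂ | 1 < ‖z‖ ∧ ‖z‖ < 2} :=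
    (isOpen_lt continuous_const continuous_norm).inter (isOpen_lt continuous_norm continuous_const)
  have hmem : ((3 / 2 : ℝ) : ℂ) ∈ {z : ℂ | 1 < ‖z‖ ∧ ‖z‖ < 2} := by
    rw [Set.mem_ofPred_eq, Complex.norm_real]; norm_num
  have h2 := h.measure_pos volume ⟨_, hmem⟩
  exact (h2.trans_le (measure_mono (t := annulus) fun z hz => ⟨hz.1.le, hz.2.le⟩)).ne'

/-- If `w` is small compared with `A`, the affine function stays above A/2 on the annulus. Otherwise
‖w‖ > N/8 and A + wz = w(z + A/w), where 1/|z| is integrable in the plane, uniformly in the shift.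
-/
theorem exists_lintegral_annulus_inv_le : ∃ C : NNReal, ∀ (A N : ℝ) (w : ℂ), 0 < N → N / 2 ≤ A →
    ∫⁻ z in annulus, ‖(A : ℂ) + w * z‖ₑ⁻¹ ≤ C * (ENNReal.ofReal N)⁻¹ := by
  obtain ⟨C, hC⟩ := exists_setLIntegral_enorm_rpow_le (volume : Measure ℂ) (α := 1)
    one_pos (by simp) (by simp) measurableSet_annulus volume_annulus_ne_top
  refine ⟨4 * (volume annulus).toNNReal + 8 * C, fun A N w hN hA => ?_⟩
  have hA0 : 0 < A := by linarith
  push_cast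
  rw [ENNReal.coe_toNNReal volume_annulus_ne_top, add_mul]
  by_cases hw : ‖w‖ * 2 ≤ A / 2
  · refine le_add_right ?_
    have hb : ∀ z ∈ annulus, ‖(A : ℂ) + w * z‖ₑ⁻¹ ≤ 4 * (ENNReal.ofReal N)⁻¹ := by
      intro z hz
      have h1 : N / 4 ≤ ‖(A : ℂ) + w * z‖ := by
        have h2 : ‖(A : ℂ)‖ ≤ ‖(A : ℂ) + w * z‖ + ‖w * z‖ := by
          have := norm_sub_le ((A : ℂ) + w * z) (w * z)
          simpa using this
        rw [Complex.norm_real, Real.norm_of_nonneg hA0.le, norm_mul] at h2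
        have := mul_le_mul_of_nonneg_left hz.2 (norm_nonneg w)
        linarith
      rw [← ofReal_norm]
      calc (ENNReal.ofReal ‖(A : ℂ) + w * z‖)⁻¹ ≤ (ENNReal.ofReal (N / 4))⁻¹ := by gcongr
        _ = 4 * (ENNReal.ofReal N)⁻¹ := by
          rw [ENNReal.ofReal_div_of_pos (by norm_num), div_eq_mul_inv,
            ENNReal.mul_inv (Or.inr (by simp)) (Or.inl (by simp)), inv_inv, mul_comm]
          simp
    calc ∫⁻ z in annulus, ‖(A : ℂ) + w * z‖ₑ⁻¹
        ≤ ∫⁻ z in annulus, 4 * (ENNReal.ofReal N)⁻¹ := setLIntegral_mono' measurableSet_annulus hb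
      _ = _ := by rw [setLIntegral_const]; ring
  · refine le_add_left ?_
    push Not at hw
    have hwN : N / 8 < ‖w‖ := by linarith
    have hw0 : w ≠ 0 := norm_pos_iff.1 (by linarith)
    have hb : ∀ z : ℂ, ‖(A : ℂ) + w * z‖ₑ⁻¹ = ‖w‖ₑ⁻¹ * (‖z + A / w‖ₑ ^ (1 : ℝ))⁻¹ := by
      intro z
      have : (A : ℂ) + w * z = w * (z + A / w) := by field_simp; ring
      rw [this, enorm_mul, ENNReal.mul_inv (Or.inr (by simp)) (Or.inl (by simp)), ENNReal.rpow_one]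
    simp only [hb]
    rw [lintegral_const_mul' _ _ (by simpa using hw0)]
    calc ‖w‖ₑ⁻¹ * ∫⁻ z in annulus, (‖z + A / w‖ₑ ^ (1 : ℝ))⁻¹ ≤ (ENNReal.ofReal (N / 8))⁻¹ * C := by
          rw [← ofReal_norm]
          gcongr
          exact hC _
      _ = _ := by
          rw [ENNReal.ofReal_div_of_pos (by norm_num), div_eq_mul_inv,
            ENNReal.mul_inv (Or.inr (by simp)) (Or.inl (by simp)), inv_inv, mul_comm]
          simp
          ring

/-- This is where d ≥ 3 enters: the complement of `k` has dimension at least 2. -/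
theorem exists_orthonormal_pair (hd : 3 ≤ d) (k : EuclideanSpace ℝ (Fin d)) :
    ∃ e₁ e₂ : EuclideanSpace ℝ (Fin d), ‖e₁‖ = 1 ∧ ‖e₂‖ = 1 ∧ inner ℝ k e₁ = 0 ∧
      inner ℝ k e₂ = 0 ∧ inner ℝ e₁ e₂ = 0 := by
  have h1 := (Submodule.span ℝ {k}).finrank_add_finrank_orthogonal
  have h2 : Module.finrank ℝ (Submodule.span ℝ {k}) ≤ 1 := by
    simpa using finrank_span_le_card (R := ℝ) ({k} : Set (EuclideanSpace ℝ (Fin d)))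
  have h3 : 2 ≤ Module.finrank ℝ (Submodule.span ℝ {k})ᗮ := by
    rw [finrank_euclideanSpace_fin] at h1
    omega
  set o := stdOrthonormalBasis ℝ (Submodule.span ℝ {k})ᗮ
  have hk : ∀ i, inner ℝ k (o i : EuclideanSpace ℝ (Fin d)) = 0 := fun i =>
    Submodule.mem_orthogonal_singleton_iff_inner_right.1 (o i).2
  refine ⟨o ⟨0, by omega⟩, o ⟨1, by omega⟩, ?_, ?_, hk _, hk _, ?_⟩
  · exact o.orthonormal.1 _
  · exact o.orthonormal.1 _
  · exact o.orthonormal.2 (by simp)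

/-- The plane spanned by e₁ and e₂ is identified with ℂ; η₂ is the direction of z and η₁ that of iz.
With r = l‖z‖ the vector r η₂ is l z, hence linear in z. -/
theorem admissible_of_complex {k e₁ e₂ : EuclideanSpace ℝ (Fin d)} (h1 : ‖e₁‖ = 1) (h2 : ‖e₂‖ = 1)
    (h3 : inner ℝ k e₁ = 0) (h4 : inner ℝ k e₂ = 0) (h5 : inner ℝ e₁ e₂ = 0) {z : ℂ} (hz : z ≠ 0)
    (r : ℝ) :
    Admissible k (Real.sqrt (‖k‖ ^ 2 / 4 + r ^ 2)) r
      (‖z‖⁻¹ • (-z.im • e₁ + z.re • e₂)) (‖z‖⁻¹ • (z.re • e₁ + z.im • e₂)) := by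
  have hz0 : ‖z‖ ≠ 0 := norm_ne_zero_iff.2 hz
  have hzn : ‖z‖ ^ 2 = z.re ^ 2 + z.im ^ 2 := by
    rw [Complex.sq_norm, Complex.normSq_apply]; ring
  have h6 : inner ℝ e₂ e₁ = 0 := by rw [real_inner_comm, h5]
  have hn : ∀ x y : ℝ, ‖x • e₁ + y • e₂‖ ^ 2 = x ^ 2 + y ^ 2 := by
    intro x y
    rw [norm_add_sq_real, inner_smul_left, inner_smul_right, h5, norm_smul, norm_smul, h1, h2]
    simp
  have hunit : ∀ v : EuclideanSpace ℝ (Fin d), ‖v‖ ^ 2 = ‖z‖ ^ 2 → ‖‖z‖⁻¹ • v‖ = 1 := by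
    intro v hv
    rw [sq_eq_sq₀ (norm_nonneg _) (norm_nonneg _)] at hv
    rw [norm_smul, norm_inv, norm_norm, hv, inv_mul_cancel₀ hz0]
  refine ⟨hunit _ ?_, hunit _ ?_, ?_, ?_, ?_, ?_⟩
  · rw [hn, hzn]; ring
  · rw [hn, hzn]
  · simp [inner_smul_right, inner_add_right, h3, h4]
  · simp [inner_smul_right, inner_add_right, h3, h4]
  · simp [inner_smul_right, inner_add_right, inner_smul_left, inner_add_left, h5, h6,
      h1, h2]
    ring
  · rw [Real.sq_sqrt (by positivity)]

/-- For large frequencies the symbol is bounded from below by an affine function of the rotated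
direction. -/
theorem le_norm_symbol_complex {k e₁ e₂ : EuclideanSpace ℝ (Fin d)} (h1 : ‖e₁‖ = 1)
    (h2 : ‖e₂‖ = 1) (h3 : inner ℝ k e₁ = 0) (h4 : inner ℝ k e₂ = 0) (h5 : inner ℝ e₁ e₂ = 0) {z : ℂ}
    (hz : z ≠ 0) (l : ℝ) (j : Fin 2) (x : EuclideanSpace ℝ (Fin d)) :
    ‖((‖x‖ ^ 2 + inner ℝ k x : ℝ) : ℂ) + (((-1) ^ (j : ℕ) * 2 * l : ℝ) : ℂ) *
      ((inner ℝ e₁ x : ℝ) - (inner ℝ e₂ x : ℝ) * Complex.I) * z‖ ≤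
    ‖symbol (zeta k (Real.sqrt (‖k‖ ^ 2 / 4 + (l * ‖z‖) ^ 2)) (l * ‖z‖)
      (‖z‖⁻¹ • (-z.im • e₁ + z.re • e₂)) (‖z‖⁻¹ • (z.re • e₁ + z.im • e₂)) j) x‖ := by
  have hz0 : ‖z‖ ≠ 0 := norm_ne_zero_iff.2 hz
  have ha := admissible_of_complex h1 h2 h3 h4 h5 hz (l * ‖z‖)
  set s := Real.sqrt (‖k‖ ^ 2 / 4 + (l * ‖z‖) ^ 2) with hs
  have hs0 : 0 ≤ s := Real.sqrt_nonneg _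
  -- Replacing s by r = l‖z‖ in the imaginary part of the symbol only decreases its modulus, and
  -- makes that part linear in z.
  have hsr : (l * ‖z‖) ^ 2 ≤ s ^ 2 := by
    rw [hs, Real.sq_sqrt (by positivity)]
    nlinarith [sq_nonneg ‖k‖]
  set a₁ : ℝ := inner ℝ e₁ x
  set a₂ : ℝ := inner ℝ e₂ x
  have hi2 : (l * ‖z‖) * inner ℝ (‖z‖⁻¹ • (z.re • e₁ + z.im • e₂)) x = l * (z.re * a₁ + z.im * a₂) := by
    simp only [inner_smul_left, inner_add_left, RCLike.conj_to_real]
    field_simp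
    rfl
  have hi1 : (l * ‖z‖) * inner ℝ (‖z‖⁻¹ • (-z.im • e₁ + z.re • e₂)) x =
      l * (-z.im * a₁ + z.re * a₂) := by
    simp only [inner_smul_left, inner_add_left, RCLike.conj_to_real]
    field_simp
    rfl
  set v₁ := ‖z‖⁻¹ • (-z.im • e₁ + z.re • e₂)
  set v₂ := ‖z‖⁻¹ • (z.re • e₁ + z.im • e₂)
  refine (le_abs_self _).trans (abs_le_of_sq_le_sq ?_ (norm_nonneg _))
  -- Real and imaginary parts of (a₁ - i a₂)z are, up to sign, the components of x along z and iz.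
  -- Here ε = ±1 distinguishes the two ζ.
  have hL : ∀ A ε : ℝ, ε ^ 2 = 1 → ‖(A : ℂ) + ((ε * 2 * l : ℝ) : ℂ) *
      ((a₁ : ℂ) - (a₂ : ℂ) * Complex.I) * z‖ ^ 2 =
      (A + 2 * ε * ((l * ‖z‖) * inner ℝ v₂ x)) ^ 2 +
        (2 * ((l * ‖z‖) * inner ℝ v₁ x)) ^ 2 := by
    intro A ε hε
    rw [hi1, hi2, Complex.sq_norm, Complex.normSq_apply]
    simp
    ring_nf
    rw [hε]
    ring
  have hfin : (2 * ((l * ‖z‖) * inner ℝ v₁ x)) ^ 2 ≤ (2 * s * inner ℝ v₁ x) ^ 2 := by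
    have := mul_le_mul_of_nonneg_right hsr (sq_nonneg (inner ℝ v₁ x))
    nlinarith
  fin_cases j
  · have h := (ha.isNull_zero hs0).norm_symbol_sq x
    have h' := hL (‖x‖ ^ 2 + inner ℝ k x) 1 (by norm_num)
    simp only [Fin.zero_eta, pow_zero]
    rw [h, h']
    have hb : inner ℝ ((2 : ℝ)⁻¹ • k + (l * ‖z‖) • v₂) x =
        2⁻¹ * inner ℝ k x + (l * ‖z‖) * inner ℝ v₂ x := by
      simp [inner_smul_left, inner_add_left]
    rw [hb]
    refine add_le_add (le_of_eq ?_) hfin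
    ring
  · have h := (ha.isNull_one hs0).norm_symbol_sq x
    have h' := hL (‖x‖ ^ 2 + inner ℝ k x) (-1) (by norm_num)
    simp only [Fin.mk_one, pow_one]
    rw [h, h']
    have hb : inner ℝ ((2 : ℝ)⁻¹ • k - (l * ‖z‖) • v₂) x =
        2⁻¹ * inner ℝ k x - (l * ‖z‖) * inner ℝ v₂ x := by
      simp [inner_smul_left, inner_sub_left]
    rw [hb, inner_neg_left]
    refine add_le_add (le_of_eq ?_) (hfin.trans (le_of_eq ?_)) <;> ring

end Averaging

/-! ### Choice of the parameters: high frequencies by averaging, low ones by size. -/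

section Choice

variable {d : ℕ}

theorem exists_setLIntegral_large_lt {g : EuclideanSpace ℝ (Fin d) → ℝ≥0∞} (hg : Measurable g)
    (hgi : ∫⁻ x, g x ≠ ⊤) {δ : ℝ≥0∞} (hδ : 0 < δ) (M₀ : ℝ) :
    ∃ M, M₀ ≤ M ∧ ∫⁻ x in {x | M ≤ ‖x‖}, g x < δ := by
  have hm : ∀ n : ℕ, MeasurableSet {x : EuclideanSpace ℝ (Fin d) | (n : ℝ) ≤ ‖x‖} := fun n =>
    (isClosed_le continuous_const continuous_norm).measurableSet
  have h : Tendsto (fun n : ℕ => ∫⁻ x, {x | (n : ℝ) ≤ ‖x‖}.indicator g x) atTop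
      (𝓝 (∫⁻ _x : EuclideanSpace ℝ (Fin d), 0)) := by
    refine tendsto_lintegral_of_dominated_convergence g (fun n => hg.indicator (hm n))
      (fun n => Eventually.of_forall fun x => Set.indicator_le_self _ _ x) hgi
      (Eventually.of_forall fun x => ?_)
    obtain ⟨N, hN⟩ := exists_nat_gt ‖x‖
    refine tendsto_const_nhds.congr' ?_
    filter_upwards [eventually_ge_atTop N] with n hn
    rw [Set.indicator_of_notMem]
    simp only [Set.mem_ofPred_eq, not_le]
    exact hN.trans_le (by exact_mod_cast hn)
  rw [lintegral_zero] at h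
  obtain ⟨N, hN⟩ := exists_nat_ge M₀
  obtain ⟨n, h1, h2⟩ := ((h.eventually_lt_const hδ).and (eventually_ge_atTop N)).exists
  refine ⟨n, hN.trans (by exact_mod_cast h2), ?_⟩
  rwa [lintegral_indicator (hm n)] at h1

/-- For a suitable choice of large admissible parameters, the weighted integrals are small. -/
theorem exists_admissible_lintegral_le (hd : 3 ≤ d) (k : EuclideanSpace ℝ (Fin d))
    {q : EuclideanSpace ℝ (Fin d) → ℝ≥0∞} (hq : Measurable q)
    (hqb : ∀ M : ℝ, ∃ B : NNReal, ∀ ξ, ‖ξ‖ ≤ M → q ξ ≤ B)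
    (hqi : ∫⁻ ξ, q ξ * (ENNReal.ofReal (1 + ‖(2 * Real.pi) • ξ‖ ^ 2))⁻¹ ≠ ⊤)
    {δ : ℝ≥0∞} (hδ : 0 < δ) (Λ : ℝ) :
    ∃ (s r : ℝ) (η₁ η₂ : EuclideanSpace ℝ (Fin d)), Admissible k s r η₁ η₂ ∧ Λ ≤ s ∧
      ∀ j, ∫⁻ ξ, q ξ * (ENNReal.ofReal (absSymbol (zeta k s r η₁ η₂ j) ξ))⁻¹ ≤ δ := by
  -- it suffices to treat finite `δ`
  wlog hδt : δ ≠ ⊤ generalizing δ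
  · obtain ⟨s, r, η₁, η₂, h1, h2, h3⟩ := this (δ := 1) one_pos (by simp)
    push Not at hδt
    exact ⟨s, r, η₁, η₂, h1, h2, fun j => (h3 j).trans (by simp [hδt])⟩
  obtain ⟨e₁, e₂, he1, he2, hk1, hk2, h12⟩ := exists_orthonormal_pair hd k
  obtain ⟨C, hC⟩ := exists_lintegral_annulus_inv_le
  obtain ⟨D, hD⟩ := exists_lintegral_inv_absSymbol_le d
  have hpi : 1 ≤ 2 * Real.pi := by nlinarith [Real.pi_gt_three]
  -- high frequencies
  set g : EuclideanSpace ℝ (Fin d) → ℝ≥0∞ :=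
    fun ξ => q ξ * (ENNReal.ofReal (1 + ‖(2 * Real.pi) • ξ‖ ^ 2))⁻¹ with hg
  have hgm : Measurable g := by rw [hg]; fun_prop
  -- Chosen so that the averaged high-frequency integral, at most 4C times the tail, is below δ/2.
  -- The added 1 keeps the denominator nonzero.
  set c₀ : ℝ≥0∞ := δ / 2 * volume annulus / (4 * C + 1) with hc₀
  have hc₀pos : 0 < c₀ := by
    refine ENNReal.div_pos (mul_ne_zero ?_ volume_annulus_ne_zero) (by finiteness)
    simp [hδ.ne']
  -- M ≥ 1 gives 1 + X² ≤ 2X², and M ≥ 2‖k‖ gives X² + k·x ≥ X²/2, as required by the annulus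
  -- estimate with N = X².
  obtain ⟨M, hM, hMg⟩ := exists_setLIntegral_large_lt hgm hqi hc₀pos (max 1 (2 * ‖k‖))
  have hM1 : 1 ≤ M := (le_max_left _ _).trans hM
  have hMk : 2 * ‖k‖ ≤ M := (le_max_right _ _).trans hM
  set H : Set (EuclideanSpace ℝ (Fin d)) := {ξ | M ≤ ‖ξ‖} with hH
  have hHm : MeasurableSet H := (isClosed_le continuous_const continuous_norm).measurableSet
  -- low frequencies
  obtain ⟨B, hB⟩ := hqb M
  obtain ⟨E, hE⟩ : ∃ E : NNReal, ∀ ξ : EuclideanSpace ℝ (Fin d), ‖ξ‖ ≤ M →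
      1 ≤ E * ENNReal.ofReal (decay (0 - ξ)) := by
    refine ⟨((1 + M) ^ ((d : ℝ) + 1)).toNNReal, fun ξ hξ => ?_⟩
    have hM0 : 0 < 1 + M := by linarith
    rw [← ENNReal.ofReal, ← ENNReal.ofReal_mul (by positivity), ENNReal.one_le_ofReal, decay,
      zero_sub, norm_neg, Real.rpow_neg (by positivity), ← div_eq_mul_inv,
      one_le_div (by positivity)]
    gcongr
  obtain ⟨l, hl1, hlΛ, hl⟩ : ∃ l : ℝ, 13 ≤ l ∧ Λ ≤ l ∧
      (B : ℝ≥0∞) * E * (D * ENNReal.ofReal l⁻¹) ≤ δ / 2 := by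
    have h1 : Tendsto (fun l : ℝ => (B : ℝ≥0∞) * E * (D * ENNReal.ofReal l⁻¹)) atTop (𝓝 0) := by
      have h2 : Tendsto (fun l : ℝ => ENNReal.ofReal l⁻¹) atTop (𝓝 0) := by
        have := (ENNReal.continuous_ofReal.tendsto 0).comp tendsto_inv_atTop_zero
        rw [ENNReal.ofReal_zero] at this
        exact this
      have h3 := ENNReal.Tendsto.const_mul (a := (B : ℝ≥0∞) * E * D) h2 (Or.inr (by finiteness))
      simpa [mul_assoc] using h3
    have h4 := (h1.eventually_lt_const (ENNReal.half_pos hδ.ne'))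
    obtain ⟨l, h5, h6, h7⟩ := (h4.and ((eventually_ge_atTop 13).and (eventually_ge_atTop Λ))).exists
    exact ⟨l, h6, h7, h5.le⟩
  -- the function to be averaged
  set w : ℝ → EuclideanSpace ℝ (Fin d) → ℂ := fun σ ξ => ((σ * 2 * l : ℝ) : ℂ) *
    ((inner ℝ e₁ ((2 * Real.pi) • ξ) : ℝ) - (inner ℝ e₂ ((2 * Real.pi) • ξ) : ℝ) * Complex.I) with hw
  set A : EuclideanSpace ℝ (Fin d) → ℝ :=
    fun ξ => ‖(2 * Real.pi) • ξ‖ ^ 2 + inner ℝ k ((2 * Real.pi) • ξ) with hA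
  set Φ : ℝ → ℂ → ℝ≥0∞ := fun σ z => ∫⁻ ξ in H, q ξ * ‖(A ξ : ℂ) + w σ ξ * z‖ₑ⁻¹ with hΦ
  have hmeas : ∀ σ, Measurable fun p : ℂ × EuclideanSpace ℝ (Fin d) =>
      q p.2 * ‖(A p.2 : ℂ) + w σ p.2 * p.1‖ₑ⁻¹ := by
    intro σ
    have h1 : Continuous fun p : ℂ × EuclideanSpace ℝ (Fin d) =>
        (A p.2 : ℂ) + w σ p.2 * p.1 := by
      rw [hA, hw]; fun_prop
    exact (hq.comp measurable_snd).mul (h1.measurable.enorm.inv)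
  have hΦm : ∀ σ, Measurable (Φ σ) := fun σ => (hmeas σ).lintegral_prod_right'
  have hΦi : ∀ σ, ∫⁻ z in annulus, Φ σ z ≤ 2 * C * ∫⁻ ξ in H, g ξ := by
    intro σ
    rw [hΦ]
    simp only
    rw [lintegral_lintegral_swap (hmeas σ).aemeasurable, ← lintegral_const_mul _ hgm]
    refine setLIntegral_mono' hHm fun ξ hξ => ?_
    rw [lintegral_const_mul _ (by fun_prop)]
    set X := ‖(2 * Real.pi) • ξ‖ with hX
    have hXM : M ≤ X := by
      rw [hX, norm_smul, Real.norm_of_nonneg (by linarith)]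
      have : M ≤ ‖ξ‖ := hξ
      nlinarith [norm_nonneg ξ]
    have hX0 : 0 < X := by linarith
    have h1 := hC (A ξ) (X ^ 2) (w σ ξ) (by positivity) (by
      have := (abs_le.1 (abs_real_inner_le_norm k ((2 * Real.pi) • ξ))).1
      simp only [hA]
      nlinarith)
    calc q ξ * ∫⁻ z in annulus, ‖(A ξ : ℂ) + w σ ξ * z‖ₑ⁻¹
        ≤ q ξ * (C * (ENNReal.ofReal (X ^ 2))⁻¹) := by gcongr
      _ ≤ q ξ * (C * (2 * (ENNReal.ofReal (1 + X ^ 2))⁻¹)) := by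
          gcongr
          have h2 : ENNReal.ofReal (1 + X ^ 2) ≤ ENNReal.ofReal (2 * X ^ 2) := by
            refine ENNReal.ofReal_le_ofReal ?_
            nlinarith
          calc (ENNReal.ofReal (X ^ 2))⁻¹ = 2 * (ENNReal.ofReal (2 * X ^ 2))⁻¹ := by
                rw [ENNReal.ofReal_mul (by norm_num),
                  ENNReal.mul_inv (Or.inr (by simp)) (Or.inl (by simp)), ← mul_assoc]
                simp [ENNReal.mul_inv_cancel]
            _ ≤ _ := by gcongr
      _ = 2 * C * g ξ := by simp only [hg]; ring
  -- Both signs are averaged together so that a single z serves ζ₁ and ζ₂.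
  have hsum : ∫⁻ z in annulus, (Φ 1 z + Φ (-1) z) ≤ δ / 2 * volume annulus := by
    rw [lintegral_add_left (hΦm 1)]
    calc _ ≤ (2 * C * ∫⁻ ξ in H, g ξ) + 2 * C * ∫⁻ ξ in H, g ξ := add_le_add (hΦi 1) (hΦi (-1))
      _ = 4 * C * ∫⁻ ξ in H, g ξ := by ring
      _ ≤ (4 * C + 1) * c₀ := by gcongr; exact le_self_add
      _ = δ / 2 * volume annulus := by
          rw [hc₀, ENNReal.mul_div_cancel (by simp) (by finiteness)]
  -- Some point of the annulus takes a value no larger than the average.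
  obtain ⟨z, hz, hzΦ⟩ := exists_le_setLAverage volume_annulus_ne_zero volume_annulus_ne_top
    ((hΦm 1).add (hΦm (-1))).aemeasurable
  have hzδ : Φ 1 z + Φ (-1) z ≤ δ / 2 := by
    refine hzΦ.trans ?_
    rw [setLAverage_eq]
    exact ENNReal.div_le_of_le_mul hsum
  have hz0 : z ≠ 0 := by
    rintro rfl
    have := hz.1
    simp at this
    linarith
  have hadm := admissible_of_complex he1 he2 hk1 hk2 h12 hz0 (l * ‖z‖)
  have hls : l ≤ Real.sqrt (‖k‖ ^ 2 / 4 + (l * ‖z‖) ^ 2) := by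
    refine Real.le_sqrt_of_sq_le ?_
    have h1 : l ≤ l * ‖z‖ := le_mul_of_one_le_right (by linarith) hz.1
    nlinarith [sq_nonneg ‖k‖]
  refine ⟨_, _, _, _, hadm, hlΛ.trans hls, fun j => ?_⟩
  set ζ := zeta k (Real.sqrt (‖k‖ ^ 2 / 4 + (l * ‖z‖) ^ 2)) (l * ‖z‖)
      (‖z‖⁻¹ • (-z.im • e₁ + z.re • e₂)) (‖z‖⁻¹ • (z.re • e₁ + z.im • e₂)) j with hζ
  have hnull : ∃ e b, IsNull ζ (Real.sqrt (‖k‖ ^ 2 / 4 + (l * ‖z‖) ^ 2)) e b := by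
    fin_cases j
    · exact ⟨_, _, hadm.isNull_zero (Real.sqrt_nonneg _)⟩
    · exact ⟨_, _, hadm.isNull_one (Real.sqrt_nonneg _)⟩
  obtain ⟨e, b, hnull⟩ := hnull
  rw [← lintegral_add_compl _ hHm]
  have hhigh : ∫⁻ ξ in H, q ξ * (ENNReal.ofReal (absSymbol ζ ξ))⁻¹ ≤ δ / 2 := by
    have h1 : ∫⁻ ξ in H, q ξ * (ENNReal.ofReal (absSymbol ζ ξ))⁻¹ ≤ Φ ((-1) ^ (j : ℕ)) z := by
      refine lintegral_mono fun ξ => ?_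
      gcongr
      rw [← ofReal_norm]
      refine ENNReal.ofReal_le_ofReal ?_
      exact le_norm_symbol_complex he1 he2 hk1 hk2 h12 hz0 l j ((2 * Real.pi) • ξ)
    refine h1.trans (le_trans ?_ hzδ)
    fin_cases j
    · simp
    · simp
  -- On the ball of radius M both `q` and the inverse of `decay` are bounded, so the O(1/s) estimate
  -- applies with s ≥ l.
  have hlow : ∫⁻ ξ in Hᶜ, q ξ * (ENNReal.ofReal (absSymbol ζ ξ))⁻¹ ≤ δ / 2 := by
    calc ∫⁻ ξ in Hᶜ, q ξ * (ENNReal.ofReal (absSymbol ζ ξ))⁻¹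
        ≤ ∫⁻ ξ in Hᶜ, (B : ℝ≥0∞) * E *
            (ENNReal.ofReal (decay (0 - ξ)) * (ENNReal.ofReal (absSymbol ζ ξ))⁻¹) := by
          refine setLIntegral_mono' hHm.compl fun ξ hξ => ?_
          have hξM : ‖ξ‖ ≤ M := le_of_lt (by simpa [hH] using hξ)
          rw [← mul_assoc, mul_assoc (B : ℝ≥0∞)]
          gcongr
          calc q ξ ≤ B * 1 := by rw [mul_one]; exact hB ξ hξM
            _ ≤ _ := by gcongr; exact hE ξ hξM
      _ ≤ ∫⁻ ξ, (B : ℝ≥0∞) * E *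
            (ENNReal.ofReal (decay (0 - ξ)) * (ENNReal.ofReal (absSymbol ζ ξ))⁻¹) :=
          setLIntegral_le_lintegral _ _
      _ ≤ (B : ℝ≥0∞) * E * (D * ENNReal.ofReal l⁻¹) := by
          rw [lintegral_const_mul' _ _ (by finiteness)]
          gcongr
          refine (hD ζ _ e b hnull (hl1.trans hls) 0).trans ?_
          gcongr
      _ ≤ δ / 2 := hl
  calc _ ≤ δ / 2 + δ / 2 := add_le_add hhigh hlow
    _ = δ := ENNReal.add_halves δ

end Choice

/-! ### A weight with explicit Fourier transform. -/

section Weight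

variable {d : ℕ}

theorem integrable_exp_neg_abs_mul (x : ℝ) : Integrable (fun t : ℝ =>
    ((Real.pi * Real.exp (-(2 * Real.pi * |t|)) : ℝ) : ℂ) *
      Complex.exp (-(2 * Real.pi * t * x : ℝ) * Complex.I)) := by
  have h1 := (integrableOn_exp_mul_complex_Ioi
    (a := -(2 * Real.pi) - (2 * Real.pi * x : ℝ) * Complex.I) (by simp [Real.pi_pos]) 0).const_mul
      (Real.pi : ℂ)
  have h2 := (integrableOn_exp_mul_complex_Iic
    (a := (2 * Real.pi) - (2 * Real.pi * x : ℝ) * Complex.I) (by simp [Real.pi_pos]) 0).const_mul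
      (Real.pi : ℂ)
  rw [← integrableOn_univ, ← Set.Iic_union_Ioi (a := (0 : ℝ))]
  refine IntegrableOn.union (IntegrableOn.congr_fun h2 (fun t ht => ?_) measurableSet_Iic)
    (IntegrableOn.congr_fun h1 (fun t ht => ?_) measurableSet_Ioi)
  · simp only [Set.mem_Iic] at ht
    rw [abs_of_nonpos ht]
    push_cast
    rw [mul_assoc (Real.pi : ℂ), ← Complex.exp_add]
    congr 2; ring
  · simp only [Set.mem_Ioi] at ht
    rw [abs_of_pos ht]
    push_cast
    rw [mul_assoc (Real.pi : ℂ), ← Complex.exp_add]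
    congr 2; ring

/-- The half-lines contribute 1/(2(1 ± ix)), whose sum is 1/(1 + x²). This motivates the weight: it
has an exponentially decaying kernel and a polynomial reciprocal. -/
theorem integral_exp_neg_abs_mul (x : ℝ) : ∫ t : ℝ,
    ((Real.pi * Real.exp (-(2 * Real.pi * |t|)) : ℝ) : ℂ) *
      Complex.exp (-(2 * Real.pi * t * x : ℝ) * Complex.I) = (((1 + x ^ 2)⁻¹ : ℝ) : ℂ) := by
  have hi := integrable_exp_neg_abs_mul x
  rw [← intervalIntegral.integral_Iic_add_Ioi (b := (0 : ℝ)) hi.integrableOn hi.integrableOn]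
  have e2 : ∫ t in Set.Iic (0 : ℝ), ((Real.pi * Real.exp (-(2 * Real.pi * |t|)) : ℝ) : ℂ) *
      Complex.exp (-(2 * Real.pi * t * x : ℝ) * Complex.I) = ∫ t in Set.Iic (0 : ℝ), (Real.pi : ℂ) *
        Complex.exp (((2 * Real.pi) - (2 * Real.pi * x : ℝ) * Complex.I) * t) := by
    refine setIntegral_congr_fun measurableSet_Iic fun t ht => ?_
    simp only [Set.mem_Iic] at ht
    simp only [abs_of_nonpos ht]
    push_cast
    rw [mul_assoc (Real.pi : ℂ), ← Complex.exp_add]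
    congr 2; ring
  have e1 : ∫ t in Set.Ioi (0 : ℝ), ((Real.pi * Real.exp (-(2 * Real.pi * |t|)) : ℝ) : ℂ) *
      Complex.exp (-(2 * Real.pi * t * x : ℝ) * Complex.I) = ∫ t in Set.Ioi (0 : ℝ), (Real.pi : ℂ) *
        Complex.exp ((-(2 * Real.pi) - (2 * Real.pi * x : ℝ) * Complex.I) * t) := by
    refine setIntegral_congr_fun measurableSet_Ioi fun t ht => ?_
    simp only [Set.mem_Ioi] at ht
    simp only [abs_of_pos ht]
    push_cast
    rw [mul_assoc (Real.pi : ℂ), ← Complex.exp_add]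
    congr 2; ring
  rw [e1, e2, integral_const_mul, integral_const_mul,
    integral_exp_mul_complex_Ioi (by simp [Real.pi_pos]),
    integral_exp_mul_complex_Iic (by simp [Real.pi_pos])]
  have hpi : (Real.pi : ℂ) ≠ 0 := by exact_mod_cast Real.pi_ne_zero
  have a1 : (1 : ℂ) + x * Complex.I ≠ 0 := fun h => by
    have := congrArg Complex.re h; simp at this
  have a2 : (1 : ℂ) - x * Complex.I ≠ 0 := fun h => by
    have := congrArg Complex.re h; simp at this
  have a3 : (1 : ℂ) + x ^ 2 = (1 + x * Complex.I) * (1 - x * Complex.I) := by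
    ring_nf; simp
  have b1 : -(2 * (Real.pi : ℂ)) - (2 * Real.pi * x : ℝ) * Complex.I
      = -(2 * Real.pi * (1 + x * Complex.I)) := by push_cast; ring
  have b2 : (2 * (Real.pi : ℂ)) - (2 * Real.pi * x : ℝ) * Complex.I
      = (2 * Real.pi * (1 - x * Complex.I)) := by push_cast; ring
  rw [b1, b2]
  push_cast
  rw [a3]
  simp only [mul_zero, Complex.exp_zero]
  field_simp
  ring

/-- The inverse Fourier transform of `weight`. -/
noncomputable def weightKernel (ξ : EuclideanSpace ℝ (Fin d)) : ℝ :=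
  ∏ j, Real.pi * Real.exp (-(2 * Real.pi * |ξ j|))

/-- The weight `∏ (1 + x_j²)⁻¹`. -/
noncomputable def weight (x : EuclideanSpace ℝ (Fin d)) : ℝ := ∏ j, (1 + x j ^ 2)⁻¹

theorem continuous_weightKernel : Continuous (weightKernel (d := d)) := by
  unfold weightKernel; fun_prop

theorem weightKernel_nonneg (ξ : EuclideanSpace ℝ (Fin d)) : 0 ≤ weightKernel ξ :=
  Finset.prod_nonneg fun _ _ => by positivity

theorem weightKernel_neg (ξ : EuclideanSpace ℝ (Fin d)) : weightKernel (-ξ) = weightKernel ξ := by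
  simp [weightKernel]

theorem exists_weightKernel_le (d : ℕ) : ∃ C : ℝ, 0 < C ∧
    ∀ ξ : EuclideanSpace ℝ (Fin d), weightKernel ξ ≤ C * decay ξ := by
  obtain ⟨C, hC⟩ : ∃ C : ℝ, ∀ t : ℝ, 0 ≤ t → (1 + t) ^ ((d : ℝ) + 1) * Real.exp (-t) ≤ C := by
    -- One term of the exponential series gives (1+t)^{d+1} ≤ (d+1)! e^{1+t}.
    refine ⟨Real.exp 1 * (d + 1).factorial, fun t ht => ?_⟩
    have h := Real.pow_div_factorial_le_exp (1 + t) (by linarith) (d + 1)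
    rw [div_le_iff₀ (by positivity)] at h
    have : (1 + t) ^ ((d : ℝ) + 1) = (1 + t) ^ (d + 1) := by
      rw [← Real.rpow_natCast]; push_cast; rfl
    rw [this]
    calc (1 + t) ^ (d + 1) * Real.exp (-t) ≤ Real.exp (1 + t) * (d + 1).factorial * Real.exp (-t) := by
          gcongr
      _ = Real.exp 1 * (d + 1).factorial := by
          rw [Real.exp_add, Real.exp_neg]; field_simp
  have hC0 : 0 < C := lt_of_lt_of_le (by simp) (hC 0 le_rfl)
  refine ⟨Real.pi ^ d * C, by positivity, fun ξ => ?_⟩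
  have h1 : ‖ξ‖ ≤ ∑ j, |ξ j| := by
    have := norm_sum_le (Finset.univ : Finset (Fin d)) (fun j => EuclideanSpace.single j (ξ j))
    have e : ∑ j, EuclideanSpace.single j (ξ j) = ξ := by
      ext i; simp [Finset.sum_apply, Pi.single_apply]
    rw [e] at this
    simpa using this
  have h2 : weightKernel ξ ≤ Real.pi ^ d * Real.exp (-‖ξ‖) := by
    unfold weightKernel
    rw [Finset.prod_mul_distrib, ← Real.exp_sum, Finset.prod_const, Finset.card_univ,
      Fintype.card_fin]
    gcongr
    rw [Finset.sum_neg_distrib, ← Finset.mul_sum]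
    have : 0 ≤ ∑ j, |ξ j| := by positivity
    nlinarith [Real.pi_gt_three]
  refine h2.trans ?_
  rw [mul_assoc]
  gcongr
  have h3 := hC ‖ξ‖ (norm_nonneg _)
  unfold decay
  rw [Real.rpow_neg (by positivity), ← div_eq_mul_inv, le_div_iff₀ (by positivity)]
  linarith

theorem integrable_weightKernel : Integrable (weightKernel (d := d)) := by
  obtain ⟨C, hC, h⟩ := exists_weightKernel_le d
  refine (integrable_decay.const_mul C).mono' continuous_weightKernel.aestronglyMeasurable ?_
  exact .of_forall fun ξ => by rw [Real.norm_of_nonneg (weightKernel_nonneg _)]; exact h ξ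

theorem weight_pos (x : EuclideanSpace ℝ (Fin d)) : 0 < weight x :=
  Finset.prod_pos fun _ _ => by positivity

theorem fourier_weightKernel (x : EuclideanSpace ℝ (Fin d)) :
    FourierTransform.fourier (fun ξ : EuclideanSpace ℝ (Fin d) => (weightKernel ξ : ℂ)) x
      = weight x := by
  rw [Real.fourier_eq']
  have : ∀ v : EuclideanSpace ℝ (Fin d),
      Complex.exp (((-2 * Real.pi * inner ℝ v x : ℝ) : ℂ) * Complex.I) • (weightKernel v : ℂ)
      = ∏ j, ((Real.pi * Real.exp (-(2 * Real.pi * |v j|)) : ℝ) : ℂ) *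
        Complex.exp (-(2 * Real.pi * v j * x j : ℝ) * Complex.I) := by
    intro v
    rw [Finset.prod_mul_distrib, ← Complex.exp_sum, weightKernel, smul_eq_mul, mul_comm,
      Complex.ofReal_prod]
    congr 2
    rw [← Finset.sum_mul, PiLp.inner_apply]
    push_cast
    rw [Finset.mul_sum]
    congr 1
    refine Finset.sum_congr rfl fun j _ => ?_
    simp; ring
  simp_rw [this]
  have hp := (EuclideanSpace.volume_preserving_symm_measurableEquiv_toLp (Fin d)).symm
  rw [← hp.integral_comp (MeasurableEquiv.measurableEmbedding _)]
  simp only [MeasurableEquiv.symm_symm, MeasurableEquiv.toLp_apply]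
  rw [integral_fintype_prod_volume_eq_prod (fun j (t : ℝ) =>
    ((Real.pi * Real.exp (-(2 * Real.pi * |t|)) : ℝ) : ℂ) *
        Complex.exp (-(2 * Real.pi * t * x j : ℝ) * Complex.I))]
  simp_rw [integral_exp_neg_abs_mul]
  simp [weight]

theorem hasTemperateGrowth_coord (j : Fin d) :
    Function.HasTemperateGrowth (fun x : EuclideanSpace ℝ (Fin d) => x j) :=
  (EuclideanSpace.proj (𝕜 := ℝ) j).hasTemperateGrowth

theorem hasTemperateGrowth_prod {ι : Type*} {s : Finset ι} {f : ι → EuclideanSpace ℝ (Fin d) → ℝ}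
    (hf : ∀ i, Function.HasTemperateGrowth (f i)) :
    Function.HasTemperateGrowth (fun x => ∏ i ∈ s, f i x) := by
  classical
  induction s using Finset.induction_on with
  | empty => simp [Function.HasTemperateGrowth.const (1 : ℝ)]
  | insert i s hi ih => simp_rw [Finset.prod_insert hi]; exact (hf i).mul ih

theorem hasTemperateGrowth_weight :
    Function.HasTemperateGrowth (fun x : EuclideanSpace ℝ (Fin d) => (weight x : ℂ)) := by
  have h : Function.HasTemperateGrowth (fun t : ℝ => (1 + t ^ 2)⁻¹) := by
    have := Function.hasTemperateGrowth_one_add_norm_sq_rpow ℝ (-1)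
    simpa [Real.rpow_neg_one] using this
  have h' : Function.HasTemperateGrowth (weight (d := d)) :=
    hasTemperateGrowth_prod fun j => h.comp (hasTemperateGrowth_coord j)
  exact Complex.ofRealCLM.hasTemperateGrowth.comp h'

/-- The reciprocal is a polynomial, so Schwartz functions may be divided by the weight. -/
theorem hasTemperateGrowth_inv_weight :
    Function.HasTemperateGrowth (fun x : EuclideanSpace ℝ (Fin d) => ((weight x)⁻¹ : ℂ)) := by
  have h : Function.HasTemperateGrowth (fun t : ℝ => (1 + t ^ 2)) := by
    have := Function.hasTemperateGrowth_one_add_norm_sq_rpow ℝ 1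
    simpa using this
  have := Complex.ofRealCLM.hasTemperateGrowth.comp
    (hasTemperateGrowth_prod (s := Finset.univ) fun j : Fin d => h.comp (hasTemperateGrowth_coord j))
  convert this using 2 with x
  simp [weight]

/-- Multiplication by the weight becomes convolution with `weightKernel`. It follows from moving the
Fourier transform from the kernel onto `v` modulated by a character. -/
theorem fourierInv_weight_smul (v : SchwartzMap (EuclideanSpace ℝ (Fin d)) ℂ)
    (η : EuclideanSpace ℝ (Fin d)) :
    FourierTransformInv.fourierInv (fun x => (weight x : ℂ) * v x) η
      = ∫ ξ, (weightKernel (ξ - η) : ℂ) * FourierTransformInv.fourierInv v ξ := by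
  rw [Real.fourierInv_eq]
  have hK : Integrable (fun ξ : EuclideanSpace ℝ (Fin d) => (weightKernel ξ : ℂ)) :=
    integrable_weightKernel.ofReal
  have hg : Integrable (fun x => Real.fourierChar (inner ℝ x η) • v x) := by
    refine (v.integrable (μ := volume)).mono (by
      have := v.continuous
      refine Continuous.aestronglyMeasurable ?_
      fun_prop) (.of_forall fun x => by simp)
  have h := VectorFourier.integral_fourierIntegral_smul_eq_flip (L := innerₗ (EuclideanSpace ℝ (Fin d)))
      (μ := volume) (ν := volume) Real.continuous_fourierChar continuous_inner hK hg
  have h1 : ∀ ξ, VectorFourier.fourierIntegral Real.fourierChar volume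
      (innerₗ (EuclideanSpace ℝ (Fin d))) (fun ξ => (weightKernel ξ : ℂ)) ξ = weight ξ :=
    fun ξ => fourier_weightKernel ξ
  have h2 : ∀ x, VectorFourier.fourierIntegral Real.fourierChar volume
      (innerₗ (EuclideanSpace ℝ (Fin d))).flip (fun x => Real.fourierChar (inner ℝ x η) • v x) x
      = FourierTransformInv.fourierInv (v : EuclideanSpace ℝ (Fin d) → ℂ) (η - x) := by
    intro x
    rw [Real.fourierInv_eq, VectorFourier.fourierIntegral]
    refine integral_congr_ae (.of_forall fun y => ?_)
    simp only [← mul_smul, ← AddChar.map_add_eq_mul]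
    congr 2
    simp [inner_sub_right]
    rw [real_inner_comm]
    ring
  simp_rw [h1, h2] at h
  simp_rw [SchwartzMap.fourierInv_coe]
  rw [← integral_sub_left_eq_self (fun ξ => (weightKernel (ξ - η) : ℂ) *
    FourierTransformInv.fourierInv (v : EuclideanSpace ℝ (Fin d) → ℂ) ξ) volume η]
  simp only [smul_eq_mul] at h
  convert h using 1
  · refine integral_congr_ae (.of_forall fun x => ?_)
    simp only [Circle.smul_def, smul_eq_mul]
    ring
  · refine integral_congr_ae (.of_forall fun x => ?_)
    have : η - x - η = -x := by abel
    simp only [this, weightKernel_neg]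

end Weight

/-! ### Bounded operators from the convolution kernel. -/

section Kernel

variable {d : ℕ}

theorem exists_schwartz_le_decay (g : SchwartzMap (EuclideanSpace ℝ (Fin d)) ℂ) :
    ∃ C : ℝ, 0 ≤ C ∧ ∀ x, ‖g x‖ ≤ C * decay x := by
  have h := fun x => SchwartzMap.one_add_le_sup_seminorm_apply (𝕜 := ℝ) (m := (d + 1, 0)) (k := d + 1)
    (n := 0) le_rfl le_rfl g x
  refine ⟨2 ^ (d + 1) * ((Finset.Iic (d + 1, 0)).sup fun m => SchwartzMap.seminorm ℝ m.1 m.2) g,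
    by positivity, fun x => ?_⟩
  · have h1 := h x
    rw [norm_iteratedFDeriv_zero] at h1
    unfold decay
    rw [Real.rpow_neg (by positivity), ← div_eq_mul_inv, le_div_iff₀ (by positivity)]
    have : (1 + ‖x‖) ^ ((d : ℝ) + 1) = (1 + ‖x‖) ^ (d + 1) := by
      rw [← Real.rpow_natCast]; push_cast; rfl
    rw [this, mul_comm]
    exact h1

theorem lintegral_mul_sq_le {α : Type*} [MeasurableSpace α] {μ : Measure α} {f g : α → ℝ≥0∞}
    (hf : AEMeasurable f μ) (hg : AEMeasurable g μ) :
    (∫⁻ x, f x * g x ∂μ) ^ 2 ≤ (∫⁻ x, f x ^ 2 ∂μ) * ∫⁻ x, g x ^ 2 ∂μ := by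
  have h := ENNReal.lintegral_mul_le_Lp_mul_Lq μ Real.HolderConjugate.two_two hf hg
  have h2 := pow_le_pow_left₀ (zero_le) h 2
  rw [mul_pow] at h2
  simp only [one_div, Pi.mul_apply] at h2
  have e : ∀ a : ℝ≥0∞, (a ^ ((2 : ℝ)⁻¹)) ^ 2 = a := fun a => by
    rw [← ENNReal.rpow_natCast, ← ENNReal.rpow_mul]; norm_num
  rw [e, e] at h2
  simpa only [ENNReal.rpow_two] using h2

/-- Cauchy-Schwarz with the kernel split evenly between the two factors. -/
theorem lintegral_kernel_mul_sq_le {w h : EuclideanSpace ℝ (Fin d) → ℂ} {k : EuclideanSpace ℝ (Fin d) → ℝ}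
    (hk : Measurable k) (hk0 : ∀ x, 0 ≤ k x)
    (hw : AEStronglyMeasurable w) (hh : AEStronglyMeasurable h) :
    (∫⁻ η, ENNReal.ofReal (k η) * (‖w η‖ₑ * ‖h η‖ₑ)) ^ 2 ≤
      (∫⁻ η, ENNReal.ofReal (k η) * ‖w η‖ₑ ^ 2) * ∫⁻ η, ENNReal.ofReal (k η) * ‖h η‖ₑ ^ 2 := by
  have hs : ∀ η, ENNReal.ofReal (k η) = ENNReal.ofReal (√(k η)) ^ 2 := fun η => by
    rw [← ENNReal.ofReal_pow (Real.sqrt_nonneg _), Real.sq_sqrt (hk0 η)]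
  have hm : Measurable fun η => ENNReal.ofReal (√(k η)) := by fun_prop
  have := lintegral_mul_sq_le (hm.aemeasurable.mul hw.enorm) (hm.aemeasurable.mul hh.enorm)
  simp only [Pi.mul_apply, mul_pow, ← hs] at this
  refine le_trans (le_of_eq ?_) this
  congr 1
  refine lintegral_congr fun η => ?_
  rw [hs]; ring

/-- A weight function `w` whose square has bounded local averages. -/
structure IsWeight (w : EuclideanSpace ℝ (Fin d) → ℂ) (A : ℝ) : Prop where
  measurable : Measurable w
  nonneg : 0 ≤ A
  bound : ∀ ξ, ∫⁻ η, ENNReal.ofReal (decay (ξ - η)) * ‖w η‖ₑ ^ 2 ≤ ENNReal.ofReal A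

theorem lintegral_decay_mul_sq_le (h : Lp (α := EuclideanSpace ℝ (Fin d)) ℂ 2) (ξ) :
    ∫⁻ η, ENNReal.ofReal (decay (ξ - η)) * ‖h η‖ₑ ^ 2 ≤ ‖h‖ₑ ^ 2 := by
  have e : ‖h‖ₑ ^ 2 = ∫⁻ η, ‖h η‖ₑ ^ 2 := by
    rw [Lp.enorm_def, eLpNorm_eq_lintegral_rpow_enorm_toReal (by simp) (by simp)]
    rw [← ENNReal.rpow_natCast, ← ENNReal.rpow_mul]
    simp
  rw [e]
  refine lintegral_mono fun η => ?_
  refine mul_le_of_le_one_left (zero_le) ?_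
  rw [ENNReal.ofReal_le_one]
  unfold decay
  refine Real.rpow_le_one_of_one_le_of_nonpos (by linarith [norm_nonneg (ξ - η)]) ?_
  have : (0:ℝ) ≤ d := by positivity
  linarith

theorem IsWeight.lintegral_sq_le {w : EuclideanSpace ℝ (Fin d) → ℂ} {A : ℝ} (hw : IsWeight w A)
    (h : Lp (α := EuclideanSpace ℝ (Fin d)) ℂ 2) (ξ) :
    (∫⁻ η, ENNReal.ofReal (decay (ξ - η)) * (‖w η‖ₑ * ‖h η‖ₑ)) ^ 2 ≤
      ENNReal.ofReal A * ∫⁻ η, ENNReal.ofReal (decay (ξ - η)) * ‖h η‖ₑ ^ 2 := by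
  refine (lintegral_kernel_mul_sq_le (k := fun η => decay (ξ - η))
    (measurable_decay.comp (by fun_prop)) (fun η => (decay_pos _).le)
    hw.measurable.aestronglyMeasurable (Lp.aestronglyMeasurable h)).trans ?_
  gcongr
  exact hw.bound ξ

theorem IsWeight.lintegral_le {w : EuclideanSpace ℝ (Fin d) → ℂ} {A : ℝ} (hw : IsWeight w A)
    (h : Lp (α := EuclideanSpace ℝ (Fin d)) ℂ 2) : ∃ B : NNReal, ∀ ξ,
    ∫⁻ η, ENNReal.ofReal (decay (ξ - η)) * (‖w η‖ₑ * ‖h η‖ₑ) ≤ B := by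
  refine ⟨(√A * ‖h‖).toNNReal, fun ξ => ?_⟩
  change _ ≤ ENNReal.ofReal _
  have h1 := (hw.lintegral_sq_le h ξ).trans (mul_le_mul_right (lintegral_decay_mul_sq_le h ξ) _)
  rw [← ENNReal.pow_le_pow_left_iff two_ne_zero]
  refine h1.trans (le_of_eq ?_)
  rw [← ofReal_norm, ← ENNReal.ofReal_pow (norm_nonneg _), ← ENNReal.ofReal_pow (by positivity),
    ← ENNReal.ofReal_mul hw.nonneg, mul_pow, Real.sq_sqrt hw.nonneg]

theorem IsWeight.integrable_kernel {w : EuclideanSpace ℝ (Fin d) → ℂ} {A : ℝ} (hw : IsWeight w A)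
    (h : Lp (α := EuclideanSpace ℝ (Fin d)) ℂ 2) {k : EuclideanSpace ℝ (Fin d) → ℂ} {C : ℝ}
    (hC : 0 ≤ C) (ξ) (hkm : AEStronglyMeasurable k) (hk : ∀ η, ‖k η‖ ≤ C * decay (ξ - η)) :
    Integrable (fun η => k η * (w η * h η)) := by
  refine ⟨hkm.mul (hw.measurable.aestronglyMeasurable.mul (Lp.aestronglyMeasurable h)), ?_⟩
  obtain ⟨B, hB⟩ := hw.lintegral_le h
  refine lt_of_le_of_lt (lintegral_mono (g := fun η => ENNReal.ofReal C *
    (ENNReal.ofReal (decay (ξ - η)) * (‖w η‖ₑ * ‖h η‖ₑ))) fun η => ?_) ?_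
  · dsimp only
    rw [enorm_mul, enorm_mul, ← mul_assoc (ENNReal.ofReal C), ← ENNReal.ofReal_mul hC]
    gcongr
    rw [← ofReal_norm]
    exact ENNReal.ofReal_le_ofReal (hk η)
  · rw [lintegral_const_mul' _ _ (by simp)]
    exact ENNReal.mul_lt_top (by simp) ((hB ξ).trans_lt (by simp))

theorem IsWeight.integrable_mul_schwartz {w : EuclideanSpace ℝ (Fin d) → ℂ} {A : ℝ}
    (hw : IsWeight w A) (h : Lp (α := EuclideanSpace ℝ (Fin d)) ℂ 2)
    (g : SchwartzMap (EuclideanSpace ℝ (Fin d)) ℂ) :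
    Integrable (fun η => w η * h η * g η) := by
  obtain ⟨C, hC, hg⟩ := exists_schwartz_le_decay g
  refine (hw.integrable_kernel h hC 0 g.continuous.aestronglyMeasurable fun η => ?_).congr
    (.of_forall fun η => mul_comm _ _)
  simpa [decay] using hg η

/-- The convolution of `weightKernel` with `w h`. -/
noncomputable def kernelConv (w h : EuclideanSpace ℝ (Fin d) → ℂ) (ξ : EuclideanSpace ℝ (Fin d)) : ℂ :=
  ∫ η, (weightKernel (ξ - η) : ℂ) * (w η * h η)

theorem aestronglyMeasurable_kernel {w h : EuclideanSpace ℝ (Fin d) → ℂ} (hw : AEStronglyMeasurable w)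
    (hh : AEStronglyMeasurable h) : AEStronglyMeasurable
      (fun p : EuclideanSpace ℝ (Fin d) × EuclideanSpace ℝ (Fin d) =>
        (weightKernel (p.1 - p.2) : ℂ) * (w p.2 * h p.2)) (volume.prod volume) := by
  refine AEStronglyMeasurable.mul ?_ (hw.mul hh).comp_snd
  have := continuous_weightKernel (d := d)
  exact Continuous.aestronglyMeasurable (by fun_prop)

theorem IsWeight.integrable_weightKernel_mul {w : EuclideanSpace ℝ (Fin d) → ℂ} {A : ℝ}
    (hw : IsWeight w A) (h : Lp (α := EuclideanSpace ℝ (Fin d)) ℂ 2) (ξ) :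
    Integrable (fun η => (weightKernel (ξ - η) : ℂ) * (w η * h η)) := by
  obtain ⟨C, hC, hg⟩ := exists_weightKernel_le d
  refine hw.integrable_kernel h hC.le ξ ?_ fun η => ?_
  · have := continuous_weightKernel (d := d)
    exact Continuous.aestronglyMeasurable (by fun_prop)
  · simpa [abs_of_nonneg (weightKernel_nonneg (ξ - η))] using hg (ξ - η)

/-- Cauchy-Schwarz gives |T h(ξ)|² ≤ C² A ∫ decay(ξ-η)|h(η)|² dη; integrating in ξ costs only the
integral of `decay`. -/
theorem exists_kernelConv_op (d : ℕ) : ∃ C : ℝ, 0 < C ∧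
    ∀ (w : EuclideanSpace ℝ (Fin d) → ℂ) (A : ℝ), IsWeight w A →
      ∃ T : Lp (α := EuclideanSpace ℝ (Fin d)) ℂ 2 →L[ℂ] Lp (α := EuclideanSpace ℝ (Fin d)) ℂ 2,
        ‖T‖ ≤ C * √A ∧ ∀ h, T h =ᵐ[volume] kernelConv w h := by
  obtain ⟨C, hC, hK⟩ := exists_weightKernel_le d
  set D : ℝ := ∫ x : EuclideanSpace ℝ (Fin d), decay x
  have hD : ENNReal.ofReal D = ∫⁻ x : EuclideanSpace ℝ (Fin d), ENNReal.ofReal (decay x) :=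
    ofReal_integral_eq_lintegral_ofReal integrable_decay (.of_forall fun x => (decay_pos x).le)
  have hD0 : 0 ≤ D := integral_nonneg fun x => (decay_pos x).le
  refine ⟨C * √D + 1, by positivity, fun w A hw => ?_⟩
  have hle : ∀ h : Lp (α := EuclideanSpace ℝ (Fin d)) ℂ 2,
      eLpNorm (kernelConv w h) 2 volume ≤ ENNReal.ofReal (C * √D * √A * ‖h‖) := by
    intro h
    rw [eLpNorm_eq_lintegral_rpow_enorm_toReal (by simp) (by simp)]
    simp only [ENNReal.toReal_ofNat, ENNReal.rpow_ofNat, one_div]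
    rw [ENNReal.rpow_inv_le_iff (by norm_num)]
    have e : ‖h‖ₑ ^ 2 = ∫⁻ η, ‖h η‖ₑ ^ 2 := by
      rw [Lp.enorm_def, eLpNorm_eq_lintegral_rpow_enorm_toReal (by simp) (by simp)]
      rw [← ENNReal.rpow_natCast, ← ENNReal.rpow_mul]
      simp
    calc ∫⁻ ξ, ‖kernelConv w h ξ‖ₑ ^ 2
        ≤ ∫⁻ ξ, ENNReal.ofReal C ^ 2 * (ENNReal.ofReal A *
            ∫⁻ η, ENNReal.ofReal (decay (ξ - η)) * ‖h η‖ₑ ^ 2) := by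
          refine lintegral_mono fun ξ => ?_
          refine le_trans ?_ (mul_le_mul_right (hw.lintegral_sq_le h ξ) _)
          rw [← mul_pow]
          refine pow_le_pow_left₀ (zero_le) ?_ 2
          refine (enorm_integral_le_lintegral_enorm _).trans ?_
          rw [← lintegral_const_mul' _ _ (by simp)]
          refine lintegral_mono fun η => ?_
          dsimp only
          rw [enorm_mul, enorm_mul, ← mul_assoc (ENNReal.ofReal C), ← ENNReal.ofReal_mul hC.le]
          gcongr
          rw [← ofReal_norm]
          refine ENNReal.ofReal_le_ofReal ?_
          simpa [abs_of_nonneg (weightKernel_nonneg (ξ - η))] using hK (ξ - η)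
      _ = ENNReal.ofReal C ^ 2 * (ENNReal.ofReal A *
            ∫⁻ ξ, ∫⁻ η, ENNReal.ofReal (decay (ξ - η)) * ‖h η‖ₑ ^ 2) := by
          rw [lintegral_const_mul' _ _ (by simp), lintegral_const_mul' _ _ (by simp)]
      _ = ENNReal.ofReal C ^ 2 * (ENNReal.ofReal A * (ENNReal.ofReal D * ‖h‖ₑ ^ 2)) := by
          congr 2
          rw [lintegral_lintegral_swap]
          · have : ∀ η, ∫⁻ ξ, ENNReal.ofReal (decay (ξ - η)) * ‖h η‖ₑ ^ 2
                = ENNReal.ofReal D * ‖h η‖ₑ ^ 2 := by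
              intro η
              rw [lintegral_mul_const' _ _ (by simp), hD,
                lintegral_sub_right_eq_self (fun x => ENNReal.ofReal (decay x))]
            simp_rw [this]
            rw [lintegral_const_mul' _ _ (by simp), e]
          · have := measurable_decay (d := d)
            have hm : Measurable fun p : EuclideanSpace ℝ (Fin d) × EuclideanSpace ℝ (Fin d) =>
              ENNReal.ofReal (decay (p.1 - p.2)) := by fun_prop
            exact hm.aemeasurable.mul ((Lp.aestronglyMeasurable h).comp_snd.enorm.pow_const 2)
      _ = ENNReal.ofReal (C * √D * √A * ‖h‖) ^ (2 : ℝ) := by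
          rw [ENNReal.rpow_two, ← ofReal_norm]
          rw [← ENNReal.ofReal_pow hC.le, ← ENNReal.ofReal_pow (norm_nonneg _),
            ← ENNReal.ofReal_mul hD0, ← ENNReal.ofReal_mul hw.nonneg,
            ← ENNReal.ofReal_mul (by positivity), ← ENNReal.ofReal_pow (by positivity)]
          congr 1
          simp only [mul_pow, Real.sq_sqrt hw.nonneg, Real.sq_sqrt hD0]
          ring
  have hmem : ∀ h : Lp (α := EuclideanSpace ℝ (Fin d)) ℂ 2, MemLp (kernelConv w h) 2 volume :=
    fun h => ⟨(aestronglyMeasurable_kernel hw.measurable.aestronglyMeasurable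
      (Lp.aestronglyMeasurable h)).integral_prod_right', (hle h).trans_lt (by simp)⟩
  refine ⟨LinearMap.mkContinuous
    { toFun := fun h => (hmem h).toLp _
      map_add' := fun h₁ h₂ => ?_
      map_smul' := fun c h => ?_ } ((C * √D + 1) * √A) fun h => ?_, ?_, fun h => ?_⟩
  · rw [← MemLp.toLp_add]
    refine MemLp.toLp_congr _ _ (.of_forall fun ξ => ?_)
    simp only [Pi.add_apply, kernelConv]
    rw [← integral_add (hw.integrable_weightKernel_mul h₁ ξ) (hw.integrable_weightKernel_mul h₂ ξ)]
    refine integral_congr_ae ?_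
    filter_upwards [Lp.coeFn_add h₁ h₂] with η hη
    rw [hη, Pi.add_apply]; ring
  · rw [RingHom.id_apply, ← MemLp.toLp_const_smul]
    refine MemLp.toLp_congr _ _ (.of_forall fun ξ => ?_)
    simp only [Pi.smul_apply, kernelConv, smul_eq_mul]
    rw [← integral_const_mul]
    refine integral_congr_ae ?_
    filter_upwards [Lp.coeFn_smul c h] with η hη
    rw [hη, Pi.smul_apply, smul_eq_mul]; ring
  · simp only [LinearMap.coe_mk, AddHom.coe_mk]
    rw [Lp.norm_toLp]
    refine ENNReal.toReal_le_of_le_ofReal (by positivity) ((hle h).trans ?_)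
    gcongr
    linarith
  · exact LinearMap.mkContinuous_norm_le _ (by positivity) _
  · exact (hmem h).coeFn_toLp

/-- Fubini moves the convolution onto the test function, where it is multiplication by the weight
before the inverse transform. -/
theorem IsWeight.integral_kernelConv_mul {w : EuclideanSpace ℝ (Fin d) → ℂ} {A : ℝ}
    (hw : IsWeight w A) (h : Lp (α := EuclideanSpace ℝ (Fin d)) ℂ 2)
    (v : SchwartzMap (EuclideanSpace ℝ (Fin d)) ℂ) :
    ∫ ξ, kernelConv w h ξ * FourierTransformInv.fourierInv v ξ =
      ∫ η, w η * h η * FourierTransformInv.fourierInv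
        (SchwartzMap.smulLeftCLM ℂ (fun x => (weight x : ℂ)) v) η := by
  set g : SchwartzMap (EuclideanSpace ℝ (Fin d)) ℂ := FourierTransformInv.fourierInv v with hg
  have e : ∀ η, FourierTransformInv.fourierInv
        (SchwartzMap.smulLeftCLM ℂ (fun x => (weight x : ℂ)) v) η
        = ∫ ξ, (weightKernel (ξ - η) : ℂ) * g ξ := by
    intro η
    rw [hg, ← fourierInv_weight_smul, SchwartzMap.fourierInv_coe,
      SchwartzMap.smulLeftCLM_apply hasTemperateGrowth_weight]
    rfl
  simp_rw [e, kernelConv, ← integral_mul_const, ← integral_const_mul]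
  rw [integral_integral_swap]
  · refine integral_congr_ae (.of_forall fun η => integral_congr_ae (.of_forall fun ξ => ?_))
    dsimp only; ring
  · refine ⟨(aestronglyMeasurable_kernel hw.measurable.aestronglyMeasurable
      (Lp.aestronglyMeasurable h)).mul g.continuous.aestronglyMeasurable.comp_fst, ?_⟩
    obtain ⟨C, hC, hK⟩ := exists_weightKernel_le d
    obtain ⟨B, hB⟩ := hw.lintegral_le h
    have hm := (aestronglyMeasurable_kernel hw.measurable.aestronglyMeasurable
      (Lp.aestronglyMeasurable h)).mul g.continuous.aestronglyMeasurable.comp_fst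
    refine lt_of_eq_of_lt (lintegral_prod _ hm.enorm) ?_
    have : ∀ ξ, ∫⁻ η, ‖(weightKernel (ξ - η) : ℂ) * (w η * h η) * g ξ‖ₑ
        ≤ ENNReal.ofReal C * B * ‖g ξ‖ₑ := by
      intro ξ
      simp_rw [enorm_mul]
      rw [lintegral_mul_const' _ _ (by simp)]
      gcongr
      refine le_trans ?_ (mul_le_mul_right (hB ξ) _)
      rw [← lintegral_const_mul' _ _ (by simp)]
      refine lintegral_mono fun η => ?_
      dsimp only
      rw [← mul_assoc (ENNReal.ofReal C), ← ENNReal.ofReal_mul hC.le]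
      gcongr
      rw [← ofReal_norm]
      refine ENNReal.ofReal_le_ofReal ?_
      simpa [abs_of_nonneg (weightKernel_nonneg (ξ - η))] using hK (ξ - η)
    refine (lintegral_mono this).trans_lt ?_
    rw [lintegral_const_mul' _ _ (by finiteness)]
    exact ENNReal.mul_lt_top (by finiteness) (g.integrable (μ := volume)).2

/-- Compose with the inverse Plancherel isometry; the pairing identifies the result as the weight
times the inverse transform of `w h`. -/
theorem exists_weightOp (d : ℕ) : ∃ C : ℝ, 0 < C ∧
    ∀ (w : EuclideanSpace ℝ (Fin d) → ℂ) (A : ℝ), IsWeight w A →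
      ∃ E : Lp (α := EuclideanSpace ℝ (Fin d)) ℂ 2 →L[ℂ] Lp (α := EuclideanSpace ℝ (Fin d)) ℂ 2,
        ‖E‖ ≤ C * √A ∧ ∀ h (v : SchwartzMap (EuclideanSpace ℝ (Fin d)) ℂ),
          ∫ x, E h x * v x = ∫ η, w η * h η * FourierTransformInv.fourierInv
            (SchwartzMap.smulLeftCLM ℂ (fun x => (weight x : ℂ)) v) η := by
  obtain ⟨C, hC, hT⟩ := exists_kernelConv_op d
  refine ⟨C, hC, fun w A hw => ?_⟩
  obtain ⟨T, hTn, hT⟩ := hT w A hw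
  refine ⟨((Lp.fourierTransformₗᵢ (EuclideanSpace ℝ (Fin d)) ℂ).symm.toLinearIsometry.toContinuousLinearMap).comp T,
    ?_, fun h v => ?_⟩
  · refine (ContinuousLinearMap.opNorm_comp_le _ _).trans ?_
    refine (mul_le_of_le_one_left (norm_nonneg _) (LinearIsometry.norm_toContinuousLinearMap_le _)).trans hTn
  · rw [← hw.integral_kernelConv_mul]
    have h1 := DFunLike.congr_fun (Lp.fourierInv_toTemperedDistribution_eq (T h)) v
    rw [TemperedDistribution.fourierInv_apply, Lp.toTemperedDistribution_apply,
      Lp.toTemperedDistribution_apply] at h1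
    rw [show ∫ ξ, kernelConv w h ξ * FourierTransformInv.fourierInv v ξ =
      ∫ ξ, T h ξ * FourierTransformInv.fourierInv v ξ from integral_congr_ae (by
        filter_upwards [hT h] with ξ hξ; rw [hξ])]
    simp only [smul_eq_mul, mul_comm] at h1 ⊢
    exact h1.symm

end Kernel

/-! ### Removing the weight: ψ and ∇ψ as locally square-integrable functions. -/

section Unweight

open scoped LineDeriv
variable {d : ℕ}

/-- Complex-valued square-integrable functions on `ℝ^d`. -/
abbrev L2Space (d : ℕ) : Type := Lp (α := EuclideanSpace ℝ (Fin d)) ℂ 2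

/-- Division by the weight. -/
noncomputable def unweight (f : L2Space d) (x : EuclideanSpace ℝ (Fin d)) : ℂ :=
  (weight x : ℂ)⁻¹ * f x

theorem continuous_inv_weight : Continuous fun x : EuclideanSpace ℝ (Fin d) => (weight x : ℂ)⁻¹ :=
  hasTemperateGrowth_inv_weight.1.continuous

theorem aestronglyMeasurable_unweight (f : L2Space d) : AEStronglyMeasurable (unweight f) volume :=
  continuous_inv_weight.aestronglyMeasurable.mul (Lp.aestronglyMeasurable f)

theorem memLp_unweight (f : L2Space d) {K : Set (EuclideanSpace ℝ (Fin d))} (hK : IsCompact K) :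
    MemLp (unweight f) 2 (volume.restrict K) := by
  obtain ⟨C, hC⟩ := hK.exists_bound_of_continuousOn (continuous_inv_weight (d := d)).continuousOn
  refine MemLp.of_le_mul (g := f) (c := C) ((Lp.memLp f).restrict K)
    (aestronglyMeasurable_unweight f).restrict ?_
  filter_upwards [ae_restrict_mem hK.measurableSet] with x hx
  unfold unweight
  rw [norm_mul]
  gcongr
  exact hC x hx

theorem locallyIntegrable_unweight (f : L2Space d) : LocallyIntegrable (unweight f) volume := by
  rw [locallyIntegrable_iff]
  intro K hK
  have : IsFiniteMeasure (volume.restrict K) := ⟨by simpa using hK.measure_lt_top⟩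
  exact (memLp_unweight f hK).integrable (by norm_num)

theorem integrable_mul_schwartz (f : L2Space d) (v : SchwartzMap (EuclideanSpace ℝ (Fin d)) ℂ) :
    Integrable (fun x => f x * v x) :=
  (Lp.memLp f).integrable_mul (v.memLp 2)

/-- Multiplication of a Schwartz function by the weight. -/
noncomputable def weightMul (v : SchwartzMap (EuclideanSpace ℝ (Fin d)) ℂ) :
    SchwartzMap (EuclideanSpace ℝ (Fin d)) ℂ := SchwartzMap.smulLeftCLM ℂ (fun x => (weight x : ℂ)) v

/-- Division of a Schwartz function by the weight. -/
noncomputable def weightDiv (v : SchwartzMap (EuclideanSpace ℝ (Fin d)) ℂ) :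
    SchwartzMap (EuclideanSpace ℝ (Fin d)) ℂ := SchwartzMap.smulLeftCLM ℂ (fun x => (weight x : ℂ)⁻¹) v

theorem weightMul_apply (v : SchwartzMap (EuclideanSpace ℝ (Fin d)) ℂ) (x) :
    weightMul v x = weight x * v x := by
  simp [weightMul, SchwartzMap.smulLeftCLM_apply_apply hasTemperateGrowth_weight]

theorem weightDiv_apply (v : SchwartzMap (EuclideanSpace ℝ (Fin d)) ℂ) (x) :
    weightDiv v x = (weight x : ℂ)⁻¹ * v x := by
  simp [weightDiv, SchwartzMap.smulLeftCLM_apply_apply hasTemperateGrowth_inv_weight]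

theorem weightMul_weightDiv (v : SchwartzMap (EuclideanSpace ℝ (Fin d)) ℂ) :
    weightMul (weightDiv v) = v := by
  ext x
  rw [weightMul_apply, weightDiv_apply, ← mul_assoc,
    mul_inv_cancel₀ (by exact_mod_cast (weight_pos x).ne'), one_mul]

theorem integrable_unweight_mul (f : L2Space d) (v : SchwartzMap (EuclideanSpace ℝ (Fin d)) ℂ) :
    Integrable (fun x => unweight f x * v x) := by
  refine (integrable_mul_schwartz f (weightDiv v)).congr (.of_forall fun x => ?_)
  simp only [weightDiv_apply, unweight]; ring

/-- `T` is the operator `h ↦ weight · 𝓕⁻¹(w h)`. -/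
def IsWeightOp (w : EuclideanSpace ℝ (Fin d) → ℂ) (T : L2Space d →L[ℂ] L2Space d) : Prop :=
  ∀ h (v : SchwartzMap (EuclideanSpace ℝ (Fin d)) ℂ),
    ∫ x, unweight (T h) x * v x = ∫ η, w η * h η * FourierTransformInv.fourierInv v η

theorem exists_isWeightOp (d : ℕ) : ∃ C : ℝ, 0 < C ∧
    ∀ (w : EuclideanSpace ℝ (Fin d) → ℂ) (A : ℝ), IsWeight w A →
      ∃ T : L2Space d →L[ℂ] L2Space d, ‖T‖ ≤ C * √A ∧ IsWeightOp w T := by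
  obtain ⟨C, hC, h⟩ := exists_weightOp d
  refine ⟨C, hC, fun w A hw => ?_⟩
  obtain ⟨T, hT, hE⟩ := h w A hw
  refine ⟨T, hT, fun h v => ?_⟩
  have := hE h (weightDiv v)
  change _ = ∫ η, w η * h η * FourierTransformInv.fourierInv (weightMul (weightDiv v)) η at this
  rw [weightMul_weightDiv] at this
  rw [← this]
  refine integral_congr_ae (.of_forall fun x => ?_)
  simp only [weightDiv_apply, unweight]; ring

theorem coord_eq_inner (ξ : EuclideanSpace ℝ (Fin d)) (j : Fin d) :
    inner ℝ ξ (EuclideanSpace.single j 1) = ξ j := by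
  simp [EuclideanSpace.inner_single_right]

theorem fourierInv_lineDeriv_apply (v : SchwartzMap (EuclideanSpace ℝ (Fin d)) ℂ) (j : Fin d) (ξ) :
    (FourierTransformInv.fourierInv
      (∂_{(EuclideanSpace.single j 1 : EuclideanSpace ℝ (Fin d))} v) : SchwartzMap (EuclideanSpace ℝ (Fin d)) ℂ) ξ
      = -(2 * Real.pi * Complex.I * ξ j) * FourierTransformInv.fourierInv v ξ := by
  rw [SchwartzMap.fourierInv_lineDerivOp_eq]
  have := SchwartzMap.smulLeftCLM_apply_apply (F := ℂ) (hasTemperateGrowth_coord j)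
    (FourierTransformInv.fourierInv v) ξ
  simp only [coord_eq_inner, smul_apply, this, smul_eq_mul, Complex.real_smul]
  ring

theorem fourier_lineDeriv_apply (v : SchwartzMap (EuclideanSpace ℝ (Fin d)) ℂ) (j : Fin d) (ξ) :
    (FourierTransform.fourier
      (∂_{(EuclideanSpace.single j 1 : EuclideanSpace ℝ (Fin d))} v) : SchwartzMap (EuclideanSpace ℝ (Fin d)) ℂ) ξ
      = (2 * Real.pi * Complex.I * ξ j) * FourierTransform.fourier v ξ := by
  rw [SchwartzMap.fourier_lineDerivOp_eq]
  have := SchwartzMap.smulLeftCLM_apply_apply (F := ℂ) (hasTemperateGrowth_coord j)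
    (FourierTransform.fourier v) ξ
  simp only [coord_eq_inner, smul_apply, this, smul_eq_mul, Complex.real_smul]
  ring

theorem lineDeriv_schwartz_apply (v : SchwartzMap (EuclideanSpace ℝ (Fin d)) ℂ) (j : Fin d) (x) :
    (∂_{(EuclideanSpace.single j 1 : EuclideanSpace ℝ (Fin d))} v) x
      = fderiv ℝ v x (EuclideanSpace.single j 1) := SchwartzMap.lineDerivOp_apply_eq_fderiv _ _ _

theorem ae_eq_of_forall_schwartz {f g : EuclideanSpace ℝ (Fin d) → ℂ}
    (hf : LocallyIntegrable f volume) (hg : LocallyIntegrable g volume)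
    (h : ∀ v : SchwartzMap (EuclideanSpace ℝ (Fin d)) ℂ, ∫ x, f x * v x = ∫ x, g x * v x) :
    f =ᵐ[volume] g := by
  refine ae_eq_of_integral_contDiff_smul_eq hf hg fun φ hφ hc => ?_
  have := h (HasCompactSupport.toSchwartzMap (f := fun x => (φ x : ℂ))
    (hc.comp_left (g := Complex.ofReal) rfl) (Complex.ofRealCLM.contDiff.comp hφ))
  simp_rw [Complex.real_smul, mul_comm ((φ _ : ℝ) : ℂ)]
  exact this

/-- Both sides have the same pairings with Schwartz functions, by Fourier inversion. It serves to
recognize test functions in the range of the operators. -/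
theorem IsWeightOp.unweight_ae_eq {w : EuclideanSpace ℝ (Fin d) → ℂ} {T : L2Space d →L[ℂ] L2Space d}
    (hT : IsWeightOp w T) {h : L2Space d} {g : SchwartzMap (EuclideanSpace ℝ (Fin d)) ℂ}
    (hg : ∀ᵐ ξ, w ξ * h ξ = FourierTransform.fourier g ξ) : unweight (T h) =ᵐ[volume] g := by
  refine ae_eq_of_forall_schwartz (locallyIntegrable_unweight _) g.continuous.locallyIntegrable
    fun v => ?_
  have hv : FourierTransform.fourier (FourierTransformInv.fourierInv v : SchwartzMap (EuclideanSpace ℝ (Fin d)) ℂ) = v :=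
    FourierTransform.fourier_fourierInv_eq v
  have h1 := SchwartzMap.integral_fourier_mul_eq g (FourierTransformInv.fourierInv v)
  rw [hv] at h1
  rw [hT, ← h1]
  refine integral_congr_ae ?_
  filter_upwards [hg] with ξ hξ
  rw [hξ]

/-- The gradient field with components `unweight (D j h)`. -/
noncomputable def unweightGrad (D : Fin d → L2Space d →L[ℂ] L2Space d) (h : L2Space d)
    (x : EuclideanSpace ℝ (Fin d)) : EuclideanSpace ℂ (Fin d) :=
  WithLp.toLp 2 fun j => unweight (D j h) x

/-- Under the inverse Fourier transform ∂_j becomes -2πi ξ_j, and the sign is that of the weak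
derivative. -/
theorem IsWeightOp.hasWeakGrad {w : EuclideanSpace ℝ (Fin d) → ℂ} {E : L2Space d →L[ℂ] L2Space d}
    {D : Fin d → L2Space d →L[ℂ] L2Space d} (hE : IsWeightOp w E)
    (hD : ∀ j, IsWeightOp (fun ξ => 2 * Real.pi * Complex.I * ξ j * w ξ) (D j)) (h : L2Space d) :
    HasWeakGrad (unweight (E h)) (unweightGrad D h) := by
  refine ⟨locallyIntegrable_unweight _, locallyIntegrable_euclidean fun j =>
    locallyIntegrable_unweight (D j h), fun j φ hφ hc => ?_⟩
  set v : SchwartzMap (EuclideanSpace ℝ (Fin d)) ℂ := hc.toSchwartzMap hφ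
  have h1 := hE h (∂_{(EuclideanSpace.single j 1 : EuclideanSpace ℝ (Fin d))} v)
  have h2 := hD j h v
  simp_rw [lineDeriv_schwartz_apply, fourierInv_lineDeriv_apply] at h1
  refine h1.trans (Eq.trans ?_ (congrArg Neg.neg h2.symm))
  rw [← integral_neg]
  refine integral_congr_ae (.of_forall fun ξ => ?_)
  dsimp only; ring

theorem memLp_unweightGrad (D : Fin d → L2Space d →L[ℂ] L2Space d) (h : L2Space d)
    {K : Set (EuclideanSpace ℝ (Fin d))} (hK : IsCompact K) :
    MemLp (unweightGrad D h) 2 (volume.restrict K) := by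
  have e : unweightGrad D h = fun x => ∑ j, (unweight (D j h) x) •
      (EuclideanSpace.single j (1 : ℂ) : EuclideanSpace ℂ (Fin d)) := by
    funext x
    ext i
    simp [Finset.sum_apply, Pi.single_apply, unweightGrad]
  rw [e]
  refine memLp_finsetSum _ fun j _ => ?_
  have := (ContinuousLinearMap.toSpanSingleton ℂ (EuclideanSpace.single j (1 : ℂ))).comp_memLp'
    (memLp_unweight (D j h) hK)
  exact this

/-- The function `unweight f` as a tempered distribution. -/
noncomputable def unweightDist (f : L2Space d) :
    TemperedDistribution (EuclideanSpace ℝ (Fin d)) ℂ :=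
  TemperedDistribution.smulLeftCLM ℂ (fun x => (weight x : ℂ)⁻¹) (Lp.toTemperedDistribution f)

theorem unweightDist_apply (f : L2Space d) (v : SchwartzMap (EuclideanSpace ℝ (Fin d)) ℂ) :
    unweightDist f v = ∫ x, unweight f x * v x := by
  rw [unweightDist, TemperedDistribution.smulLeftCLM_apply_apply, Lp.toTemperedDistribution_apply]
  refine integral_congr_ae (.of_forall fun x => ?_)
  change weightDiv v x • f x = unweight f x * v x
  rw [weightDiv_apply, unweight, smul_eq_mul]; ring

theorem isFunction_unweightDist (f : L2Space d) : IsFunction (unweightDist f) (unweight f) :=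
  fun v => ⟨integrable_unweight_mul f v, unweightDist_apply f v⟩

theorem IsWeightOp.isFunction_fourier {w : EuclideanSpace ℝ (Fin d) → ℂ} {A : ℝ}
    {E : L2Space d →L[ℂ] L2Space d} (hw : IsWeight w A) (hE : IsWeightOp w E) (h : L2Space d) :
    IsFunction (FourierTransform.fourier (unweightDist (E h))) (fun ξ => w ξ * h ξ) := by
  refine fun v => ⟨hw.integrable_mul_schwartz h v, ?_⟩
  rw [TemperedDistribution.fourier_apply, unweightDist_apply, hE,
    FourierTransform.fourierInv_fourier_eq]

/-- The function `|p_ζ|^{-1/2}` in the frequency variable. -/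
noncomputable def invSqrtSymbol (ζ : Fin d → ℂ) (ξ : EuclideanSpace ℝ (Fin d)) : ℂ :=
  ((absSymbol ζ ξ ^ (-1 / 2 : ℝ) : ℝ) : ℂ)

theorem measurable_invSqrtSymbol (ζ : Fin d → ℂ) : Measurable (invSqrtSymbol ζ) := by
  have := (continuous_absSymbol ζ).measurable
  unfold invSqrtSymbol; fun_prop

/-- Equality holds off the zeros of the symbol. At a zero the real power is 0 by convention while
the right side is ∞. -/
theorem enorm_invSqrtSymbol_sq_le (ζ : Fin d → ℂ) (ξ : EuclideanSpace ℝ (Fin d)) :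
    ‖invSqrtSymbol ζ ξ‖ₑ ^ 2 ≤ (ENNReal.ofReal (absSymbol ζ ξ))⁻¹ := by
  rcases (absSymbol_nonneg ζ ξ).eq_or_lt with h | h
  · simp [← h]
  · rw [← ENNReal.ofReal_inv_of_pos h, ← ofReal_norm, ← ENNReal.ofReal_pow (norm_nonneg _)]
    refine ENNReal.ofReal_le_ofReal (le_of_eq ?_)
    unfold invSqrtSymbol
    rw [Complex.norm_real, Real.norm_of_nonneg (by positivity), ← Real.rpow_natCast,
      ← Real.rpow_mul h.le]
    norm_num
    exact Real.rpow_neg_one _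

theorem exists_isWeight_invSqrtSymbol (d : ℕ) : ∃ C : ℝ, 0 < C ∧ ∀ (ζ : Fin d → ℂ) (s : ℝ)
    (e b : EuclideanSpace ℝ (Fin d)), IsNull ζ s e b → 13 ≤ s →
      IsWeight (invSqrtSymbol ζ) (C / s) ∧
      ∀ j, IsWeight (fun ξ => 2 * Real.pi * Complex.I * ξ j * invSqrtSymbol ζ ξ) (C * s) := by
  obtain ⟨C₁, h₁⟩ := exists_lintegral_inv_absSymbol_le d
  obtain ⟨C₂, h₂⟩ := exists_lintegral_norm_sq_inv_absSymbol_le d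
  refine ⟨C₁ + C₂ + 1, by positivity, fun ζ s e b hζ hs => ⟨⟨measurable_invSqrtSymbol ζ,
    by positivity, fun ξ => ?_⟩, fun j => ⟨?_, by positivity, fun ξ => ?_⟩⟩⟩
  · refine (lintegral_mono fun η => mul_le_mul_right (enorm_invSqrtSymbol_sq_le ζ η) _).trans
      ((h₁ ζ s e b hζ hs ξ).trans ?_)
    rw [← ENNReal.ofReal_coe_nnreal, ← ENNReal.ofReal_mul (by positivity), div_eq_mul_inv]
    apply ENNReal.ofReal_le_ofReal
    gcongr
    linarith [C₂.2]
  · have := measurable_invSqrtSymbol ζ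
    fun_prop
  · refine (lintegral_mono fun η => mul_le_mul_right (?_ : _ ≤
      ENNReal.ofReal (‖(2 * Real.pi) • η‖ ^ 2) * (ENNReal.ofReal (absSymbol ζ η))⁻¹) _).trans
      ((h₂ ζ s e b hζ hs ξ).trans ?_)
    · rw [enorm_mul, mul_pow]
      gcongr
      · rw [← ofReal_norm, ← ENNReal.ofReal_pow (norm_nonneg _)]
        apply ENNReal.ofReal_le_ofReal
        have := PiLp.norm_apply_le η j
        rw [norm_smul]
        simp only [norm_mul, Complex.norm_real, Complex.norm_I, mul_one, Complex.norm_ofNat,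
          Real.norm_ofNat]
        gcongr
      · exact enorm_invSqrtSymbol_sq_le ζ η
    · rw [← ENNReal.ofReal_coe_nnreal, ← ENNReal.ofReal_mul (by positivity)]
      apply ENNReal.ofReal_le_ofReal
      gcongr
      linarith [C₁.2]

theorem xnorm_unweightDist_le {ζ : Fin d → ℂ} {A : ℝ} {E : L2Space d →L[ℂ] L2Space d}
    (hw : IsWeight (invSqrtSymbol ζ) A) (hE : IsWeightOp (invSqrtSymbol ζ) E) (h : L2Space d) :
    XNorm (1 / 2) ζ (unweightDist (E h)) ≤ ‖h‖ₑ := by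
  refine (iInf₂_le _ (hE.isFunction_fourier hw h)).trans ?_
  rw [Lp.enorm_def]
  refine eLpNorm_mono fun ξ => ?_
  have h0 : (0 : ℝ) ≤ absSymbol ζ ξ := absSymbol_nonneg ζ ξ
  rw [← mul_assoc, norm_mul]
  refine mul_le_of_le_one_left (norm_nonneg _) ?_
  change ‖((absSymbol ζ ξ ^ (1 / 2 : ℝ) : ℝ) : ℂ) * ((absSymbol ζ ξ ^ (-1 / 2 : ℝ) : ℝ) : ℂ)‖ ≤ 1
  rw [← Complex.ofReal_mul, Complex.norm_real, Real.norm_of_nonneg (by positivity)]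
  rcases h0.eq_or_lt with h | h
  · rw [← h]; norm_num
  · rw [← Real.rpow_add h]; norm_num

end Unweight

/-! ### The potential as a tempered distribution and its Fourier transform. -/

section Potential

open scoped LineDeriv
variable {d : ℕ}

theorem integral_fourier_mul_schwartz {f : EuclideanSpace ℝ (Fin d) → ℂ} (hf : Integrable f)
    (v : SchwartzMap (EuclideanSpace ℝ (Fin d)) ℂ) :
    ∫ ξ, FourierTransform.fourier f ξ * v ξ = ∫ x, f x * FourierTransform.fourier v x := by
  have h := VectorFourier.integral_fourierIntegral_smul_eq_flip (L := innerₗ (EuclideanSpace ℝ (Fin d)))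
      (μ := volume) (ν := volume) Real.continuous_fourierChar continuous_inner hf
      (v.integrable (μ := volume))
  rw [flip_innerₗ] at h
  exact h

theorem continuous_fourier {f : EuclideanSpace ℝ (Fin d) → ℂ} (hf : Integrable f) :
    Continuous (FourierTransform.fourier f) :=
  VectorFourier.fourierIntegral_continuous Real.continuous_fourierChar continuous_inner hf

theorem integrable_fourier_mul_schwartz {f : EuclideanSpace ℝ (Fin d) → ℂ} (hf : Integrable f)
    (v : SchwartzMap (EuclideanSpace ℝ (Fin d)) ℂ) :
    Integrable (fun ξ => FourierTransform.fourier f ξ * v ξ) := by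
  refine (v.integrable (μ := volume)).bdd_mul (c := ∫ x, ‖f x‖)
    (continuous_fourier hf).aestronglyMeasurable (.of_forall fun ξ => ?_)
  exact VectorFourier.norm_fourierIntegral_le_integral_norm _ _ _ _ _

/-- For an integrable square-integrable function the Fourier integral agrees almost everywhere with
the Plancherel transform. -/
theorem memLp_fourier {f : EuclideanSpace ℝ (Fin d) → ℂ} (hf : Integrable f) (hf2 : MemLp f 2) :
    MemLp (FourierTransform.fourier f) 2 := by
  set F : L2Space d := hf2.toLp f
  have h : FourierTransform.fourier f =ᵐ[volume] (FourierTransform.fourier F : L2Space d) := by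
    refine ae_eq_of_forall_schwartz (continuous_fourier hf).locallyIntegrable
      ((Lp.memLp _).locallyIntegrable (by norm_num)) fun v => ?_
    rw [integral_fourier_mul_schwartz hf]
    have h1 := DFunLike.congr_fun (Lp.fourier_toTemperedDistribution_eq F) v
    rw [TemperedDistribution.fourier_apply, Lp.toTemperedDistribution_apply,
      Lp.toTemperedDistribution_apply] at h1
    simp only [smul_eq_mul, mul_comm] at h1 ⊢
    rw [← h1]
    refine integral_congr_ae ?_
    filter_upwards [hf2.coeFn_toLp] with x hx
    rw [hx]
  exact (Lp.memLp _).ae_eq h.symm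

/-- The Fourier transform of the potential with logarithmic gradient `f`. -/
noncomputable def fourierPotential (f : Fin d → EuclideanSpace ℝ (Fin d) → ℝ)
    (ξ : EuclideanSpace ℝ (Fin d)) : ℂ :=
  FourierTransform.fourier (fun x => ∑ j, (f j x : ℂ) ^ 2) ξ
    + ∑ j, 2 * Real.pi * Complex.I * ξ j * FourierTransform.fourier (fun x => (f j x : ℂ)) ξ

theorem memLp_of_bounded {g : EuclideanSpace ℝ (Fin d) → ℂ} (hg : AEStronglyMeasurable g) {B ρ : ℝ}
    (hb : ∀ x, ‖g x‖ ≤ B) (h0 : ∀ x, ρ < ‖x‖ → g x = 0) (p : ℝ≥0∞) : MemLp g p := by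
  have hK : (volume (Metric.closedBall (0 : EuclideanSpace ℝ (Fin d)) ρ)) ≠ ⊤ :=
    (isCompact_closedBall _ _).measure_ne_top
  have : IsFiniteMeasure (volume.restrict (Metric.closedBall (0 : EuclideanSpace ℝ (Fin d)) ρ)) :=
    ⟨by simpa using hK.lt_top⟩
  have h1 : MemLp g p (volume.restrict (Metric.closedBall (0 : EuclideanSpace ℝ (Fin d)) ρ)) :=
    MemLp.of_bound hg.restrict B (.of_forall hb)
  have h2 := (memLp_indicator_iff_restrict Metric.isClosed_closedBall.measurableSet).2 h1
  convert h2 using 1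
  funext x
  by_cases hx : x ∈ Metric.closedBall (0 : EuclideanSpace ℝ (Fin d)) ρ
  · rw [Set.indicator_of_mem hx]
  · rw [Set.indicator_of_notMem hx, h0 x (by simpa using hx)]

section
variable {γ : EuclideanSpace ℝ (Fin d) → ℝ} {ρ : ℝ} {f : Fin d → EuclideanSpace ℝ (Fin d) → ℝ}

theorem IsLogGradient.memLp (hf : IsLogGradient γ ρ f) (j : Fin d) (p : ℝ≥0∞) :
    MemLp (fun x => (f j x : ℂ)) p := by
  obtain ⟨B, hB⟩ := hf.bounded
  refine memLp_of_bounded (B := B) (ρ := ρ) ?_ (fun x => by simpa using hB j x)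
    (fun x hx => by simp [hf.eq_zero j x hx]) p
  exact (Complex.measurable_ofReal.comp (hf.measurable j)).aestronglyMeasurable

theorem IsLogGradient.memLp_sq (hf : IsLogGradient γ ρ f) (p : ℝ≥0∞) :
    MemLp (fun x => ∑ j, (f j x : ℂ) ^ 2) p := by
  obtain ⟨B, hB⟩ := hf.bounded
  refine memLp_finsetSum _ fun j _ => memLp_of_bounded (B := B ^ 2) (ρ := ρ) ?_ (fun x => ?_)
    (fun x hx => by simp [hf.eq_zero j x hx]) p
  · exact ((Complex.measurable_ofReal.comp (hf.measurable j)).pow_const 2).aestronglyMeasurable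
  · rw [norm_pow]
    have := hB j x
    gcongr
    simpa using this

theorem IsLogGradient.continuous_fourierPotential (hf : IsLogGradient γ ρ f) :
    Continuous (fourierPotential f) := by
  have h1 := continuous_fourier (memLp_one_iff_integrable.1 (hf.memLp_sq 1))
  have h2 := fun j => continuous_fourier (memLp_one_iff_integrable.1 (hf.memLp j 1))
  unfold fourierPotential
  fun_prop

/-- This says q ∈ H^{-1}: q is the sum of |f|² and div f, with |f|² and f in L². The multipliers `m`
and 2πi ξ_j `m` are bounded by 1. -/
theorem IsLogGradient.lintegral_fourierPotential_ne_top (hf : IsLogGradient γ ρ f) :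
    ∫⁻ ξ, ‖fourierPotential f ξ‖ₑ ^ 2 * (ENNReal.ofReal (1 + ‖(2 * Real.pi) • ξ‖ ^ 2))⁻¹ ≠ ⊤ := by
  set m : EuclideanSpace ℝ (Fin d) → ℂ := fun ξ => ((√(1 + ‖(2 * Real.pi) • ξ‖ ^ 2))⁻¹ : ℝ) with hm
  have hm0 : ∀ ξ : EuclideanSpace ℝ (Fin d), 0 < √(1 + ‖(2 * Real.pi) • ξ‖ ^ 2) := fun ξ => by positivity
  have hmc : Continuous m := by
    refine Complex.continuous_ofReal.comp (Continuous.inv₀ (by fun_prop) fun ξ => (hm0 ξ).ne')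
  have hm1 : ∀ ξ, ‖m ξ‖ ≤ 1 := fun ξ => by
    rw [hm, Complex.norm_real, norm_inv, Real.norm_of_nonneg (Real.sqrt_nonneg _)]
    exact inv_le_one_of_one_le₀ (Real.one_le_sqrt.2 (by nlinarith [sq_nonneg ‖(2 * Real.pi) • ξ‖]))
  have hm2 : ∀ ξ j, ‖m ξ * (2 * Real.pi * Complex.I * ξ j)‖ ≤ 1 := fun ξ j => by
    rw [norm_mul, hm, Complex.norm_real, norm_inv, Real.norm_of_nonneg (Real.sqrt_nonneg _),
      inv_mul_le_one₀ (hm0 ξ)]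
    refine Real.le_sqrt_of_sq_le ?_
    have := PiLp.norm_apply_le ξ j
    have h : ‖2 * Real.pi * Complex.I * (ξ j : ℂ)‖ ≤ ‖(2 * Real.pi) • ξ‖ := by
      rw [norm_smul]
      simp only [norm_mul, Complex.norm_real, Complex.norm_I, mul_one, Complex.norm_ofNat,
        Real.norm_ofNat]
      gcongr
    nlinarith [norm_nonneg (2 * Real.pi * Complex.I * (ξ j : ℂ))]
  have hL : MemLp (fun ξ => m ξ * fourierPotential f ξ) 2 := by
    have h1 := memLp_fourier (memLp_one_iff_integrable.1 (hf.memLp_sq 1)) (hf.memLp_sq 2)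
    have h2 := fun j => memLp_fourier (memLp_one_iff_integrable.1 (hf.memLp j 1)) (hf.memLp j 2)
    have h3 : (fun ξ => m ξ * fourierPotential f ξ) = (fun ξ => m ξ *
        FourierTransform.fourier (fun x => ∑ j, (f j x : ℂ) ^ 2) ξ) + fun ξ => ∑ j,
          (m ξ * (2 * Real.pi * Complex.I * ξ j)) * FourierTransform.fourier (fun x => (f j x : ℂ)) ξ := by
      funext ξ
      simp only [fourierPotential, Pi.add_apply, mul_add, Finset.mul_sum, mul_assoc]
    rw [h3]
    refine MemLp.add (h1.of_le_mul (c := 1) (hmc.aestronglyMeasurable.mul h1.1)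
      (.of_forall fun ξ => ?_)) (memLp_finsetSum _ fun j _ => (h2 j).of_le_mul (c := 1)
      ((Continuous.aestronglyMeasurable (by fun_prop)).mul (h2 j).1) (.of_forall fun ξ => ?_))
    · rw [norm_mul]; gcongr; exact hm1 ξ
    · rw [norm_mul]; gcongr; exact hm2 ξ j
  have h4 := (eLpNorm_lt_top_iff_lintegral_rpow_enorm_lt_top (by simp) (by simp)).1 hL.2
  simp only [ENNReal.toReal_ofNat, ENNReal.rpow_two] at h4
  refine ne_of_lt (lt_of_le_of_lt (lintegral_mono fun ξ => le_of_eq ?_) h4)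
  dsimp only
  rw [enorm_mul, mul_pow, mul_comm]
  congr 1
  rw [← ofReal_norm, ← ENNReal.ofReal_pow (norm_nonneg _), hm, Complex.norm_real, norm_inv,
    Real.norm_of_nonneg (Real.sqrt_nonneg _), inv_pow, Real.sq_sqrt (by positivity),
    ENNReal.ofReal_inv_of_pos (by positivity)]

theorem IsLogGradient.mq_one (hf : IsLogGradient γ ρ f)
    (v : SchwartzMap (EuclideanSpace ℝ (Fin d)) ℂ) : mq γ (fun _ => 1) v =
      ∫ x, ∑ j, ((f j x : ℂ) ^ 2 * v x - f j x * fderiv ℝ v x (EuclideanSpace.single j 1)) := by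
  rw [hf.mq_eq _ _ _ hasWeakGrad_one (v.smooth ⊤)]
  simp

theorem IsLogGradient.integrable_potential (hf : IsLogGradient γ ρ f) (j : Fin d)
    (v : SchwartzMap (EuclideanSpace ℝ (Fin d)) ℂ) : Integrable (fun x => (f j x : ℂ) * v x) :=
  (hf.memLp j 2).integrable_mul (v.memLp 2)

/-- The witness is |f|² + div f in the sense of distributions. -/
theorem IsLogGradient.exists_potential (hf : IsLogGradient γ ρ f) :
    ∃ Q : TemperedDistribution (EuclideanSpace ℝ (Fin d)) ℂ, IsPotential γ Q ∧
      IsFunction (FourierTransform.fourier Q) (fourierPotential f) := by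
  set Q : TemperedDistribution (EuclideanSpace ℝ (Fin d)) ℂ :=
    Lp.toTemperedDistribution ((hf.memLp_sq 2).toLp _)
      + ∑ j, ∂_{(EuclideanSpace.single j 1 : EuclideanSpace ℝ (Fin d))}
        (Lp.toTemperedDistribution ((hf.memLp j 2).toLp _) :
          TemperedDistribution (EuclideanSpace ℝ (Fin d)) ℂ)
  have hQ : ∀ v : SchwartzMap (EuclideanSpace ℝ (Fin d)) ℂ, Q v =
      (∫ x, (∑ j, (f j x : ℂ) ^ 2) * v x) - ∑ j, ∫ x, (f j x : ℂ) *
        (∂_{(EuclideanSpace.single j 1 : EuclideanSpace ℝ (Fin d))} v) x := by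
    intro v
    have h1 : (Lp.toTemperedDistribution ((hf.memLp_sq 2).toLp _) :
          TemperedDistribution (EuclideanSpace ℝ (Fin d)) ℂ) v =
        ∫ x, (∑ j, (f j x : ℂ) ^ 2) * v x := by
      rw [Lp.toTemperedDistribution_apply]
      refine integral_congr_ae ?_
      filter_upwards [(hf.memLp_sq 2).coeFn_toLp] with x hx
      rw [hx, smul_eq_mul, mul_comm]
    have h2 : ∀ j, (∂_{(EuclideanSpace.single j 1 : EuclideanSpace ℝ (Fin d))}
        (Lp.toTemperedDistribution ((hf.memLp j 2).toLp _) :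
          TemperedDistribution (EuclideanSpace ℝ (Fin d)) ℂ)) v = - ∫ x, (f j x : ℂ) *
        (∂_{(EuclideanSpace.single j 1 : EuclideanSpace ℝ (Fin d))} v) x := by
      intro j
      rw [TemperedDistribution.lineDerivOp_apply_apply, map_neg, Lp.toTemperedDistribution_apply]
      congr 1
      refine integral_congr_ae ?_
      filter_upwards [(hf.memLp j 2).coeFn_toLp] with x hx
      rw [hx, smul_eq_mul, mul_comm]
    change (_ + _ : TemperedDistribution (EuclideanSpace ℝ (Fin d)) ℂ) v = _
    rw [add_apply, h1, sum_apply]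
    simp_rw [h2]
    rw [Finset.sum_neg_distrib, sub_eq_add_neg]
  have hsq : ∀ v : SchwartzMap (EuclideanSpace ℝ (Fin d)) ℂ,
      Integrable (fun x => (∑ j, (f j x : ℂ) ^ 2) * v x) := fun v =>
    (hf.memLp_sq 2).integrable_mul (v.memLp 2)
  have hi1 := memLp_one_iff_integrable.1 (hf.memLp_sq 1)
  have hi2 := fun j => memLp_one_iff_integrable.1 (hf.memLp j 1)
  have hV : ∀ (v : SchwartzMap (EuclideanSpace ℝ (Fin d)) ℂ) (j : Fin d),
      ∃ V : SchwartzMap (EuclideanSpace ℝ (Fin d)) ℂ, (∀ x, V x = 2 * Real.pi * Complex.I * x j * v x) ∧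
        FourierTransform.fourier V = - ∂_{(EuclideanSpace.single j 1 : EuclideanSpace ℝ (Fin d))}
          (FourierTransform.fourier v : SchwartzMap (EuclideanSpace ℝ (Fin d)) ℂ) := by
    intro v j
    refine ⟨(2 * Real.pi * Complex.I) • (SchwartzMap.smulLeftCLM ℂ fun x => inner ℝ x
      (EuclideanSpace.single j 1 : EuclideanSpace ℝ (Fin d))) v, fun x => ?_, ?_⟩
    · have := SchwartzMap.smulLeftCLM_apply_apply (F := ℂ) (hasTemperateGrowth_coord j) v x
      simp only [coord_eq_inner, smul_apply, this, smul_eq_mul, Complex.real_smul]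
      ring
    · rw [SchwartzMap.lineDerivOp_fourier_eq, neg_smul, ← FourierTransform.fourier_neg, neg_neg]
  have hsum : ∀ (v : SchwartzMap (EuclideanSpace ℝ (Fin d)) ℂ)
      (V : Fin d → SchwartzMap (EuclideanSpace ℝ (Fin d)) ℂ),
      (∀ j x, V j x = 2 * Real.pi * Complex.I * x j * v x) → (fun x => fourierPotential f x * v x)
        = fun x => FourierTransform.fourier (fun x => ∑ j, (f j x : ℂ) ^ 2) x * v x
          + ∑ j, FourierTransform.fourier (fun x => (f j x : ℂ)) x * V j x := by
    intro v V hV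
    funext x
    simp only [fourierPotential, add_mul, Finset.sum_mul, hV]
    congr 1
    refine Finset.sum_congr rfl fun j _ => ?_
    ring
  refine ⟨Q, fun v => ?_, fun v => ?_⟩
  · rw [hQ, hf.mq_one, ← integral_finsetSum _ fun j _ => hf.integrable_potential j _,
      ← integral_sub (hsq v) (integrable_finsetSum _ fun j _ => hf.integrable_potential j _)]
    refine integral_congr_ae (.of_forall fun x => ?_)
    simp only [Finset.sum_sub_distrib, Finset.sum_mul, lineDeriv_schwartz_apply]
  · choose V hV1 hV2 using hV v
    rw [hsum v V hV1]
    have i1 := integrable_fourier_mul_schwartz hi1 v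
    have i2 := fun j => integrable_fourier_mul_schwartz (hi2 j) (V j)
    refine ⟨i1.add (integrable_finsetSum _ fun j _ => i2 j), ?_⟩
    rw [integral_add i1 (integrable_finsetSum _ fun j _ => i2 j),
      integral_finsetSum _ fun j _ => i2 j, TemperedDistribution.fourier_apply, hQ,
      integral_fourier_mul_schwartz hi1, sub_eq_add_neg, ← Finset.sum_neg_distrib]
    congr 1
    refine Finset.sum_congr rfl fun j _ => ?_
    rw [integral_fourier_mul_schwartz (hi2 j), hV2, ← integral_neg]
    refine integral_congr_ae (.of_forall fun x => ?_)
    simp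

end

theorem eLpNorm_invSqrtSymbol_mul_sq_le (ζ : Fin d → ℂ) (F : EuclideanSpace ℝ (Fin d) → ℂ) :
    eLpNorm (fun ξ => invSqrtSymbol ζ ξ * F ξ) 2 volume ^ 2 ≤
      ∫⁻ ξ, ‖F ξ‖ₑ ^ 2 * (ENNReal.ofReal (absSymbol ζ ξ))⁻¹ := by
  rw [eLpNorm_eq_lintegral_rpow_enorm_toReal (by simp) (by simp), ← ENNReal.rpow_natCast,
    ← ENNReal.rpow_mul]
  simp only [ENNReal.toReal_ofNat, ENNReal.rpow_two, Nat.cast_ofNat, one_div]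
  rw [inv_mul_cancel₀ two_ne_zero, ENNReal.rpow_one]
  refine lintegral_mono fun ξ => ?_
  rw [enorm_mul, mul_pow, mul_comm]
  gcongr
  exact enorm_invSqrtSymbol_sq_le ζ ξ

theorem xnorm_neg_le {ζ : Fin d → ℂ} {Q : TemperedDistribution (EuclideanSpace ℝ (Fin d)) ℂ}
    {F : EuclideanSpace ℝ (Fin d) → ℂ} (h : IsFunction (FourierTransform.fourier Q) F) :
    XNorm (-1 / 2) ζ Q ≤ eLpNorm (fun ξ => invSqrtSymbol ζ ξ * F ξ) 2 volume :=
  iInf₂_le _ h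

end Potential

/-! ### Representing test functions by vectors of L². -/

section Test

open scoped LineDeriv ComplexConjugate
variable {d : ℕ}

theorem exists_mulOp {m : EuclideanSpace ℝ (Fin d) → ℂ} (hm : Measurable m) {B : ℝ} (hB : 0 ≤ B)
    (hb : ∀ x, ‖m x‖ ≤ B) : ∃ M : L2Space d →L[ℂ] L2Space d, ‖M‖ ≤ B ∧
      ∀ h, M h =ᵐ[volume] fun x => m x * h x := by
  have hle : ∀ h : L2Space d, eLpNorm (fun x => m x * h x) 2 volume ≤ ENNReal.ofReal (B * ‖h‖) := by
    intro h
    have := eLpNorm_le_mul_eLpNorm_of_ae_le_mul (f := fun x => m x * h x) (g := h) (c := B)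
      (μ := volume) (.of_forall fun x => by rw [norm_mul]; gcongr; exact hb x) 2
    rw [ENNReal.ofReal_mul hB, ofReal_norm, Lp.enorm_def]
    exact this
  have hmem : ∀ h : L2Space d, MemLp (fun x => m x * h x) 2 volume := fun h =>
    ⟨hm.aestronglyMeasurable.mul (Lp.aestronglyMeasurable h), (hle h).trans_lt (by simp)⟩
  refine ⟨LinearMap.mkContinuous
    { toFun := fun h => (hmem h).toLp _
      map_add' := fun h₁ h₂ => ?_
      map_smul' := fun c h => ?_ } B fun h => ?_, ?_, fun h => ?_⟩
  · rw [← MemLp.toLp_add]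
    refine MemLp.toLp_congr _ _ ?_
    filter_upwards [Lp.coeFn_add h₁ h₂] with x hx
    rw [hx, Pi.add_apply, Pi.add_apply]; ring
  · rw [RingHom.id_apply, ← MemLp.toLp_const_smul]
    refine MemLp.toLp_congr _ _ ?_
    filter_upwards [Lp.coeFn_smul c h] with x hx
    rw [hx, Pi.smul_apply, Pi.smul_apply, smul_eq_mul, smul_eq_mul]; ring
  · simp only [LinearMap.coe_mk, AddHom.coe_mk]
    rw [Lp.norm_toLp]
    exact ENNReal.toReal_le_of_le_ofReal (by positivity) (hle h)
  · exact LinearMap.mkContinuous_norm_le _ hB _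
  · exact (hmem h).coeFn_toLp

theorem inner_eq_integral (a b : L2Space d) : inner ℂ a b = ∫ x, conj (a x) * b x := by
  rw [L2.inner_def]
  refine integral_congr_ae (.of_forall fun x => ?_)
  simp [mul_comm]

/-- The support of `f` lies in a fixed ball, where weight^{-2} is bounded. The constant `W` thus
depends only on d and ρ. -/
theorem exists_unweightedMulOp (d : ℕ) (ρ : ℝ) : ∃ W : ℝ, 0 < W ∧
    ∀ (f : EuclideanSpace ℝ (Fin d) → ℝ) (B : ℝ), Measurable f → (∀ x, |f x| ≤ B) →
      (∀ x, ρ < ‖x‖ → f x = 0) → ∃ M : L2Space d →L[ℂ] L2Space d, ‖M‖ ≤ B * W ∧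
        ∀ a b, inner ℂ a (M b) = ∫ x, (f x : ℂ) * (conj (unweight a x) * unweight b x) := by
  obtain ⟨C, hC⟩ := (isCompact_closedBall (0 : EuclideanSpace ℝ (Fin d)) ρ).exists_bound_of_continuousOn
    (continuous_inv_weight (d := d)).continuousOn
  refine ⟨C ^ 2 + 1, by positivity, fun f B hf hB h0 => ?_⟩
  have hB0 : 0 ≤ B := (abs_nonneg _).trans (hB 0)
  obtain ⟨M, hM, hMm⟩ := exists_mulOp (m := fun x => (f x : ℂ) * (weight x : ℂ)⁻¹ ^ 2)
    ((Complex.measurable_ofReal.comp hf).mul ((continuous_inv_weight.pow 2).measurable))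
    (B := B * (C ^ 2 + 1)) (by positivity) (fun x => by
      by_cases hx : ρ < ‖x‖
      · rw [h0 x hx]; simp; positivity
      · have := hC x (by simpa using hx)
        rw [norm_mul, norm_pow]
        have h2 : ‖(weight x : ℂ)⁻¹‖ ^ 2 ≤ C ^ 2 := by gcongr
        have h1 : ‖(f x : ℂ)‖ ≤ B := by simpa using hB x
        gcongr
        linarith)
  refine ⟨M, hM, fun a b => ?_⟩
  rw [inner_eq_integral]
  refine integral_congr_ae ?_
  filter_upwards [hMm b] with x hx
  rw [hx, unweight, unweight, map_mul, map_inv₀, Complex.conj_ofReal]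
  ring

/-- The complex conjugate of a Schwartz function. -/
noncomputable def conjSchwartz (v : SchwartzMap (EuclideanSpace ℝ (Fin d)) ℂ) :
    SchwartzMap (EuclideanSpace ℝ (Fin d)) ℂ :=
  SchwartzMap.postcompCLM ((Complex.conjCLE : ℂ ≃L[ℝ] ℂ) : ℂ →L[ℝ] ℂ) v

theorem conjSchwartz_apply (v : SchwartzMap (EuclideanSpace ℝ (Fin d)) ℂ) (x) :
    conjSchwartz v x = conj (v x) := by
  simp [conjSchwartz]

theorem lineDeriv_conjSchwartz_apply (v : SchwartzMap (EuclideanSpace ℝ (Fin d)) ℂ) (j : Fin d) (x) :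
    (∂_{(EuclideanSpace.single j 1 : EuclideanSpace ℝ (Fin d))} (conjSchwartz v)) x
      = conj (fderiv ℝ v x (EuclideanSpace.single j 1)) := by
  rw [lineDeriv_schwartz_apply]
  have : (conjSchwartz v : EuclideanSpace ℝ (Fin d) → ℂ)
      = ((Complex.conjCLE : ℂ ≃L[ℝ] ℂ) : ℂ →L[ℝ] ℂ) ∘ v := by
    funext x; simp [conjSchwartz_apply]
  rw [this, fderiv_comp x (ContinuousLinearMap.differentiableAt _) v.differentiableAt,
    ContinuousLinearMap.fderiv]
  simp

theorem fourier_conjSchwartz (v : SchwartzMap (EuclideanSpace ℝ (Fin d)) ℂ) (ξ) :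
    (FourierTransform.fourier (conjSchwartz v) : SchwartzMap (EuclideanSpace ℝ (Fin d)) ℂ) ξ
      = conj ((FourierTransformInv.fourierInv v : SchwartzMap (EuclideanSpace ℝ (Fin d)) ℂ) ξ) := by
  rw [SchwartzMap.fourier_coe, SchwartzMap.fourierInv_coe, Real.fourier_eq', Real.fourierInv_eq',
    ← integral_conj]
  refine integral_congr_ae (.of_forall fun x => ?_)
  simp only [conjSchwartz_apply, smul_eq_mul, map_mul, ← Complex.exp_conj, Complex.conj_I,
    Complex.conj_ofReal]
  congr 2
  push_cast
  ring

/-- The symbol in the frequency variable of the Fourier transform `∫ e^{-2πi x·ξ} u(x) dx`. -/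
noncomputable def freqSymbol (ζ : Fin d → ℂ) (ξ : EuclideanSpace ℝ (Fin d)) : ℂ :=
  symbol ζ ((2 * Real.pi) • ξ)

theorem continuous_freqSymbol (ζ : Fin d → ℂ) : Continuous (freqSymbol ζ) :=
  (continuous_symbol ζ).comp (continuous_const_smul _)

theorem norm_freqSymbol (ζ : Fin d → ℂ) (ξ : EuclideanSpace ℝ (Fin d)) :
    ‖freqSymbol ζ ξ‖ = absSymbol ζ ξ := rfl

theorem freqSymbol_eq (ζ : Fin d → ℂ) (ξ : EuclideanSpace ℝ (Fin d)) :
    freqSymbol ζ ξ = ∑ j, ((2 * Real.pi * Complex.I * ξ j) * (2 * Real.pi * Complex.I * ξ j)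
      + 2 * ζ j * (2 * Real.pi * Complex.I * ξ j)) := by
  rw [freqSymbol, symbol, cdot, norm_smul, mul_pow, EuclideanSpace.norm_sq_eq, Finset.sum_add_distrib]
  congr 1
  · push_cast
    rw [Finset.mul_sum, ← Finset.sum_neg_distrib]
    refine Finset.sum_congr rfl fun j _ => ?_
    have hI := Complex.I_sq
    simp only [Real.norm_eq_abs, ← Complex.ofReal_pow, sq_abs]
    push_cast
    linear_combination (-(4 * (Real.pi : ℂ) ^ 2 * (ξ j : ℂ) ^ 2)) * hI
  · rw [Finset.mul_sum]
    refine Finset.sum_congr rfl fun j _ => ?_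
    simp only [PiLp.smul_apply, smul_eq_mul]
    push_cast
    ring

/-- The adjoint of `Δ + 2 ζ · ∇` applied to a Schwartz function. -/
noncomputable def adjointLaplace (ζ : Fin d → ℂ) (v : SchwartzMap (EuclideanSpace ℝ (Fin d)) ℂ) :
    SchwartzMap (EuclideanSpace ℝ (Fin d)) ℂ :=
  ∑ j, (∂_{(EuclideanSpace.single j 1 : EuclideanSpace ℝ (Fin d))}
    (∂_{(EuclideanSpace.single j 1 : EuclideanSpace ℝ (Fin d))} v)
      - (2 * ζ j) • ∂_{(EuclideanSpace.single j 1 : EuclideanSpace ℝ (Fin d))} v)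

/-- The minus sign of the adjoint and the minus sign of the inverse transform of ∂_j cancel, giving
back p_ζ. -/
theorem fourierInv_adjointLaplace (ζ : Fin d → ℂ) (v : SchwartzMap (EuclideanSpace ℝ (Fin d)) ℂ) (ξ) :
    (FourierTransformInv.fourierInv (adjointLaplace ζ v) : SchwartzMap (EuclideanSpace ℝ (Fin d)) ℂ) ξ
      = freqSymbol ζ ξ * (FourierTransformInv.fourierInv v :
        SchwartzMap (EuclideanSpace ℝ (Fin d)) ℂ) ξ := by
  have h := map_sum (FourierTransform.fourierInvCLM ℂ (SchwartzMap (EuclideanSpace ℝ (Fin d)) ℂ))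
    (fun j => (∂_{(EuclideanSpace.single j 1 : EuclideanSpace ℝ (Fin d))}
    (∂_{(EuclideanSpace.single j 1 : EuclideanSpace ℝ (Fin d))} v)
      - (2 * ζ j) • ∂_{(EuclideanSpace.single j 1 : EuclideanSpace ℝ (Fin d))} v)) Finset.univ
  simp only [map_sub, map_smul, FourierTransform.fourierInvCLM_apply] at h
  rw [adjointLaplace, h, sum_apply, freqSymbol_eq, Finset.sum_mul]
  refine Finset.sum_congr rfl fun j _ => ?_
  rw [sub_apply, smul_apply, fourierInv_lineDeriv_apply, fourierInv_lineDeriv_apply, smul_eq_mul]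
  ring

theorem memLp_sqrt_symbol_mul (ζ : Fin d → ℂ) (v : SchwartzMap (EuclideanSpace ℝ (Fin d)) ℂ) :
    MemLp (fun ξ => (√(absSymbol ζ ξ) : ℂ) * conj ((FourierTransformInv.fourierInv v :
      SchwartzMap (EuclideanSpace ℝ (Fin d)) ℂ) ξ)) 2 := by
  set g : SchwartzMap (EuclideanSpace ℝ (Fin d)) ℂ := FourierTransformInv.fourierInv v with hg
  set k : SchwartzMap (EuclideanSpace ℝ (Fin d)) ℂ :=
    FourierTransformInv.fourierInv (adjointLaplace ζ v) with hk
  -- √|p| ≤ 1 + |p|, and |p| times the inverse transform of `v` is the modulus of the inverse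
  -- transform of a Schwartz function.
  have h := (g.memLp 2 (μ := volume)).norm.add (k.memLp 2 (μ := volume)).norm
  refine h.of_le ?_ (.of_forall fun ξ => ?_)
  · have h1 := continuous_absSymbol ζ
    have h2 := g.continuous
    exact Continuous.aestronglyMeasurable (by fun_prop)
  · rw [Pi.add_apply, Real.norm_of_nonneg (by positivity), norm_mul, RCLike.norm_conj,
      Complex.norm_real, Real.norm_of_nonneg (Real.sqrt_nonneg _), hk, fourierInv_adjointLaplace,
      norm_mul, norm_freqSymbol, ← hg]
    have : √(absSymbol ζ ξ) ≤ 1 + absSymbol ζ ξ := by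
      rw [Real.sqrt_le_left (by linarith [absSymbol_nonneg ζ ξ])]
      nlinarith [absSymbol_nonneg ζ ξ]
    nlinarith [norm_nonneg (g ξ)]

/-- The square-integrable function `|p_ζ|^{1/2}` times the conjugate of the inverse Fourier
transform of `v`. -/
noncomputable def testVec (ζ : Fin d → ℂ) (v : SchwartzMap (EuclideanSpace ℝ (Fin d)) ℂ) : L2Space d :=
  (memLp_sqrt_symbol_mul ζ v).toLp _

theorem testVec_ae_eq (ζ : Fin d → ℂ) (v : SchwartzMap (EuclideanSpace ℝ (Fin d)) ℂ) :
    testVec ζ v =ᵐ[volume] fun ξ => (√(absSymbol ζ ξ) : ℂ) * conj ((FourierTransformInv.fourierInv v :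
      SchwartzMap (EuclideanSpace ℝ (Fin d)) ℂ) ξ) :=
  (memLp_sqrt_symbol_mul ζ v).coeFn_toLp

theorem invSqrtSymbol_mul_sqrt {ζ : Fin d → ℂ} {ξ : EuclideanSpace ℝ (Fin d)}
    (h : 0 < absSymbol ζ ξ) : invSqrtSymbol ζ ξ * (√(absSymbol ζ ξ) : ℂ) = 1 := by
  rw [invSqrtSymbol, Real.sqrt_eq_rpow, ← Complex.ofReal_mul, ← Real.rpow_add h]
  norm_num

/-- The half powers of the symbol cancel off a null set. The conjugate compensates for conjugate
linearity of the inner product in its first argument. -/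
theorem IsWeightOp.unweight_testVec {ζ : Fin d → ℂ} (hζ : ∀ᵐ ξ, 0 < absSymbol ζ ξ)
    {E : L2Space d →L[ℂ] L2Space d} (hE : IsWeightOp (invSqrtSymbol ζ) E)
    (v : SchwartzMap (EuclideanSpace ℝ (Fin d)) ℂ) :
    unweight (E (testVec ζ v)) =ᵐ[volume] fun x => conj (v x) := by
  refine (hE.unweight_ae_eq (g := conjSchwartz v) ?_).trans
    (.of_forall fun x => conjSchwartz_apply v x)
  filter_upwards [hζ, testVec_ae_eq ζ v] with ξ h1 h2
  rw [h2, fourier_conjSchwartz, ← mul_assoc, invSqrtSymbol_mul_sqrt h1, one_mul]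

theorem IsWeightOp.unweight_grad_testVec {ζ : Fin d → ℂ} (hζ : ∀ᵐ ξ, 0 < absSymbol ζ ξ) {j : Fin d}
    {D : L2Space d →L[ℂ] L2Space d}
    (hD : IsWeightOp (fun ξ => 2 * Real.pi * Complex.I * ξ j * invSqrtSymbol ζ ξ) D)
    (v : SchwartzMap (EuclideanSpace ℝ (Fin d)) ℂ) :
    unweight (D (testVec ζ v)) =ᵐ[volume]
      fun x => conj (fderiv ℝ v x (EuclideanSpace.single j 1)) := by
  refine (hD.unweight_ae_eq
    (g := ∂_{(EuclideanSpace.single j 1 : EuclideanSpace ℝ (Fin d))} (conjSchwartz v)) ?_).trans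
    (.of_forall fun x => lineDeriv_conjSchwartz_apply v j x)
  filter_upwards [hζ, testVec_ae_eq ζ v] with ξ h1 h2
  rw [h2, fourier_lineDeriv_apply, fourier_conjSchwartz, mul_assoc, ← mul_assoc (invSqrtSymbol ζ ξ),
    invSqrtSymbol_mul_sqrt h1, one_mul]

end Test

/-! ### The bilinear form of the potential as a bounded operator. -/

section Perturbation

open scoped LineDeriv ComplexConjugate InnerProduct
variable {d : ℕ}

theorem integrable_bdd_mul_unweight {f : EuclideanSpace ℝ (Fin d) → ℝ} {B : ℝ} (hf : Measurable f)
    (hB : ∀ x, |f x| ≤ B) (k : L2Space d) (u : SchwartzMap (EuclideanSpace ℝ (Fin d)) ℂ) :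
    Integrable (fun x => (f x : ℂ) * (u x * unweight k x)) := by
  refine (((integrable_unweight_mul k u).congr (.of_forall fun x => mul_comm _ _))).bdd_mul (c := B)
    (Complex.measurable_ofReal.comp hf).aestronglyMeasurable (.of_forall fun x => ?_)
  simpa using hB x

/-- `E` produces ψ with norm O(s^{-1/2}) and `D j` produces ∂_j ψ with norm O(s^{1/2}). Zero-order
forms therefore gain 1/s and first-order ones are merely bounded. -/
theorem exists_weightOps (d : ℕ) : ∃ K : ℝ, 0 < K ∧ ∀ (ζ : Fin d → ℂ) (s : ℝ)
    (e b : EuclideanSpace ℝ (Fin d)), IsNull ζ s e b → 13 ≤ s →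
      (∃ A, IsWeight (invSqrtSymbol ζ) A) ∧ ∃ (E : L2Space d →L[ℂ] L2Space d)
        (D : Fin d → L2Space d →L[ℂ] L2Space d), IsWeightOp (invSqrtSymbol ζ) E ∧
        (∀ j, IsWeightOp (fun ξ => 2 * Real.pi * Complex.I * ξ j * invSqrtSymbol ζ ξ) (D j)) ∧
        ‖E‖ * ‖E‖ ≤ K / s ∧ ∀ j, ‖D j‖ * ‖E‖ ≤ K := by
  obtain ⟨C₁, hC₁, h₁⟩ := exists_isWeightOp d
  obtain ⟨C₂, hC₂, h₂⟩ := exists_isWeight_invSqrtSymbol d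
  refine ⟨C₁ ^ 2 * C₂, by positivity, fun ζ s e b hζ hs => ?_⟩
  have hs0 : 0 < s := by linarith
  obtain ⟨hw, hwj⟩ := h₂ ζ s e b hζ hs
  obtain ⟨E, hEn, hE⟩ := h₁ _ _ hw
  choose D hDn hD using fun j => h₁ _ _ (hwj j)
  refine ⟨⟨_, hw⟩, E, D, hE, hD, ?_, fun j => ?_⟩
  · calc ‖E‖ * ‖E‖ ≤ (C₁ * √(C₂ / s)) * (C₁ * √(C₂ / s)) := by gcongr
      _ = C₁ ^ 2 * (√(C₂ / s) * √(C₂ / s)) := by ring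
      _ = C₁ ^ 2 * C₂ / s := by rw [Real.mul_self_sqrt (by positivity)]; ring
  · calc ‖D j‖ * ‖E‖ ≤ (C₁ * √(C₂ * s)) * (C₁ * √(C₂ / s)) := by gcongr; exact hDn j
      _ = C₁ ^ 2 * (√(C₂ * s) * √(C₂ / s)) := by ring
      _ = C₁ ^ 2 * C₂ := by
        rw [← Real.sqrt_mul (by positivity), show C₂ * s * (C₂ / s) = C₂ * C₂ by field_simp,
          Real.sqrt_mul_self hC₂.le]

/-- A decomposition of the vector field `f`, supported in the ball of radius `ρ`, into a part bounded
by `B₁` and a smooth part with divergence bounded by `B₂`. -/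
structure IsSplitting (ρ B₀ B₁ B₂ : ℝ) (f f₁ f₂ : Fin d → EuclideanSpace ℝ (Fin d) → ℝ) : Prop where
  measurable : ∀ j, Measurable (f₁ j)
  contDiff : ∀ j, ContDiff ℝ ∞ (f₂ j)
  eq_add : ∀ j x, f j x = f₁ j x + f₂ j x
  zero_left : ∀ j x, ρ < ‖x‖ → f₁ j x = 0
  zero_right : ∀ j x, ρ < ‖x‖ → f₂ j x = 0
  bound_sq : ∀ x, ∑ j, f j x ^ 2 ≤ B₀
  bound_left : ∀ j x, |f₁ j x| ≤ B₁
  bound_div : ∀ x, |∑ j, fderiv ℝ (f₂ j) x (EuclideanSpace.single j 1)| ≤ B₂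

section
variable {ρ B₀ B₁ B₂ : ℝ} {f f₁ f₂ : Fin d → EuclideanSpace ℝ (Fin d) → ℝ}

theorem IsSplitting.hasCompactSupport (hf : IsSplitting ρ B₀ B₁ B₂ f f₁ f₂) (j : Fin d) :
    HasCompactSupport (f₂ j) :=
  HasCompactSupport.intro (isCompact_closedBall 0 ρ) fun x hx => hf.zero_right j x (by simpa using hx)

theorem IsSplitting.measurable_right (hf : IsSplitting ρ B₀ B₁ B₂ f f₁ f₂) (j : Fin d) :
    Measurable (f₂ j) := (hf.contDiff j).continuous.measurable

theorem IsSplitting.exists_bound_right (hf : IsSplitting ρ B₀ B₁ B₂ f f₁ f₂) (j : Fin d) :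
    ∃ B, ∀ x, |f₂ j x| ≤ B := by
  simpa using (hf.contDiff j).continuous.bounded_above_of_compact_support (hf.hasCompactSupport j)

theorem IsSplitting.fderiv_eq_zero (hf : IsSplitting ρ B₀ B₁ B₂ f f₁ f₂) (j : Fin d)
    {x : EuclideanSpace ℝ (Fin d)} (hx : ρ < ‖x‖) : fderiv ℝ (f₂ j) x = 0 := by
  have : f₂ j =ᶠ[𝓝 x] fun _ => 0 := by
    filter_upwards [(isOpen_lt continuous_const continuous_norm).mem_nhds hx] with y hy
    exact hf.zero_right j y hy
  rw [this.fderiv_eq]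
  simp

theorem IsSplitting.continuous_div (hf : IsSplitting ρ B₀ B₁ B₂ f f₁ f₂) :
    Continuous fun x => ∑ j, fderiv ℝ (f₂ j) x (EuclideanSpace.single j 1) :=
  continuous_finsetSum _ fun j _ => ((hf.contDiff j).continuous_fderiv (by simp)).clm_apply continuous_const

/-- The weak gradient of ψ tested against f₂ v. This trades the first-order term with f₂ for a
zero-order term with div f₂. -/
theorem IsSplitting.integral_div (hf : IsSplitting ρ B₀ B₁ B₂ f f₁ f₂) {E : L2Space d →L[ℂ] L2Space d}
    {D : Fin d → L2Space d →L[ℂ] L2Space d} {h : L2Space d}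
    (hG : HasWeakGrad (unweight (E h)) (unweightGrad D h))
    (v : SchwartzMap (EuclideanSpace ℝ (Fin d)) ℂ) :
    ∫ x, ((∑ j, fderiv ℝ (f₂ j) x (EuclideanSpace.single j 1) : ℝ) : ℂ) * (v x * unweight (E h) x) =
      -∑ j, ((∫ x, (f₂ j x : ℂ) * (fderiv ℝ v x (EuclideanSpace.single j 1) * unweight (E h) x))
        + ∫ x, (f₂ j x : ℂ) * (v x * unweight (D j h) x)) := by
  have hb : ∀ j, ∃ B, ∀ x, |fderiv ℝ (f₂ j) x (EuclideanSpace.single j 1)| ≤ B := fun j => by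
    have hc : Continuous fun x => fderiv ℝ (f₂ j) x (EuclideanSpace.single j 1) :=
      ((hf.contDiff j).continuous_fderiv (by simp)).clm_apply continuous_const
    simpa using hc.bounded_above_of_compact_support
      (HasCompactSupport.intro (isCompact_closedBall 0 ρ) fun x hx => by
        rw [hf.fderiv_eq_zero j (by simpa using hx)]; simp)
  have hm : ∀ j, Measurable fun x => fderiv ℝ (f₂ j) x (EuclideanSpace.single j 1) := fun j =>
    (((hf.contDiff j).continuous_fderiv (by simp)).clm_apply continuous_const).measurable
  have i1 : ∀ j, Integrable fun x => ((fderiv ℝ (f₂ j) x (EuclideanSpace.single j 1) : ℝ) : ℂ)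
      * (v x * unweight (E h) x) := fun j => by
    obtain ⟨B, hB⟩ := hb j
    exact integrable_bdd_mul_unweight (hm j) hB _ v
  have i2 : ∀ j, Integrable fun x => (f₂ j x : ℂ) *
      (fderiv ℝ v x (EuclideanSpace.single j 1) * unweight (E h) x) := fun j => by
    obtain ⟨B, hB⟩ := hf.exists_bound_right j
    have := integrable_bdd_mul_unweight (hf.measurable_right j) hB (E h)
      (∂_{(EuclideanSpace.single j 1 : EuclideanSpace ℝ (Fin d))} v)
    simpa only [lineDeriv_schwartz_apply] using this
  have key : ∀ j, ∫ x, ((fderiv ℝ (f₂ j) x (EuclideanSpace.single j 1) : ℝ) : ℂ)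
      * (v x * unweight (E h) x) =
      -((∫ x, (f₂ j x : ℂ) * (fderiv ℝ v x (EuclideanSpace.single j 1) * unweight (E h) x))
        + ∫ x, (f₂ j x : ℂ) * (v x * unweight (D j h) x)) := by
    intro j
    have hs : ContDiff ℝ ∞ fun x => (f₂ j x : ℂ) * v x :=
      (Complex.ofRealCLM.contDiff.comp (hf.contDiff j)).mul (v.smooth ⊤)
    have hc : HasCompactSupport fun x => (f₂ j x : ℂ) * v x :=
      ((hf.hasCompactSupport j).comp_left (g := Complex.ofReal) rfl).mul_right
    have h1 := hG.2.2 j _ hs hc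
    have hd : ∀ x, fderiv ℝ (fun x => (f₂ j x : ℂ) * v x) x (EuclideanSpace.single j 1)
        = ((fderiv ℝ (f₂ j) x (EuclideanSpace.single j 1) : ℝ) : ℂ) * v x
          + f₂ j x * fderiv ℝ v x (EuclideanSpace.single j 1) := by
      intro x
      have hf2 : HasFDerivAt (fun x => (f₂ j x : ℂ)) (Complex.ofRealCLM.comp (fderiv ℝ (f₂ j) x)) x :=
        Complex.ofRealCLM.hasFDerivAt.comp x
          ((hf.contDiff j).differentiable (by simp) x).hasFDerivAt
      have := (hf2.mul v.differentiableAt.hasFDerivAt).fderiv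
      change fderiv ℝ ((fun x => (f₂ j x : ℂ)) * (v : EuclideanSpace ℝ (Fin d) → ℂ)) x _ = _
      rw [this]
      simp
      ring
    have e1 : ∫ x, unweight (E h) x *
        fderiv ℝ (fun x => (f₂ j x : ℂ) * v x) x (EuclideanSpace.single j 1)
        = (∫ x, ((fderiv ℝ (f₂ j) x (EuclideanSpace.single j 1) : ℝ) : ℂ)
          * (v x * unweight (E h) x)) + ∫ x, (f₂ j x : ℂ) *
            (fderiv ℝ v x (EuclideanSpace.single j 1) * unweight (E h) x) := by
      rw [← integral_add (i1 j) (i2 j)]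
      refine integral_congr_ae (.of_forall fun x => ?_)
      simp only [hd]; ring
    have e2 : ∫ x, unweightGrad D h x j * ((f₂ j x : ℂ) * v x)
        = ∫ x, (f₂ j x : ℂ) * (v x * unweight (D j h) x) := by
      refine integral_congr_ae (.of_forall fun x => ?_)
      simp only [unweightGrad]; ring
    rw [e1, e2] at h1
    rw [eq_neg_iff_add_eq_zero]
    linear_combination h1
  rw [← Finset.sum_neg_distrib, ← Finset.sum_congr rfl fun j _ => key j,
    ← integral_finsetSum _ fun j _ => i1 j]
  refine integral_congr_ae (.of_forall fun x => ?_)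
  simp only [Complex.ofReal_sum, Finset.sum_mul]

/-- The form ∫ |f|² vψ - f·∇(vψ) is rewritten as ∫ (|f|² + div f₂) vψ - f₁·∇(vψ). Only the part f₁,
bounded by B₁, meets a derivative. -/
theorem IsSplitting.exists_perturbation (d : ℕ) (ρ : ℝ) : ∃ W : ℝ, 0 < W ∧
    ∀ (B₀ B₁ B₂ : ℝ) (f f₁ f₂ : Fin d → EuclideanSpace ℝ (Fin d) → ℝ),
      IsSplitting ρ B₀ B₁ B₂ f f₁ f₂ →
      ∀ (ζ : Fin d → ℂ) (E : L2Space d →L[ℂ] L2Space d) (D : Fin d → L2Space d →L[ℂ] L2Space d),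
        (∀ᵐ ξ, 0 < absSymbol ζ ξ) → IsWeightOp (invSqrtSymbol ζ) E →
        (∀ j, IsWeightOp (fun ξ => 2 * Real.pi * Complex.I * ξ j * invSqrtSymbol ζ ξ) (D j)) →
        ∃ A : L2Space d →L[ℂ] L2Space d,
          ‖A‖ ≤ W * ((B₀ + B₂) * (‖E‖ * ‖E‖) + ∑ j, 2 * B₁ * (‖D j‖ * ‖E‖)) ∧
          ∀ h v, inner ℂ (testVec ζ v) (A h) = ∫ x, ∑ j, ((f j x : ℂ) ^ 2 * (v x * unweight (E h) x)
            - (f j x : ℂ) * (v x * unweight (D j h) x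
              + fderiv ℝ v x (EuclideanSpace.single j 1) * unweight (E h) x)) := by
  obtain ⟨W, hW, hM⟩ := exists_unweightedMulOp d ρ
  refine ⟨W, hW, fun B₀ B₁ B₂ f f₁ f₂ hf ζ E D hζ hE hD => ?_⟩
  have hfm : ∀ j, Measurable (f j) := fun j => by
    rw [show f j = fun x => f₁ j x + f₂ j x from funext (hf.eq_add j)]
    exact (hf.measurable j).add (hf.measurable_right j)
  have hf0 : ∀ j x, ρ < ‖x‖ → f j x = 0 := fun j x hx => by
    rw [hf.eq_add, hf.zero_left j x hx, hf.zero_right j x hx, add_zero]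
  have hsqm : Measurable fun x => ∑ j, f j x ^ 2 := by fun_prop
  have hsqb : ∀ x, |∑ j, f j x ^ 2| ≤ B₀ := fun x => by
    rw [abs_of_nonneg (by positivity)]; exact hf.bound_sq x
  obtain ⟨M₀, hM₀, hM₀i⟩ := hM (fun x => ∑ j, f j x ^ 2) B₀ hsqm hsqb
    (fun x hx => by simp [hf0 _ x hx])
  obtain ⟨N, hN, hNi⟩ := hM _ B₂ hf.continuous_div.measurable hf.bound_div
    (fun x hx => by simp [hf.fderiv_eq_zero _ hx])
  choose M hMn hMi using fun j => hM (f₁ j) B₁ (hf.measurable j) (hf.bound_left j) (hf.zero_left j)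
  -- `M₀`, `N` and `M j` multiply by |f|², div f₂ and f₁ respectively; adjoints move `E` and `D j`
  -- onto the test vector. The two terms per j are the two ways the derivative falls on vψ.
  refine ⟨(E† ∘L M₀ ∘L E) + (E† ∘L N ∘L E) - ∑ j, ((D j)† ∘L M j ∘L E + E† ∘L M j ∘L D j), ?_,
    fun h v => ?_⟩
  · have hcomp : ∀ (P Q R : L2Space d →L[ℂ] L2Space d), ‖P† ∘L Q ∘L R‖ ≤ ‖P‖ * (‖Q‖ * ‖R‖) := by
      intro P Q R
      refine (ContinuousLinearMap.opNorm_comp_le _ _).trans ?_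
      rw [LinearIsometryEquiv.norm_map]
      gcongr
      exact ContinuousLinearMap.opNorm_comp_le _ _
    refine (norm_sub_le _ _).trans ?_
    have h1 : ‖(E† ∘L M₀ ∘L E) + (E† ∘L N ∘L E)‖ ≤ W * ((B₀ + B₂) * (‖E‖ * ‖E‖)) := by
      refine (norm_add_le _ _).trans ((add_le_add (hcomp _ _ _) (hcomp _ _ _)).trans ?_)
      calc _ ≤ ‖E‖ * ((B₀ * W) * ‖E‖) + ‖E‖ * ((B₂ * W) * ‖E‖) := by gcongr
        _ = _ := by ring
    have h2 : ‖∑ j, ((D j)† ∘L M j ∘L E + E† ∘L M j ∘L D j)‖ ≤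
        W * ∑ j, 2 * B₁ * (‖D j‖ * ‖E‖) := by
      rw [Finset.mul_sum]
      refine norm_sum_le_of_le _ fun j _ => ?_
      refine (norm_add_le _ _).trans ((add_le_add (hcomp _ _ _) (hcomp _ _ _)).trans ?_)
      have := hMn j
      calc _ ≤ ‖D j‖ * ((B₁ * W) * ‖E‖) + ‖E‖ * ((B₁ * W) * ‖D j‖) := by gcongr
        _ = _ := by ring
    linarith
  · have hEv := hE.unweight_testVec hζ v
    have hDv := fun j => (hD j).unweight_grad_testVec hζ v
    have e1 : ∀ (g : EuclideanSpace ℝ (Fin d) → ℝ) (k : L2Space d),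
        ∫ x, (g x : ℂ) * (conj (unweight (E (testVec ζ v)) x) * unweight k x)
          = ∫ x, (g x : ℂ) * (v x * unweight k x) := fun g k => by
      refine integral_congr_ae ?_
      filter_upwards [hEv] with x hx
      rw [hx, Complex.conj_conj]
    have e2 : ∀ (j) (g : EuclideanSpace ℝ (Fin d) → ℝ) (k : L2Space d),
        ∫ x, (g x : ℂ) * (conj (unweight (D j (testVec ζ v)) x) * unweight k x)
          = ∫ x, (g x : ℂ) * (fderiv ℝ v x (EuclideanSpace.single j 1) * unweight k x) :=
      fun j g k => by
        refine integral_congr_ae ?_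
        filter_upwards [hDv j] with x hx
        rw [hx, Complex.conj_conj]
    have hsum : inner ℂ (testVec ζ v) (((E† ∘L M₀ ∘L E) + (E† ∘L N ∘L E)
        - ∑ j, ((D j)† ∘L M j ∘L E + E† ∘L M j ∘L D j)) h)
        = inner ℂ (E (testVec ζ v)) (M₀ (E h)) + inner ℂ (E (testVec ζ v)) (N (E h))
          - ∑ j, (inner ℂ (D j (testVec ζ v)) (M j (E h))
            + inner ℂ (E (testVec ζ v)) (M j (D j h))) := by
      simp only [sub_apply, add_apply, sum_apply, ContinuousLinearMap.comp_apply, inner_sub_right,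
        inner_add_right, inner_sum, ContinuousLinearMap.adjoint_inner_right]
    rw [hsum]
    simp only [hM₀i, hNi, hMi, e1, e2]
    rw [hf.integral_div (hE.hasWeakGrad hD h) v]
    have j0 : ∀ g : EuclideanSpace ℝ (Fin d) → ℝ, Measurable g → (∃ B, ∀ x, |g x| ≤ B) → ∀ k : L2Space d,
        Integrable (fun x => (g x : ℂ) * (v x * unweight k x)) := fun g hg ⟨B, hB⟩ k =>
      integrable_bdd_mul_unweight hg hB k v
    have j1 : ∀ g : EuclideanSpace ℝ (Fin d) → ℝ, Measurable g → (∃ B, ∀ x, |g x| ≤ B) → ∀ j,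
        Integrable (fun x => (g x : ℂ) *
          (fderiv ℝ v x (EuclideanSpace.single j 1) * unweight (E h) x)) := fun g hg ⟨B, hB⟩ j => by
      have := integrable_bdd_mul_unweight hg hB (E h)
        (∂_{(EuclideanSpace.single j 1 : EuclideanSpace ℝ (Fin d))} v)
      simpa only [lineDeriv_schwartz_apply] using this
    have b1 : ∀ j, ∃ B, ∀ x, |f₁ j x| ≤ B := fun j => ⟨B₁, hf.bound_left j⟩
    have b2 := hf.exists_bound_right
    have m1 := hf.measurable
    have m2 := hf.measurable_right
    rw [add_sub_assoc, ← Finset.sum_neg_distrib, ← Finset.sum_sub_distrib]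
    have e3 : ∀ j, (-((∫ x, (f₂ j x : ℂ) * (fderiv ℝ v x (EuclideanSpace.single j 1) * unweight (E h) x))
        + ∫ x, (f₂ j x : ℂ) * (v x * unweight (D j h) x))
        - ((∫ x, (f₁ j x : ℂ) * (fderiv ℝ v x (EuclideanSpace.single j 1) * unweight (E h) x))
        + ∫ x, (f₁ j x : ℂ) * (v x * unweight (D j h) x))) =
        ∫ x, -((f j x : ℂ) * (v x * unweight (D j h) x
              + fderiv ℝ v x (EuclideanSpace.single j 1) * unweight (E h) x)) := by
      intro j
      have q2 := ((j1 _ (m2 j) (b2 j) j).fun_add (j0 _ (m2 j) (b2 j) (D j h))).fun_neg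
      have q1 := (j1 _ (m1 j) (b1 j) j).fun_add (j0 _ (m1 j) (b1 j) (D j h))
      rw [← integral_add (j1 _ (m2 j) (b2 j) j) (j0 _ (m2 j) (b2 j) _), ← integral_neg,
        ← integral_add (j1 _ (m1 j) (b1 j) j) (j0 _ (m1 j) (b1 j) _), ← integral_sub q2 q1]
      refine integral_congr_ae (.of_forall fun x => ?_)
      simp only [hf.eq_add, Complex.ofReal_add]
      ring
    have j3 : ∀ j, Integrable fun x => -((f j x : ℂ) * (v x * unweight (D j h) x
              + fderiv ℝ v x (EuclideanSpace.single j 1) * unweight (E h) x)) := fun j => by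
      refine (((j1 _ (m2 j) (b2 j) j).add (j0 _ (m2 j) (b2 j) (D j h))).add
        ((j1 _ (m1 j) (b1 j) j).add (j0 _ (m1 j) (b1 j) (D j h)))).neg.congr (.of_forall fun x => ?_)
      simp only [hf.eq_add, Complex.ofReal_add, Pi.add_apply, Pi.neg_apply]
      ring
    simp_rw [e3]
    rw [← integral_finsetSum _ fun j _ => j3 j, ← integral_add (j0 _ hsqm ⟨_, hsqb⟩ _)
      (integrable_finsetSum _ fun j _ => j3 j)]
    refine integral_congr_ae (.of_forall fun x => ?_)
    simp only [Complex.ofReal_sum, Complex.ofReal_pow, Finset.sum_mul, ← Finset.sum_add_distrib,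
      sub_eq_add_neg]
end

end Perturbation

/-! ### The fixed-point equation and the splitting of f. -/

section Splitting

open scoped ComplexConjugate
variable {d : ℕ}

/-- Cancelling |p|^{1/2}, the equation reads h = U(A h + q) with U multiplication by conj(p)/|p|, a
contraction. Since ‖U A‖ < 1 the operator 1 - U A is invertible, and ‖h‖ ≤ ‖q‖ + ‖h‖/2. -/
theorem exists_solution {ζ : Fin d → ℂ} (hζ : ∀ᵐ ξ, 0 < absSymbol ζ ξ)
    {A : L2Space d →L[ℂ] L2Space d} (hA : ‖A‖ ≤ 1 / 2) (q : L2Space d) :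
    ∃ h : L2Space d, ‖h‖ ≤ 2 * ‖q‖ ∧ ∀ v, inner ℂ (testVec ζ v) (A h) + inner ℂ (testVec ζ v) q =
      ∫ ξ, invSqrtSymbol ζ ξ * h ξ * (freqSymbol ζ ξ * (FourierTransformInv.fourierInv v :
        SchwartzMap (EuclideanSpace ℝ (Fin d)) ℂ) ξ) := by
  have hm : Measurable fun ξ => freqSymbol ζ ξ * ((absSymbol ζ ξ)⁻¹ : ℝ) :=
    (continuous_freqSymbol ζ).measurable.mul
      (Complex.measurable_ofReal.comp (continuous_absSymbol ζ).measurable.inv)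
  have hb : ∀ ξ, ‖freqSymbol ζ ξ * ((absSymbol ζ ξ)⁻¹ : ℝ)‖ ≤ 1 := fun ξ => by
    rw [norm_mul, norm_freqSymbol, Complex.norm_real, norm_inv,
      Real.norm_of_nonneg (absSymbol_nonneg ζ ξ)]
    exact mul_inv_le_one
  obtain ⟨U, hU, hUm⟩ := exists_mulOp (Complex.continuous_conj.measurable.comp hm) zero_le_one
    (fun ξ => by simpa using hb ξ)
  have hUA : ‖U ∘L A‖ < 1 := by
    refine lt_of_le_of_lt (ContinuousLinearMap.opNorm_comp_le _ _) ?_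
    nlinarith [norm_nonneg U, norm_nonneg A]
  have hu := isUnit_one_sub_of_norm_lt_one hUA
  obtain ⟨u, hu⟩ := hu
  set h : L2Space d := (↑u⁻¹ : L2Space d →L[ℂ] L2Space d) (U q) with hh
  have heq : h - U (A h) = U q := by
    have h1 : ((u : L2Space d →L[ℂ] L2Space d) * ↑u⁻¹) (U q) = U q := by
      rw [Units.mul_inv]; rfl
    rw [hu] at h1
    exact h1
  have hle : ∀ k, ‖U k‖ ≤ ‖k‖ := fun k =>
    (U.le_opNorm k).trans (mul_le_of_le_one_left (norm_nonneg _) hU)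
  have hAh : ‖A h‖ ≤ 1 / 2 * ‖h‖ := (A.le_opNorm h).trans (by gcongr)
  refine ⟨h, ?_, fun v => ?_⟩
  · have h1 : ‖h‖ ≤ ‖U q‖ + ‖U (A h)‖ := by
      rw [← heq]; simpa using norm_add_le (h - U (A h)) (U (A h))
    linarith [hle q, hle (A h)]
  · rw [← inner_add_right, inner_eq_integral]
    have heq' : h = U (A h + q) := by rw [map_add, ← heq]; abel
    refine integral_congr_ae ?_
    filter_upwards [hζ, testVec_ae_eq ζ v, hUm (A h + q)] with ξ h1 h2 h3
    rw [← heq'] at h3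
    rw [h2, h3]
    simp only [map_mul, Complex.conj_ofReal, Complex.conj_conj, Function.comp]
    have e1 := invSqrtSymbol_mul_sqrt h1
    have e2 : freqSymbol ζ ξ * conj (freqSymbol ζ ξ) = (absSymbol ζ ξ : ℂ) * absSymbol ζ ξ := by
      rw [Complex.mul_conj, Complex.normSq_eq_norm_sq, norm_freqSymbol]; push_cast; ring
    have e3 : (absSymbol ζ ξ : ℂ) = (√(absSymbol ζ ξ) : ℂ) * (√(absSymbol ζ ξ) : ℂ) := by
      rw [← Complex.ofReal_mul, Real.mul_self_sqrt h1.le]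
    have e4 : (absSymbol ζ ξ : ℂ) ≠ 0 := by exact_mod_cast h1.ne'
    have e5 : invSqrtSymbol ζ ξ * absSymbol ζ ξ = √(absSymbol ζ ξ) := by
      rw [e3, ← mul_assoc, e1, one_mul]
    have e6 : ∀ k g : ℂ, invSqrtSymbol ζ ξ * (conj (freqSymbol ζ ξ) * ((absSymbol ζ ξ)⁻¹ : ℝ) * k) *
        (freqSymbol ζ ξ * g) = √(absSymbol ζ ξ) * g * k := fun k g => by
      calc _ = invSqrtSymbol ζ ξ * (freqSymbol ζ ξ * conj (freqSymbol ζ ξ)) *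
            (absSymbol ζ ξ : ℂ)⁻¹ * g * k := by push_cast; ring
        _ = invSqrtSymbol ζ ξ * absSymbol ζ ξ * g * k := by rw [e2]; field_simp
        _ = _ := by rw [e5]
    exact (e6 _ _).symm

variable {γ : EuclideanSpace ℝ (Fin d) → ℝ} {ρ : ℝ} {f : Fin d → EuclideanSpace ℝ (Fin d) → ℝ}

/-- No smooth part is needed. The bound holds only almost everywhere, so f is set to zero on the
exceptional null set to make it hold everywhere. -/
theorem IsLogGradient.exists_splitting_of_le (hf : IsLogGradient γ ρ f) {ε : ℝ} (hε : 0 ≤ ε)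
    (h : gradLogNorm γ ≤ ENNReal.ofReal ε) : ∃ B₀ f',
      (∀ᵐ x, ∀ j, f' j x = f j x) ∧ IsSplitting (ρ + 2) B₀ ε 0 f' f' 0 := by
  have hae : ∀ᵐ x, ∀ j, |f j x| ≤ ε := by
    have h1 := ae_le_eLpNormEssSup (f := weakGrad (fun x => (Real.log (γ x) : ℂ))) (μ := volume)
    filter_upwards [h1, hf.log_eq] with x hx1 hx2 j
    rw [gradLogNorm, eLpNorm_exponent_top] at h
    have h2 := hx1.trans h
    rw [← ofReal_norm, ENNReal.ofReal_le_ofReal_iff hε] at h2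
    have h3 := (PiLp.norm_apply_le (weakGrad (fun x => (Real.log (γ x) : ℂ)) x) j).trans h2
    rw [hx2 j, norm_mul, Complex.norm_real, Complex.norm_ofNat, Real.norm_eq_abs] at h3
    linarith [abs_nonneg (f j x)]
  refine ⟨∑ _j : Fin d, ε ^ 2, fun j => {x | |f j x| ≤ ε}.indicator (f j), ?_, ?_⟩
  · filter_upwards [hae] with x hx j
    have hm : x ∈ {x | |f j x| ≤ ε} := hx j
    exact Set.indicator_of_mem hm (f j)
  have hb : ∀ j x, |{x | |f j x| ≤ ε}.indicator (f j) x| ≤ ε := fun j x => by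
    by_cases hx : |f j x| ≤ ε
    · rw [Set.indicator_of_mem (by exact hx)]; exact hx
    · rw [Set.indicator_of_notMem (by exact hx)]; simpa
  refine ⟨fun j => (hf.measurable j).indicator (measurableSet_le (hf.measurable j).abs measurable_const),
    fun j => contDiff_zero_fun, fun j x => by simp, fun j x hx => ?_, fun j x hx => rfl, fun x => ?_,
    hb, fun x => ?_⟩
  · by_cases hx' : |f j x| ≤ ε
    · rw [Set.indicator_of_mem (by exact hx'), hf.eq_zero j x (by linarith)]
    · rw [Set.indicator_of_notMem (by exact hx')]
  · refine Finset.sum_le_sum fun j _ => ?_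
    rw [← sq_abs]
    gcongr
    exact hb j x
  · simp

/-- A continuous compactly supported field is uniformly continuous, so a fine mollification is
uniformly within ε. The bump radius is at most 2, hence the enlarged support ρ + 2. -/
theorem IsLogGradient.exists_splitting_of_continuous (hf : IsLogGradient γ ρ f)
    (hc : ∀ j, Continuous (f j)) {ε : ℝ} (hε : 0 < ε) : ∃ B₀ B₂ f₁ f₂,
      IsSplitting (ρ + 2) B₀ ε B₂ f f₁ f₂ := by
  obtain ⟨B, hB⟩ := hf.bounded
  have hcs : ∀ j, HasCompactSupport (f j) := fun j =>
    HasCompactSupport.intro (isCompact_closedBall 0 ρ) fun x hx => hf.eq_zero j x (by simpa using hx)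
  have hn : ∀ j, ∃ n, ∀ x, |f j x - mollify n (f j) x| ≤ ε := by
    intro j
    have hu := (hcs j).uniformContinuous_of_continuous (hc j)
    obtain ⟨δ, hδ, h⟩ := Metric.uniformContinuous_iff.1 hu ε hε
    obtain ⟨n, hn⟩ := ((tendsto_rOut_bump d).eventually (gt_mem_nhds hδ)).exists
    refine ⟨n, fun x => ?_⟩
    rw [mollify_eq_convolution_left, ← Real.dist_eq, dist_comm]
    refine ContDiffBump.dist_normed_convolution_le (hc j).aestronglyMeasurable fun y hy => ?_
    exact (h (lt_trans (by simpa using hy) hn)).le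
  choose n hn using hn
  have hzero : ∀ j x, ρ + 2 < ‖x‖ → mollify (n j) (f j) x = 0 := by
    intro j x hx
    rw [mollify]
    refine integral_eq_zero_of_ae (.of_forall fun y => ?_)
    by_cases hy : ρ < ‖y‖
    · simp [hf.eq_zero j y hy]
    · have h1 : x - y ∉ Function.support ((bump d (n j)).normed volume) := by
        rw [ContDiffBump.support_normed_eq, mem_ball_zero_iff, not_lt]
        have h2 : (bump d (n j)).rOut ≤ 2 := by
          simp only [bump]
          exact div_le_self zero_le_two (by linarith [(n j).cast_nonneg (α := ℝ)])
        have h3 := norm_sub_norm_le x y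
        linarith
      rw [Function.notMem_support] at h1
      simp [mollifier, h1]
  have hcd : ∀ j, ContDiff ℝ ∞ (mollify (n j) (f j)) := fun j =>
    contDiff_mollify (n j) (hc j).locallyIntegrable
  have hdc : Continuous fun x => ∑ j, fderiv ℝ (mollify (n j) (f j)) x (EuclideanSpace.single j 1) :=
    continuous_finsetSum _ fun j _ => ((hcd j).continuous_fderiv (by simp)).clm_apply continuous_const
  obtain ⟨B₂, hB₂⟩ := hdc.bounded_above_of_compact_support
    (HasCompactSupport.intro (isCompact_closedBall 0 (ρ + 2)) fun x hx => by
      refine Finset.sum_eq_zero fun j _ => ?_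
      have : mollify (n j) (f j) =ᶠ[𝓝 x] fun _ => 0 := by
        filter_upwards [(isOpen_lt continuous_const continuous_norm).mem_nhds
          (show ρ + 2 < ‖x‖ by simpa using hx)] with y hy
        exact hzero j y hy
      rw [this.fderiv_eq]
      simp)
  refine ⟨∑ _j : Fin d, B ^ 2, B₂, fun j x => f j x - mollify (n j) (f j) x,
    fun j => mollify (n j) (f j), fun j => ((hc j).sub (hcd j).continuous).measurable, hcd,
    fun j x => by ring, fun j x hx => ?_, hzero, fun x => ?_, hn, fun x => by simpa using hB₂ x⟩
  · rw [hzero j x hx, hf.eq_zero j x (by linarith), sub_zero]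
  · refine Finset.sum_le_sum fun j _ => ?_
    rw [← sq_abs]
    have := hB j x
    gcongr

theorem IsLogGradient.exists_splitting (hf : IsLogGradient γ ρ f) {ε : ℝ} (hε : 0 < ε)
    (h : gradLogNorm γ ≤ ENNReal.ofReal ε ∨ IsC1 γ) : ∃ B₀ B₂ f' f₁ f₂,
      (∀ᵐ x, ∀ j, f' j x = f j x) ∧ IsSplitting (ρ + 2) B₀ ε B₂ f' f₁ f₂ := by
  rcases h with h | h
  · obtain ⟨B₀, f', h1, h2⟩ := hf.exists_splitting_of_le hε.le h
    exact ⟨B₀, 0, f', f', 0, h1, h2⟩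
  · obtain ⟨B₀, B₂, f₁, f₂, h2⟩ := hf.exists_splitting_of_continuous (hf.continuous h) hε
    exact ⟨B₀, B₂, f, f₁, f₂, .of_forall fun _ _ => rfl, h2⟩

end Splitting

/-! ### Conjugation by the exponential and the weak equation. -/

section Solution

open scoped LineDeriv
variable {d : ℕ}

/-- The exponential `e^{x·ζ}`. -/
noncomputable def expCdot (ζ : Fin d → ℂ) (x : EuclideanSpace ℝ (Fin d)) : ℂ :=
  Complex.exp (cdot x ζ)

theorem contDiff_cdot (ζ : Fin d → ℂ) :
    ContDiff ℝ ∞ fun x : EuclideanSpace ℝ (Fin d) => cdot x ζ := by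
  unfold cdot
  refine ContDiff.sum fun j _ => ContDiff.mul ?_ contDiff_const
  exact Complex.ofRealCLM.contDiff.comp (EuclideanSpace.proj (𝕜 := ℝ) j).contDiff

theorem contDiff_expCdot (ζ : Fin d → ℂ) : ContDiff ℝ ∞ (expCdot ζ) := (contDiff_cdot ζ).cexp

theorem fderiv_expCdot (ζ : Fin d → ℂ) (x : EuclideanSpace ℝ (Fin d)) (j : Fin d) :
    fderiv ℝ (expCdot ζ) x (EuclideanSpace.single j 1) = ζ j * expCdot ζ x := by
  have h1 : HasLineDerivAt ℝ (expCdot ζ) (ζ j * expCdot ζ x) x (EuclideanSpace.single j 1) := by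
    rw [HasLineDerivAt]
    have h2 : ∀ t : ℝ, cdot (x + t • EuclideanSpace.single j (1 : ℝ)) ζ = cdot x ζ + t * ζ j := by
      intro t
      simp [cdot, add_mul, Finset.sum_add_distrib, apply_ite Complex.ofReal]
    have h3 : HasDerivAt (fun t : ℝ => cdot x ζ + (t : ℂ) * ζ j) (ζ j) 0 := by
      have := ((Complex.ofRealCLM.hasDerivAt (x := (0 : ℝ))).mul_const (ζ j)).const_add (cdot x ζ)
      simpa using this
    have h4 := h3.cexp
    have h5 : (fun t : ℝ => expCdot ζ (x + t • EuclideanSpace.single j (1 : ℝ)))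
        = fun t : ℝ => Complex.exp (cdot x ζ + (t : ℂ) * ζ j) := by
      funext t
      rw [expCdot, h2]
    have h6 : ζ j * expCdot ζ x = Complex.exp (cdot x ζ + ((0 : ℝ) : ℂ) * ζ j) * ζ j := by
      simp [expCdot, mul_comm]
    rw [h5, h6]
    exact h4
  rw [← ((contDiff_expCdot ζ).differentiable (by simp) x).lineDeriv_eq_fderiv]
  exact h1.lineDeriv

theorem HasWeakGrad.one_add {u : EuclideanSpace ℝ (Fin d) → ℂ}
    {G : EuclideanSpace ℝ (Fin d) → EuclideanSpace ℂ (Fin d)} (h : HasWeakGrad u G) :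
    HasWeakGrad (fun x => 1 + u x) G := by
  refine ⟨(locallyIntegrable_const 1).add h.1, h.2.1, fun j φ hφ hc => ?_⟩
  have h1 := hasWeakGrad_one.2.2 j φ hφ hc
  have hd : Continuous fun x => fderiv ℝ φ x (EuclideanSpace.single j 1) :=
    (hφ.continuous_fderiv (by simp)).clm_apply continuous_const
  have hdc : HasCompactSupport fun x => fderiv ℝ φ x (EuclideanSpace.single j 1) :=
    hc.fderiv_apply (𝕜 := ℝ) _
  have i1 := integrable_mul_of_hasCompactSupport (locallyIntegrable_const (1 : ℂ)) hd hdc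
  have i2 := integrable_mul_of_hasCompactSupport h.1 hd hdc
  rw [← h.2.2 j φ hφ hc]
  simp only [add_mul]
  rw [integral_add i1 i2, h1]
  simp

theorem memLp_smul_of_continuous {F : Type*} [NormedAddCommGroup F] [NormedSpace ℂ F]
    {K : Set (EuclideanSpace ℝ (Fin d))} (hK : IsCompact K) {w : EuclideanSpace ℝ (Fin d) → ℂ}
    (hw : Continuous w) {g : EuclideanSpace ℝ (Fin d) → F} (hg : MemLp g 2 (volume.restrict K)) :
    MemLp (fun x => w x • g x) 2 (volume.restrict K) := by
  obtain ⟨C, hC⟩ := hK.exists_bound_of_continuousOn hw.continuousOn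
  refine hg.of_le_mul (c := C) (hw.aestronglyMeasurable.smul hg.1) ?_
  filter_upwards [ae_restrict_mem hK.measurableSet] with x hx
  rw [norm_smul]
  gcongr
  exact hC x hx

section
variable {ζ : Fin d → ℂ} {E : L2Space d →L[ℂ] L2Space d} {D : Fin d → L2Space d →L[ℂ] L2Space d}
  {h : L2Space d} {τ : EuclideanSpace ℝ (Fin d) → ℂ}

/-- The weak gradient of `e^{x·ζ} (1 + ψ)`. -/
noncomputable def expGrad (ζ : Fin d → ℂ) (ψ : EuclideanSpace ℝ (Fin d) → ℂ)
    (G : EuclideanSpace ℝ (Fin d) → EuclideanSpace ℂ (Fin d)) (x : EuclideanSpace ℝ (Fin d)) :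
    EuclideanSpace ℂ (Fin d) := expCdot ζ x • G x + (1 + ψ x) • grad (expCdot ζ) x

theorem expGrad_apply (ζ : Fin d → ℂ) (ψ : EuclideanSpace ℝ (Fin d) → ℂ)
    (G : EuclideanSpace ℝ (Fin d) → EuclideanSpace ℂ (Fin d)) (x) (j : Fin d) :
    expGrad ζ ψ G x j = expCdot ζ x * (G x j + (1 + ψ x) * ζ j) := by
  simp [expGrad, fderiv_expCdot]; ring

theorem HasWeakGrad.exp_mul {ψ : EuclideanSpace ℝ (Fin d) → ℂ}
    {G : EuclideanSpace ℝ (Fin d) → EuclideanSpace ℂ (Fin d)} (hG : HasWeakGrad ψ G) (ζ : Fin d → ℂ) :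
    HasWeakGrad (fun x => expCdot ζ x * (1 + ψ x)) (expGrad ζ ψ G) := by
  have := hG.one_add.mul_contDiff (contDiff_expCdot ζ)
  refine this.congr (.of_forall fun x => ?_) (.of_forall fun x => rfl)
  simp [mul_comm]

theorem memH1Loc_exp_mul {ψ : EuclideanSpace ℝ (Fin d) → ℂ}
    {G : EuclideanSpace ℝ (Fin d) → EuclideanSpace ℂ (Fin d)} (hG : HasWeakGrad ψ G)
    (hψ : ∀ K : Set (EuclideanSpace ℝ (Fin d)), IsCompact K → MemLp ψ 2 (volume.restrict K))
    (hG2 : ∀ K : Set (EuclideanSpace ℝ (Fin d)), IsCompact K → MemLp G 2 (volume.restrict K))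
    (ζ : Fin d → ℂ) : MemH1Loc (fun x => expCdot ζ x * (1 + ψ x)) := by
  have h1 : ∀ K : Set (EuclideanSpace ℝ (Fin d)), IsCompact K →
      MemLp (fun x => 1 + ψ x) 2 (volume.restrict K) := fun K hK => by
    have : IsFiniteMeasure (volume.restrict K) := ⟨by simpa using hK.measure_lt_top⟩
    have h2 : MemLp (fun _ : EuclideanSpace ℝ (Fin d) => (1 : ℂ)) 2 (volume.restrict K) := memLp_const 1
    exact h2.add (hψ K hK)
  refine ⟨fun K hK => by
    simpa only [smul_eq_mul] using memLp_smul_of_continuous (w := expCdot ζ) (g := fun x => 1 + ψ x) hK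
      (contDiff_expCdot ζ).continuous (h1 K hK), _,
    hG.exp_mul ζ, fun K hK => ?_⟩
  have a1 := memLp_smul_of_continuous hK (contDiff_expCdot ζ).continuous (hG2 K hK)
  suffices a2 : MemLp (fun x => (1 + ψ x) • grad (expCdot ζ) x) 2 (volume.restrict K) from a1.add a2
  have e : (fun x => (1 + ψ x) • grad (expCdot ζ) x) =
      fun x => expCdot ζ x • ((1 + ψ x) • (WithLp.toLp 2 ζ : EuclideanSpace ℂ (Fin d))) := by
    funext x
    ext j
    simp [fderiv_expCdot]; ring
  rw [e]
  refine memLp_smul_of_continuous hK (contDiff_expCdot ζ).continuous ?_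
  exact (ContinuousLinearMap.toSpanSingleton ℂ (WithLp.toLp 2 ζ : EuclideanSpace ℂ (Fin d))).comp_memLp'
    (h1 K hK)

theorem fderiv_expCdot_mul (hτ : ContDiff ℝ ∞ τ) (x) (j : Fin d) :
    fderiv ℝ (fun x => expCdot ζ x * τ x) x (EuclideanSpace.single j 1) =
      expCdot ζ x * (ζ j * τ x + fderiv ℝ τ x (EuclideanSpace.single j 1)) := by
  have := (((contDiff_expCdot ζ).differentiable (by simp) x).hasFDerivAt.mul
    ((hτ.differentiable (by simp) x).hasFDerivAt)).fderiv
  change fderiv ℝ (expCdot ζ * τ) x _ = _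
  rw [this]
  simp [fderiv_expCdot]
  ring

/-- With v = e^{x·ζ} τ the Dirichlet form equals -∫ ψ (Δ - 2ζ·∇)v, which the inverse transform turns
into the symbol. -/
theorem IsWeightOp.integral_expGrad (hζ : ∑ j, ζ j * ζ j = 0) (hE : IsWeightOp (invSqrtSymbol ζ) E)
    (hD : ∀ j, IsWeightOp (fun ξ => 2 * Real.pi * Complex.I * ξ j * invSqrtSymbol ζ ξ) (D j))
    (hτ : ContDiff ℝ ∞ τ) (v : SchwartzMap (EuclideanSpace ℝ (Fin d)) ℂ) (hvc : HasCompactSupport v)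
    (hv : ∀ x, v x = expCdot ζ x * τ x) :
    ∫ x, ∑ j, expGrad ζ (unweight (E h)) (unweightGrad D h) x j *
        fderiv ℝ τ x (EuclideanSpace.single j 1) =
      -∫ ξ, invSqrtSymbol ζ ξ * h ξ * (freqSymbol ζ ξ * (FourierTransformInv.fourierInv v :
        SchwartzMap (EuclideanSpace ℝ (Fin d)) ℂ) ξ) := by
  have hG := hE.hasWeakGrad hD h
  set e : Fin d → EuclideanSpace ℝ (Fin d) := fun j => EuclideanSpace.single j 1 with he
  set dv : Fin d → SchwartzMap (EuclideanSpace ℝ (Fin d)) ℂ := fun j => ∂_{e j} v with hdv0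
  set ddv : Fin d → SchwartzMap (EuclideanSpace ℝ (Fin d)) ℂ := fun j => ∂_{e j} (dv j) with hddv0
  have hdvx : ∀ j x, dv j x = fderiv ℝ v x (EuclideanSpace.single j 1) :=
    fun j x => lineDeriv_schwartz_apply v j x
  have hddvx : ∀ j x, ddv j x = fderiv ℝ (dv j) x (EuclideanSpace.single j 1) :=
    fun j x => lineDeriv_schwartz_apply (dv j) j x
  have hdv : ∀ x j, (dv j) x = expCdot ζ x * (ζ j * τ x + fderiv ℝ τ x (e j)) := by
    intro x j
    rw [hdvx, ← fderiv_expCdot_mul hτ]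
    congr 2
    exact funext hv
  -- Substitute e^{x·ζ} ∇τ = ∇v - ζ v; the terms carrying ζ·ζ vanish.
  have hpt : ∀ x, ∑ j, expGrad ζ (unweight (E h)) (unweightGrad D h) x j *
      fderiv ℝ τ x (EuclideanSpace.single j 1) =
      ∑ j, (unweight (D j h) x * (dv j) x - ζ j * (unweight (D j h) x * v x)
        + ζ j * (unweight (E h) x * (dv j) x) + ζ j * (1 * (dv j) x)) := by
    intro x
    rw [← sub_eq_zero, ← Finset.sum_sub_distrib]
    have : ∑ j, (1 + unweight (E h) x) * v x * (ζ j * ζ j) = 0 := by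
      rw [← Finset.mul_sum, hζ, mul_zero]
    rw [← neg_eq_zero, ← this, ← Finset.sum_neg_distrib]
    refine Finset.sum_congr rfl fun j _ => ?_
    rw [expGrad_apply, hdv, hv]
    simp only [unweightGrad, he]
    ring
  simp_rw [hpt]
  have i1 : ∀ j, Integrable fun x => unweight (D j h) x * (dv j) x :=
    fun j => integrable_unweight_mul _ _
  have i2 : ∀ j, Integrable fun x => ζ j * (unweight (D j h) x * v x) :=
    fun j => (integrable_unweight_mul _ _).const_mul _
  have i3 : ∀ j, Integrable fun x => ζ j * (unweight (E h) x * (dv j) x) :=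
    fun j => (integrable_unweight_mul _ _).const_mul _
  have i4 : ∀ j, Integrable fun x => ζ j * (1 * (dv j) x) := fun j => by
    simpa using ((dv j).integrable (μ := volume)).const_mul (ζ j)
  have hdc : ∀ j, HasCompactSupport (dv j) := fun j => by
    have he' : (dv j : EuclideanSpace ℝ (Fin d) → ℂ) =
        fun x => fderiv ℝ v x (EuclideanSpace.single j 1) := funext (hdvx j)
    rw [he']
    exact hvc.fderiv_apply (𝕜 := ℝ) _
  have k1 : ∀ j, ∫ x, unweight (D j h) x * (dv j) x
      = -∫ x, unweight (E h) x * (ddv j) x := fun j => by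
    have := hG.2.2 j (dv j) ((dv j).smooth ⊤) (hdc j)
    simp only [← hddvx, unweightGrad] at this
    rw [this, neg_neg]
  have k2 : ∀ j, ∫ x, unweight (D j h) x * v x = -∫ x, unweight (E h) x * (dv j) x := fun j => by
    have := hG.2.2 j v (v.smooth ⊤) hvc
    simp only [← hdvx, unweightGrad] at this
    rw [this, neg_neg]
  -- The 1 in 1 + ψ contributes only integrals of derivatives of `v`, which are zero.
  have k4 : ∀ j, ∫ x, (1 : ℂ) * (dv j) x = 0 := fun j => by
    have := hasWeakGrad_one.2.2 j v (v.smooth ⊤) hvc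
    simp only [← hdvx] at this
    simpa using this
  have i12 : ∀ j, Integrable fun x => unweight (D j h) x * (dv j) x
      - ζ j * (unweight (D j h) x * v x) := fun j => (i1 j).sub (i2 j)
  have i123 : ∀ j, Integrable fun x => unweight (D j h) x * (dv j) x
      - ζ j * (unweight (D j h) x * v x) + ζ j * (unweight (E h) x * (dv j) x) :=
    fun j => (i12 j).add (i3 j)
  rw [integral_finsetSum _ fun j _ => (i123 j).fun_add (i4 j)]
  have k5 : ∀ j, ∫ x, (unweight (D j h) x * (dv j) x - ζ j * (unweight (D j h) x * v x)
        + ζ j * (unweight (E h) x * (dv j) x) + ζ j * (1 * (dv j) x))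
      = -∫ x, unweight (E h) x * (ddv j - (2 * ζ j) • dv j) x := by
    intro j
    rw [integral_add (i123 j) (i4 j),
      integral_add (i12 j) (i3 j), integral_sub (i1 j) (i2 j), integral_const_mul,
      integral_const_mul, integral_const_mul, k1, k2, k4]
    have : ∀ x, unweight (E h) x * (ddv j - (2 * ζ j) • dv j) x =
        unweight (E h) x * (ddv j) x - 2 * ζ j * (unweight (E h) x * (dv j) x) := by
      intro x
      rw [sub_apply, smul_apply, smul_eq_mul]; ring
    simp_rw [this]
    rw [integral_sub (integrable_unweight_mul _ _) ((integrable_unweight_mul _ _).const_mul _),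
      integral_const_mul]
    ring
  simp_rw [k5]
  rw [Finset.sum_neg_distrib, ← integral_finsetSum _ fun j _ => integrable_unweight_mul _ _]
  congr 1
  have k6 := hE h (adjointLaplace ζ v)
  simp_rw [fourierInv_adjointLaplace] at k6
  rw [← k6]
  refine integral_congr_ae (.of_forall fun x => ?_)
  simp only [adjointLaplace, sum_apply, Finset.mul_sum, hddv0, hdv0, he]

/-- The form depends only on the product of its two arguments, so the exponential moves from the
solution to the test function. -/
theorem IsLogGradient.mq_exp {γ : EuclideanSpace ℝ (Fin d) → ℝ} {ρ : ℝ}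
    {f : Fin d → EuclideanSpace ℝ (Fin d) → ℝ} (hf : IsLogGradient γ ρ f)
    (hG : HasWeakGrad (unweight (E h)) (unweightGrad D h))
    (hτ : ContDiff ℝ ∞ τ) (v : SchwartzMap (EuclideanSpace ℝ (Fin d)) ℂ)
    (hv : ∀ x, v x = expCdot ζ x * τ x) :
    mq γ (fun x => expCdot ζ x * (1 + unweight (E h) x)) τ = mq γ (fun _ => 1) v +
      ∫ x, ∑ j, ((f j x : ℂ) ^ 2 * (v x * unweight (E h) x)
            - (f j x : ℂ) * (v x * unweight (D j h) x
              + fderiv ℝ v x (EuclideanSpace.single j 1) * unweight (E h) x)) := by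
  obtain ⟨B, hB⟩ := hf.bounded
  have hm := hf.measurable
  have j1 : ∀ j, Integrable (fun x => (f j x : ℂ) ^ 2 * (v x * unweight (E h) x)) := fun j => by
    have := integrable_bdd_mul_unweight (f := fun x => f j x ^ 2) (B := B ^ 2) ((hm j).pow_const 2)
      (fun x => by have := hB j x; rw [abs_pow]; gcongr) (E h) v
    simpa using this
  have j2 : ∀ j, Integrable (fun x => (f j x : ℂ) * (v x * unweight (D j h) x
      + fderiv ℝ v x (EuclideanSpace.single j 1) * unweight (E h) x)) := fun j => by
    have := (integrable_bdd_mul_unweight (hm j) (hB j) (D j h) v).add (integrable_bdd_mul_unweight (hm j)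
      (hB j) (E h) (∂_{(EuclideanSpace.single j 1 : EuclideanSpace ℝ (Fin d))} v))
    refine this.congr (.of_forall fun x => ?_)
    simp only [Pi.add_apply, lineDeriv_schwartz_apply]; ring
  have j3 : ∀ j, Integrable (fun x => (f j x : ℂ) ^ 2 * v x) := fun j => by
    refine (v.integrable (μ := volume)).bdd_mul (c := B ^ 2)
      ((Complex.measurable_ofReal.comp (hm j)).pow_const 2).aestronglyMeasurable (.of_forall fun x => ?_)
    have := hB j x
    rw [norm_pow, Complex.norm_real, Real.norm_eq_abs]; gcongr
  have j4 : ∀ j, Integrable (fun x => (f j x : ℂ) * fderiv ℝ v x (EuclideanSpace.single j 1)) :=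
    fun j => by
      have := hf.integrable_potential j (∂_{(EuclideanSpace.single j 1 : EuclideanSpace ℝ (Fin d))} v)
      simpa only [lineDeriv_schwartz_apply] using this
  have j5 : Integrable fun x => ∑ j, ((f j x : ℂ) ^ 2 * v x -
      (f j x : ℂ) * fderiv ℝ v x (EuclideanSpace.single j 1)) :=
    integrable_finsetSum _ fun j _ => (j3 j).sub (j4 j)
  have j6 : Integrable fun x => ∑ j, ((f j x : ℂ) ^ 2 * (v x * unweight (E h) x)
      - (f j x : ℂ) * (v x * unweight (D j h) x
        + fderiv ℝ v x (EuclideanSpace.single j 1) * unweight (E h) x)) :=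
    integrable_finsetSum _ fun j _ => (j1 j).sub (j2 j)
  rw [hf.mq_eq _ _ _ (hG.exp_mul ζ) hτ, hf.mq_one, ← integral_add j5 j6]
  refine integral_congr_ae (.of_forall fun x => ?_)
  dsimp only
  rw [← Finset.sum_add_distrib]
  refine Finset.sum_congr rfl fun j _ => ?_
  have hdv : fderiv ℝ v x (EuclideanSpace.single j 1) =
      expCdot ζ x * (ζ j * τ x + fderiv ℝ τ x (EuclideanSpace.single j 1)) := by
    rw [← fderiv_expCdot_mul hτ]
    congr 2
    exact funext hv
  rw [hdv, hv, expGrad_apply]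
  simp only [unweightGrad]
  ring

theorem isSchrodingerSolution_exp {γ : EuclideanSpace ℝ (Fin d) → ℝ} {ρ : ℝ}
    {f : Fin d → EuclideanSpace ℝ (Fin d) → ℝ} (hf : IsLogGradient γ ρ f)
    (hζ : ∑ j, ζ j * ζ j = 0) (hE : IsWeightOp (invSqrtSymbol ζ) E)
    (hD : ∀ j, IsWeightOp (fun ξ => 2 * Real.pi * Complex.I * ξ j * invSqrtSymbol ζ ξ) (D j))
    (heq : ∀ v : SchwartzMap (EuclideanSpace ℝ (Fin d)) ℂ,
      (∫ x, ∑ j, ((f j x : ℂ) ^ 2 * (v x * unweight (E h) x)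
            - (f j x : ℂ) * (v x * unweight (D j h) x
              + fderiv ℝ v x (EuclideanSpace.single j 1) * unweight (E h) x)))
        + mq γ (fun _ => 1) v = ∫ ξ, invSqrtSymbol ζ ξ * h ξ * (freqSymbol ζ ξ *
          (FourierTransformInv.fourierInv v : SchwartzMap (EuclideanSpace ℝ (Fin d)) ℂ) ξ)) :
    IsSchrodingerSolution γ (fun x => Complex.exp (cdot x ζ) * (1 + unweight (E h) x)) := by
  have hG := hE.hasWeakGrad hD h
  refine ⟨memH1Loc_exp_mul hG (fun K hK => memLp_unweight _ hK)
    (fun K hK => memLp_unweightGrad D h hK) ζ, fun τ hτ hc => ?_⟩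
  have hvs : ContDiff ℝ ∞ fun x => expCdot ζ x * τ x := (contDiff_expCdot ζ).mul hτ
  have hvc : HasCompactSupport fun x => expCdot ζ x * τ x := hc.mul_left
  set v : SchwartzMap (EuclideanSpace ℝ (Fin d)) ℂ := hvc.toSchwartzMap hvs
  have h1 := hE.integral_expGrad (h := h) hζ hD hτ v hvc fun x => rfl
  have h2 := hf.mq_exp hG hτ v fun x => rfl
  have h3 := heq v
  have h4 : ∫ x, ∑ j, weakGrad (fun x => Complex.exp (cdot x ζ) * (1 + unweight (E h) x)) x j *
      fderiv ℝ τ x (EuclideanSpace.single j 1) = ∫ x, ∑ j,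
        expGrad ζ (unweight (E h)) (unweightGrad D h) x j *
        fderiv ℝ τ x (EuclideanSpace.single j 1) := by
    refine integral_congr_ae ?_
    filter_upwards [(hG.exp_mul ζ).weakGrad_ae_eq] with x hx
    have : weakGrad (fun x => Complex.exp (cdot x ζ) * (1 + unweight (E h) x)) x = _ := hx
    rw [this]
  change _ + mq γ (fun x => expCdot ζ x * (1 + unweight (E h) x)) τ = 0
  rw [h4, h1, h2]
  linear_combination h3
end

end Solution

/-! ### Solutions with small remainder, and the theorem. -/

section Main

open scoped ComplexConjugate
variable {d : ℕ}

theorem Admissible.exists_isNull {k : EuclideanSpace ℝ (Fin d)} {s r : ℝ}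
    {η₁ η₂ : EuclideanSpace ℝ (Fin d)} (h : Admissible k s r η₁ η₂) (hs : 0 ≤ s) (j : Fin 2) :
    ∃ e b, IsNull (zeta k s r η₁ η₂ j) s e b := by
  fin_cases j
  · exact ⟨_, _, h.isNull_zero hs⟩
  · exact ⟨_, _, h.isNull_one hs⟩

theorem tendsto_zero_of_sq_le {f g : ℕ → ℝ≥0∞} (h : ∀ n, f n ^ 2 ≤ g n) (hg : Tendsto g atTop (𝓝 0)) :
    Tendsto f atTop (𝓝 0) := by
  have h1 : Tendsto (fun n => g n ^ (2 : ℝ)⁻¹) atTop (𝓝 0) := by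
    have := (ENNReal.continuous_rpow_const (y := (2 : ℝ)⁻¹)).tendsto 0 |>.comp hg
    simpa using! this
  refine tendsto_of_tendsto_of_tendsto_of_le_of_le tendsto_const_nhds h1 (fun _ => zero_le) fun n => ?_
  rw [ENNReal.le_rpow_inv_iff (by norm_num), ENNReal.rpow_two]
  exact h n

theorem IsFunction.xnorm_neg_sq_le {ζ : Fin d → ℂ}
    {Q : TemperedDistribution (EuclideanSpace ℝ (Fin d)) ℂ} {F : EuclideanSpace ℝ (Fin d) → ℂ}
    (h : IsFunction (FourierTransform.fourier Q) F) :
    XNorm (-1 / 2) ζ Q ^ 2 ≤ ∫⁻ ξ, ‖F ξ‖ₑ ^ 2 * (ENNReal.ofReal (absSymbol ζ ξ))⁻¹ :=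
  (pow_le_pow_left₀ zero_le (xnorm_neg_le h) 2).trans (eLpNorm_invSqrtSymbol_mul_sq_le ζ F)

/-- The smallness of f, or of f₁, controls the first-order terms, and s ≥ Λ controls the zero-order
ones. The order of quantifiers matters: ε depends only on d and ρ, and Λ only on γ, f and ε. -/
theorem exists_cgo_solution (d : ℕ) (ρ : ℝ) : ∃ ε : ℝ, 0 < ε ∧
    ∀ (γ : EuclideanSpace ℝ (Fin d) → ℝ) (f : Fin d → EuclideanSpace ℝ (Fin d) → ℝ),
      IsLogGradient γ ρ f → (gradLogNorm γ ≤ ENNReal.ofReal ε ∨ IsC1 γ) →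
      ∃ Λ : ℝ, ∀ (ζ : Fin d → ℂ) (s : ℝ) (e b : EuclideanSpace ℝ (Fin d)) (δ : ℝ≥0∞),
        IsNull ζ s e b → 13 ≤ s → Λ ≤ s → δ ≠ ⊤ →
        ∫⁻ ξ, ‖fourierPotential f ξ‖ₑ ^ 2 * (ENNReal.ofReal (absSymbol ζ ξ))⁻¹ ≤ δ →
        ∃ (ψ : EuclideanSpace ℝ (Fin d) → ℂ) (Ψ : TemperedDistribution (EuclideanSpace ℝ (Fin d)) ℂ),
          IsFunction Ψ ψ ∧
          IsSchrodingerSolution γ (fun x => Complex.exp (cdot x ζ) * (1 + ψ x)) ∧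
          XNorm (1 / 2) ζ Ψ ^ 2 ≤ 4 * δ := by
  obtain ⟨K, hK, hops⟩ := exists_weightOps d
  obtain ⟨W, hW, hpert⟩ := IsSplitting.exists_perturbation d (ρ + 2)
  -- Makes the first-order contribution 2dεKW at most 1/4; d + 1 avoids a zero denominator.
  set ε : ℝ := 1 / (8 * (d + 1) * K * W) with hε
  have hε0 : 0 < ε := by positivity
  refine ⟨ε, hε0, fun γ f hf hcond => ?_⟩
  obtain ⟨B₀, B₂, f', f₁, f₂, hae, hsplit⟩ := hf.exists_splitting hε0 hcond
  have hB₀ : 0 ≤ B₀ := le_trans (by positivity) (hsplit.bound_sq 0)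
  have hB₂ : 0 ≤ B₂ := (abs_nonneg _).trans (hsplit.bound_div 0)
  -- For s beyond this value the zero-order contribution is at most 1/4.
  refine ⟨4 * (W * ((B₀ + B₂) * K)), fun ζ s e b δ hζ hs hΛ hδ hle => ?_⟩
  have hs0 : 0 < s := by linarith
  have hpos := hζ.ae_absSymbol_pos hs
  obtain ⟨⟨A₀, hw⟩, E, D, hE, hD, hEn, hDn⟩ := hops ζ s e b hζ hs
  obtain ⟨A, hA, hAi⟩ := hpert B₀ ε B₂ f' f₁ f₂ hsplit ζ E D hpos hE hD
  have hA2 : ‖A‖ ≤ 1 / 2 := by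
    refine hA.trans ?_
    have h1 : W * ((B₀ + B₂) * (‖E‖ * ‖E‖)) ≤ 1 / 4 := by
      calc W * ((B₀ + B₂) * (‖E‖ * ‖E‖)) ≤ W * ((B₀ + B₂) * (K / s)) := by gcongr
        _ = W * ((B₀ + B₂) * K) / s := by ring
        _ ≤ 1 / 4 := by rw [div_le_iff₀ hs0]; linarith
    have h2 : W * ∑ j, 2 * ε * (‖D j‖ * ‖E‖) ≤ 1 / 4 := by
      calc W * ∑ j, 2 * ε * (‖D j‖ * ‖E‖) ≤ W * ∑ _j : Fin d, 2 * ε * K := by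
            gcongr with j; exact hDn j
        _ = W * (d * (2 * ε * K)) := by simp
        _ ≤ W * ((d + 1) * (2 * ε * K)) := by gcongr; linarith
        _ = 1 / 4 := by rw [hε]; field_simp; norm_num
    linarith
  obtain ⟨Q, hQ, hQF⟩ := hf.exists_potential
  have hqsq := (eLpNorm_invSqrtSymbol_mul_sq_le ζ (fourierPotential f)).trans hle
  have hqm : MemLp (fun ξ => invSqrtSymbol ζ ξ * fourierPotential f ξ) 2 := by
    refine ⟨((measurable_invSqrtSymbol ζ).mul
      hf.continuous_fourierPotential.measurable).aestronglyMeasurable, ?_⟩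
    by_contra hcon
    rw [not_lt, top_le_iff] at hcon
    rw [hcon] at hqsq
    exact hδ (top_le_iff.1 (by simpa using hqsq))
  obtain ⟨h, hh, hsol⟩ := exists_solution hpos hA2 (hqm.toLp _)
  refine ⟨unweight (E h), unweightDist (E h), isFunction_unweightDist _,
    isSchrodingerSolution_exp hf hζ.sum_sq hE hD fun v => ?_, ?_⟩
  · rw [← hsol v, hAi]
    congr 1
    · refine integral_congr_ae ?_
      filter_upwards [hae] with x hx
      simp only [hx]
    · have h1 := (hQF (FourierTransformInv.fourierInv v)).2
      rw [TemperedDistribution.fourier_apply, FourierTransform.fourier_fourierInv_eq, hQ] at h1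
      rw [h1, inner_eq_integral]
      refine integral_congr_ae ?_
      filter_upwards [hpos, testVec_ae_eq ζ v, hqm.coeFn_toLp] with ξ h2 h3 h4
      rw [h3, h4, map_mul, Complex.conj_conj, Complex.conj_ofReal]
      have := invSqrtSymbol_mul_sqrt h2
      linear_combination (-(fourierPotential f ξ * (FourierTransformInv.fourierInv v :
        SchwartzMap (EuclideanSpace ℝ (Fin d)) ℂ) ξ)) * this
  · have h1 := xnorm_unweightDist_le hw hE h
    have h2 : ‖h‖ₑ ≤ 2 * ‖hqm.toLp _‖ₑ := by
      have h3 := ENNReal.ofReal_le_ofReal hh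
      rwa [ENNReal.ofReal_mul zero_le_two, ENNReal.ofReal_ofNat, ofReal_norm, ofReal_norm] at h3
    rw [Lp.enorm_toLp] at h2
    calc XNorm (1 / 2) ζ (unweightDist (E h)) ^ 2
        ≤ (2 * eLpNorm (fun ξ => invSqrtSymbol ζ ξ * fourierPotential f ξ) 2 volume) ^ 2 := by
          gcongr; exact h1.trans h2
      _ = 4 * eLpNorm (fun ξ => invSqrtSymbol ζ ξ * fourierPotential f ξ) 2 volume ^ 2 := by
          rw [mul_pow]; norm_num
      _ ≤ 4 * δ := by gcongr

end Main

end CGO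

theorem mainTheorem4 (d : ℕ) (hd : 3 ≤ d) (x₀ : EuclideanSpace ℝ (Fin d)) (R : ℝ) :
    ∃ ε : ℝ, 0 < ε ∧
      ∀ (γ : Fin 2 → EuclideanSpace ℝ (Fin d) → ℝ) (c : ℝ), 0 < c →
        (∀ i, CGO.MemW1Inf (γ i)) →
        (∀ i, ∀ᵐ x ∂volume, c < γ i x) →
        (∀ i, ∀ᵐ x ∂volume, x ∉ Metric.ball x₀ R → γ i x = 1) →
        ∃ Q : Fin 2 → TemperedDistribution (EuclideanSpace ℝ (Fin d)) ℂ,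
          (∀ i, CGO.IsPotential (γ i) (Q i)) ∧
          ∀ k : EuclideanSpace ℝ (Fin d),
            ∃ (s r : ℕ → ℝ) (η₁ η₂ : ℕ → EuclideanSpace ℝ (Fin d)),
              (∀ n, CGO.Admissible k (s n) (r n) (η₁ n) (η₂ n)) ∧
              Tendsto s atTop atTop ∧
              (∀ i j : Fin 2, Tendsto
                (fun n => CGO.XNorm (-1 / 2) (CGO.zeta k (s n) (r n) (η₁ n) (η₂ n) j) (Q i))
                atTop (𝓝 0)) ∧
              ∀ i : Fin 2, (CGO.gradLogNorm (γ i) ≤ ENNReal.ofReal ε ∨ CGO.IsC1 (γ i)) →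
                ∃ (ψ : ℕ → EuclideanSpace ℝ (Fin d) → ℂ)
                  (Ψ : ℕ → TemperedDistribution (EuclideanSpace ℝ (Fin d)) ℂ),
                  (∀ n, CGO.IsFunction (Ψ n) (ψ n)) ∧
                  (∀ n, CGO.IsSchrodingerSolution (γ i) (fun x =>
                    Complex.exp (CGO.cdot x (CGO.zeta k (s n) (r n) (η₁ n) (η₂ n) i)) *
                      (1 + ψ n x))) ∧
                  Tendsto
                    (fun n => CGO.XNorm (1 / 2) (CGO.zeta k (s n) (r n) (η₁ n) (η₂ n) i) (Ψ n))
                    atTop (𝓝 0) := by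
  -- A ball about the origin containing the given one, so that ε depends only on d and the ball.
  set ρ : ℝ := ‖x₀‖ + |R| + 1
  obtain ⟨ε, hε, hcgo⟩ := CGO.exists_cgo_solution d ρ
  refine ⟨ε, hε, fun γ c hc hγ hγc hγ1 => ?_⟩
  have hγρ : ∀ i, ∀ᵐ x, ρ < ‖x‖ → γ i x = 1 := fun i => by
    filter_upwards [hγ1 i] with x hx hρx
    refine hx fun hmem => ?_
    rw [Metric.mem_ball, dist_eq_norm] at hmem
    have h1 := norm_le_norm_add_norm_sub' x x₀
    have h2 := le_abs_self R
    change ‖x₀‖ + |R| + 1 < ‖x‖ at hρx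
    linarith
  choose f hf using fun i => CGO.exists_isLogGradient (hγ i) hc (hγc i) (hγρ i)
  choose Q hQ hQF using fun i => (hf i).exists_potential
  refine ⟨Q, hQ, fun k => ?_⟩
  -- The sequence must be chosen before it is known for which i the condition of (b) holds; where it
  -- fails, Λ = 0 is a harmless default.
  have hΛ : ∀ i, ∃ Λ : ℝ, (CGO.gradLogNorm (γ i) ≤ ENNReal.ofReal ε ∨ CGO.IsC1 (γ i)) →
      ∀ (ζ : Fin d → ℂ) (s : ℝ) (e b : EuclideanSpace ℝ (Fin d)) (δ : ℝ≥0∞),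
        CGO.IsNull ζ s e b → 13 ≤ s → Λ ≤ s → δ ≠ ⊤ →
        ∫⁻ ξ, ‖CGO.fourierPotential (f i) ξ‖ₑ ^ 2 * (ENNReal.ofReal (CGO.absSymbol ζ ξ))⁻¹ ≤ δ →
        ∃ (ψ : EuclideanSpace ℝ (Fin d) → ℂ) (Ψ : TemperedDistribution (EuclideanSpace ℝ (Fin d)) ℂ),
          CGO.IsFunction Ψ ψ ∧
          CGO.IsSchrodingerSolution (γ i) (fun x => Complex.exp (CGO.cdot x ζ) * (1 + ψ x)) ∧
          CGO.XNorm (1 / 2) ζ Ψ ^ 2 ≤ 4 * δ := fun i => by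
    by_cases h : CGO.gradLogNorm (γ i) ≤ ENNReal.ofReal ε ∨ CGO.IsC1 (γ i)
    · obtain ⟨Λ, hΛ⟩ := hcgo (γ i) (f i) (hf i) h
      exact ⟨Λ, fun _ => hΛ⟩
    · exact ⟨0, fun h' => absurd h' h⟩
  choose Λ hΛ using hΛ
  have hcont := fun i => (hf i).continuous_fourierPotential
  -- Summing over i lets one sequence of parameters serve both potentials.
  set q : EuclideanSpace ℝ (Fin d) → ℝ≥0∞ := fun ξ => ∑ i, ‖CGO.fourierPotential (f i) ξ‖ₑ ^ 2 with hq
  have hqm : Measurable q :=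
    Finset.measurable_fun_sum _ fun i _ => (hcont i).measurable.enorm.pow_const 2
  have hqb : ∀ M : ℝ, ∃ B : NNReal, ∀ ξ, ‖ξ‖ ≤ M → q ξ ≤ B := fun M => by
    have hqc : Continuous q := continuous_finsetSum _ fun i _ =>
      (ENNReal.continuous_pow 2).comp (hcont i).enorm
    have hfin : ∀ ξ, q ξ ≠ ⊤ := fun ξ => by simp [hq]
    obtain ⟨B, hB⟩ := (isCompact_closedBall (0 : EuclideanSpace ℝ (Fin d)) M).bddAbove_image
      (f := fun ξ => (q ξ).toNNReal)
      (ENNReal.continuousOn_toNNReal.comp_continuous hqc hfin).continuousOn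
    refine ⟨B, fun ξ hξ => ?_⟩
    rw [← ENNReal.coe_toNNReal (hfin ξ)]
    exact_mod_cast hB ⟨ξ, by simpa using hξ, rfl⟩
  have hqi : ∫⁻ ξ, q ξ * (ENNReal.ofReal (1 + ‖(2 * Real.pi) • ξ‖ ^ 2))⁻¹ ≠ ⊤ := by
    simp only [hq, Finset.sum_mul]
    have hm : ∀ i, Measurable fun ξ => ‖CGO.fourierPotential (f i) ξ‖ₑ ^ 2 *
        (ENNReal.ofReal (1 + ‖(2 * Real.pi) • ξ‖ ^ 2))⁻¹ := fun i => by
      have := (hcont i).measurable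
      fun_prop
    rw [lintegral_finsetSum _ fun i _ => hm i]
    exact ENNReal.sum_ne_top.2 fun i _ => (hf i).lintegral_fourierPotential_ne_top
  choose s r η₁ η₂ hadm hs hint using fun n : ℕ => CGO.exists_admissible_lintegral_le hd k hqm hqb hqi
    (δ := ((n : ℝ≥0∞) + 1)⁻¹) (by simp) (max (max 13 n) (max (Λ 0) (Λ 1)))
  have hs13 : ∀ n, 13 ≤ s n := fun n => (le_max_left _ _).trans ((le_max_left _ _).trans (hs n))
  have hsΛ : ∀ n i, Λ i ≤ s n := fun n i => by
    refine le_trans ?_ ((le_max_right _ _).trans (hs n))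
    fin_cases i
    · exact le_max_left _ _
    · exact le_max_right _ _
  have hint' : ∀ n i j, ∫⁻ ξ, ‖CGO.fourierPotential (f i) ξ‖ₑ ^ 2 *
      (ENNReal.ofReal (CGO.absSymbol (CGO.zeta k (s n) (r n) (η₁ n) (η₂ n) j) ξ))⁻¹
        ≤ ((n : ℝ≥0∞) + 1)⁻¹ := fun n i j => by
    refine (lintegral_mono fun ξ => ?_).trans (hint n j)
    gcongr
    exact Finset.single_le_sum (f := fun i => ‖CGO.fourierPotential (f i) ξ‖ₑ ^ 2)
      (fun _ _ => zero_le) (Finset.mem_univ i)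
  have hδ : Tendsto (fun n : ℕ => ((n : ℝ≥0∞) + 1)⁻¹) atTop (𝓝 0) := by
    have := (tendsto_add_atTop_iff_nat 1).2 ENNReal.tendsto_inv_nat_nhds_zero
    simpa using this
  refine ⟨s, r, η₁, η₂, hadm, ?_, fun i j => ?_, fun i hi => ?_⟩
  · exact tendsto_atTop_mono (fun n => (le_max_right _ _).trans ((le_max_left _ _).trans (hs n)))
      tendsto_natCast_atTop_atTop
  · exact CGO.tendsto_zero_of_sq_le
      (fun n => (hQF i).xnorm_neg_sq_le.trans (hint' n i j)) hδ
  · have hsol : ∀ n, ∃ (ψ : EuclideanSpace ℝ (Fin d) → ℂ)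
        (Ψ : TemperedDistribution (EuclideanSpace ℝ (Fin d)) ℂ), CGO.IsFunction Ψ ψ ∧
          CGO.IsSchrodingerSolution (γ i) (fun x =>
            Complex.exp (CGO.cdot x (CGO.zeta k (s n) (r n) (η₁ n) (η₂ n) i)) * (1 + ψ x)) ∧
          CGO.XNorm (1 / 2) (CGO.zeta k (s n) (r n) (η₁ n) (η₂ n) i) Ψ ^ 2
            ≤ 4 * ((n : ℝ≥0∞) + 1)⁻¹ := fun n => by
      obtain ⟨e, b, hnull⟩ := (hadm n).exists_isNull (by linarith [hs13 n]) i
      exact hΛ i hi _ _ e b _ hnull (hs13 n) (hsΛ n i) (by simp) (hint' n i i)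
    choose ψ Ψ h1 h2 h3 using hsol
    refine ⟨ψ, Ψ, h1, h2, CGO.tendsto_zero_of_sq_le h3 ?_⟩
    have := ENNReal.Tendsto.const_mul (a := 4) hδ (Or.inr (by simp))
    simpa using this
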